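/- Let $\mathbb{K}$ be a field of characteristic zero. Species are positive linear species over $\mathbb{K}$ (functors $V\mapsto S[V]$ from finite sets and bijections to $\mathbb{K}$-vector spaces with $S[\emptyset]=0$), and an operad is a symmetric linear operad, i.e. a species $\mathcal O$ with a unit and partial compositions $\circ_\ast:\mathcal O[V_1\sqcup\{\ast\}]\otimes\mathcal O[V_2]\to\mathcal O[V_1\sqcup V_2]$ that are natural, commute when made at distinct points, are associative when nested, and are unital. For a species $G$, let $\mathbf{Free}_G$ be the free operad on $G$, whose partial composition is denoted $\circ^\xi_\ast$; it is spanned by trees with internal nodes labelled by elements of $G$, and $\mathbf{Free}_G^{(k)}$ is the subspecies spanned by trees with exactly $k$ internal nodes. For a subspecies $R$ of $\mathbf{Free}_G$, let $\mathrm{Ope}(G,R)=\mathbf{Free}_G/(R)$, where $(R)$ is the smallest operad ideal containing $R$. The operad $\mathrm{Ope}(G,R)$ is binary if $G[V]=0$ whenever $|V|\neq 2$, and quadratic if $R\subseteq\mathbf{Free}_G^{(2)}$. Let $\mathbb{K}\mathbf{G}[V]$ be the vector space with basis the simple graphs with vertex set $V$ (for $V\ne\emptyset$). It is an operad for the insertion: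 for graphs $g_1$ on $V_1\sqcup\{\ast\}$ and $g_2$ on $V_2$, $$g_1\circ_\ast g_2=\sum_{f:N_\ast\to V_2}(g_1\setminus\{\ast\})\cup g_2\cup\bigcup_{v\in N_\ast}\{v,f(v)\},$$ where $N_\ast$ is the set of neighbours of $\ast$ in $g_1$. Its unit is the one-vertex graph. For $a\neq b$, write $p_{ab}$ for the graph on $\{a,b\}$ with no edge and $s_{ab}$ for the graph on $\{a,b\}$ with one edge. Let $\mathbf{SP}$ be the suboperad of $\mathbb{K}\mathbf{G}$ generated by $p_{ab}$ and $s_{ab}$. Proposition (presentation of $\mathbf{SP}$). The operad $\mathbf{SP}$ is isomorphic to $\mathrm{Ope}(G,R)$, where $G$ is the subspecies of $\mathbb{K}\mathbf{G}$ generated by $\{p_{ab},s_{ab}\}$ and $R$ is the subspecies of $\mathbf{Free}_G$ generated by the two elements of $\mathbf{Free}_G[\{a,b,c\}]$ $$p_{c\ast}\circ^{\xi}_\ast p_{ab}-p_{a\ast}\circ^{\xi}_\ast p_{bc},$$ $$s_{a\ast}\circ^{\xi}_\ast p_{bc}-p_{c\ast}\circ^{\xi}_\ast s_{ab}-p_{b\ast}\circ^{\xi}_\ast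 s_{ac}.$$ Moreover $\mathrm{Ope}(G,R)$ is binary and quadratic, so that $\mathbf{SP}$ is a binary and quadratic operad. -/

import Mathlib

noncomputable section

namespace GraphOperad

universe u w w'

/-! ### Linear species -/

/-- A positive linear species over `K`: a functor from finite sets and bijections to `K`-vector
spaces which vanishes on the empty set. -/
structure Species (K : Type u) [Field K] where
  /-- The vector space `S[V]`. -/
  obj : (V : Type) → [Finite V] → Type w
  [addCommGroup : ∀ (V : Type) [Finite V], AddCommGroup (obj V)]
  [module : ∀ (V : Type) [Finite V], Module K (obj V)]
  /-- The linear map `S[σ]`. -/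
  map : {V W : Type} → [Finite V] → [Finite W] → (V ≃ W) → obj V →ₗ[K] obj W
  map_refl : ∀ (V : Type) [Finite V] (x : obj V), map (Equiv.refl V) x = x
  map_trans : ∀ {U V W : Type} [Finite U] [Finite V] [Finite W] (σ : U ≃ V) (τ : V ≃ W)
    (x : obj U), map (σ.trans τ) x = map τ (map σ x)
  positive : ∀ (V : Type) [Finite V] [IsEmpty V] (x : obj V), x = 0

attribute [instance] Species.addCommGroup Species.module

/-- A subspecies: a family of subspaces stable under relabelling. -/
@[ext]
structure Subspecies {K : Type u} [Field K] (S : Species.{u, w} K) where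
  carrier : (V : Type) → [Finite V] → Submodule K (S.obj V)
  map_mem : ∀ {V W : Type} [Finite V] [Finite W] (σ : V ≃ W) {x : S.obj V},
    x ∈ carrier V → S.map σ x ∈ carrier W

/-- A subspecies, as a species. -/
def Subspecies.toSpecies {K : Type u} [Field K] {S : Species.{u, w} K} (R : Subspecies S) :
    Species.{u, w} K where
  obj V _ := R.carrier V
  map σ := (S.map σ).restrict fun _ hx => R.map_mem σ hx
  map_refl V _ x := Subtype.ext (S.map_refl V x.1)
  map_trans σ τ x := Subtype.ext (S.map_trans σ τ x.1)
  positive V _ _ x := Subtype.ext (S.positive V x.1)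

/-- The subspecies generated by a family `x i ∈ S[V i]`: the smallest subspecies containing it. -/
def Subspecies.generated {K : Type u} [Field K] (S : Species.{u, w} K) {ι : Type} (V : ι → Type)
    [∀ i, Finite (V i)] (x : ∀ i, S.obj (V i)) : Subspecies S where
  carrier W _ := sInf {M | ∃ R : Subspecies S, (∀ i, x i ∈ R.carrier (V i)) ∧ M = R.carrier W}
  map_mem σ y hy := by
    simp only [Submodule.mem_sInf, Set.mem_ofPred_eq] at hy ⊢
    rintro _ ⟨R, hR, rfl⟩
    exact R.map_mem σ (hy _ ⟨R, hR, rfl⟩)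

theorem Subspecies.mem_generated {K : Type u} [Field K] (S : Species.{u, w} K) {ι : Type}
    (V : ι → Type) [∀ i, Finite (V i)] (x : ∀ i, S.obj (V i)) (i : ι) :
    x i ∈ (Subspecies.generated S V x).carrier (V i) := by
  simp only [Subspecies.generated, Submodule.mem_sInf, Set.mem_ofPred_eq]
  rintro _ ⟨R, hR, rfl⟩
  exact hR i

/-! ### Relabellings used in the operad axioms -/

/-- `(A ⊔ {∗}) ⊔ B ≃ (A ⊔ B) ⊔ {∗}`. -/
def starLeft (A B : Type) : Option A ⊕ B ≃ Option (A ⊕ B) where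
  toFun
    | .inl none => none
    | .inl (some a) => some (.inl a)
    | .inr b => some (.inr b)
  invFun
    | none => .inl none
    | some (.inl a) => .inl (some a)
    | some (.inr b) => .inr b
  left_inv := by rintro ((_ | a) | b) <;> rfl
  right_inv := by rintro (_ | (a | b)) <;> rfl

/-- `A ⊔ (B ⊔ {∗}) ≃ (A ⊔ B) ⊔ {∗}`. -/
def starRight (A B : Type) : A ⊕ Option B ≃ Option (A ⊕ B) where
  toFun
    | .inl a => some (.inl a)
    | .inr none => none
    | .inr (some b) => some (.inr b)
  invFun
    | none => .inr none
    | some (.inl a) => .inl a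
    | some (.inr b) => .inr (some b)
  left_inv := by rintro (a | (_ | b)) <;> rfl
  right_inv := by rintro (_ | (a | b)) <;> rfl

/-- The exchange of the two adjoined points of `A ⊔ {∗₂} ⊔ {∗₁}`. -/
def starSwap (A : Type) : Option (Option A) ≃ Option (Option A) where
  toFun
    | none => some none
    | some none => none
    | some (some a) => some (some a)
  invFun
    | none => some none
    | some none => none
    | some (some a) => some (some a)
  left_inv := by rintro (_ | (_ | a)) <;> rfl
  right_inv := by rintro (_ | (_ | a)) <;> rfl

/-- `(A ⊔ C) ⊔ B ≃ (A ⊔ B) ⊔ C`. -/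
def sumRightComm (A B C : Type) : (A ⊕ C) ⊕ B ≃ (A ⊕ B) ⊕ C where
  toFun
    | .inl (.inl a) => .inl (.inl a)
    | .inl (.inr c) => .inr c
    | .inr b => .inl (.inr b)
  invFun
    | .inl (.inl a) => .inl (.inl a)
    | .inl (.inr b) => .inr b
    | .inr c => .inl (.inr c)
  left_inv := by rintro ((a | c) | b) <;> rfl
  right_inv := by rintro ((a | b) | c) <;> rfl

/-- The one-point set, written as `∅ ⊔ {∗}`. -/
def starOnly : Unit ≃ Option Empty where
  toFun _ := none
  invFun _ := ()
  left_inv _ := rfl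
  right_inv := by rintro (_ | a) <;> [rfl; exact a.elim]

/-! ### Operads -/

/-- A linear symmetric operad in partial-composition form. The set `V ⊔ {∗}` is `Option V`, with
`∗ = none`, and `comp A B` is the component `O[A ⊔ {∗}] ⊗ O[B] → O[A ⊔ B]` of `∘_∗`. The unit
`K X → O` is given by its value at the one-point set. -/
structure Operad (K : Type u) [Field K] extends Species.{u, w} K where
  unit : obj Unit
  comp : (A B : Type) → [Finite A] → [Finite B] → obj (Option A) →ₗ[K] obj B →ₗ[K] obj (A ⊕ B)
  comp_map : ∀ {A A' B B' : Type} [Finite A] [Finite A'] [Finite B] [Finite B']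
    (σ : A ≃ A') (τ : B ≃ B') (x : obj (Option A)) (y : obj B),
    comp A' B' (map (Equiv.optionCongr σ) x) (map τ y) = map (Equiv.sumCongr σ τ) (comp A B x y)
  /-- Compositions at two different points `∗₁` (outer `none`) and `∗₂` commute. -/
  comp_comm : ∀ {A B C : Type} [Finite A] [Finite B] [Finite C]
    (x : obj (Option (Option A))) (y : obj B) (z : obj C),
    comp (A ⊕ B) C (map (starLeft A B) (comp (Option A) B x y)) z =
      map (sumRightComm A B C)
        (comp (A ⊕ C) B (map (starLeft A C) (comp (Option A) C (map (starSwap A) x) z)) y)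
  /-- Nested compositions are associative. -/
  comp_assoc : ∀ {A B C : Type} [Finite A] [Finite B] [Finite C]
    (x : obj (Option A)) (y : obj (Option B)) (z : obj C),
    comp (A ⊕ B) C (map (starRight A B) (comp A (Option B) x y)) z =
      map (Equiv.sumAssoc A B C).symm (comp A (B ⊕ C) x (comp B C y z))
  comp_unit : ∀ {A : Type} [Finite A] (x : obj (Option A)),
    comp A Unit x unit = map (Equiv.optionEquivSumPUnit A) x
  unit_comp : ∀ {B : Type} [Finite B] (y : obj B),
    comp Empty B (map starOnly unit) y = map (Equiv.emptySum Empty B).symm y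

/-- A morphism of operads. -/
structure Operad.Hom {K : Type u} [Field K] (P : Operad.{u, w} K) (Q : Operad.{u, w'} K) where
  toFun : (V : Type) → [Finite V] → P.obj V →ₗ[K] Q.obj V
  map_map : ∀ {V W : Type} [Finite V] [Finite W] (σ : V ≃ W) (x : P.obj V),
    toFun W (P.map σ x) = Q.map σ (toFun V x)
  map_unit : toFun Unit P.unit = Q.unit
  map_comp : ∀ {A B : Type} [Finite A] [Finite B] (x : P.obj (Option A)) (y : P.obj B),
    toFun (A ⊕ B) (P.comp A B x y) = Q.comp A B (toFun (Option A) x) (toFun B y)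

/-- Two operads are isomorphic if there is an operad morphism between them all of whose
components are bijective. -/
def Operad.Isomorphic {K : Type u} [Field K] (P : Operad.{u, w} K) (Q : Operad.{u, w'} K) : Prop :=
  ∃ f : Operad.Hom P Q, ∀ (V : Type) [Finite V], Function.Bijective (f.toFun V)

/-! ### Suboperads -/

/-- A suboperad. -/
structure Suboperad {K : Type u} [Field K] (O : Operad.{u, w} K) extends
    Subspecies O.toSpecies where
  unit_mem : O.unit ∈ carrier Unit
  comp_mem : ∀ {A B : Type} [Finite A] [Finite B] {x : O.obj (Option A)} {y : O.obj B},
    x ∈ carrier (Option A) → y ∈ carrier B → O.comp A B x y ∈ carrier (A ⊕ B)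

/-- A suboperad, as an operad. -/
def Suboperad.toOperad {K : Type u} [Field K] {O : Operad.{u, w} K} (P : Suboperad O) :
    Operad.{u, w} K where
  toSpecies := P.toSubspecies.toSpecies
  unit := ⟨O.unit, P.unit_mem⟩
  comp A B _ _ := LinearMap.mk₂ K
    (fun (x : P.carrier (Option A)) (y : P.carrier B) =>
      (⟨O.comp A B x.1 y.1, P.comp_mem x.2 y.2⟩ : P.carrier (A ⊕ B)))
    (fun x x' y => Subtype.ext (LinearMap.map_add₂ (O.comp A B) x.1 x'.1 y.1))
    (fun c x y => Subtype.ext (LinearMap.map_smul₂ (O.comp A B) c x.1 y.1))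
    (fun x y y' => Subtype.ext (map_add (O.comp A B x.1) y.1 y'.1))
    (fun c x y => Subtype.ext (map_smul (O.comp A B x.1) c y.1))
  comp_map σ τ x y := Subtype.ext (O.comp_map σ τ x.1 y.1)
  comp_comm x y z := Subtype.ext (O.comp_comm x.1 y.1 z.1)
  comp_assoc x y z := Subtype.ext (O.comp_assoc x.1 y.1 z.1)
  comp_unit x := Subtype.ext (O.comp_unit x.1)
  unit_comp y := Subtype.ext (O.unit_comp y.1)

/-- The suboperad generated by a family `x i ∈ O[V i]`: the smallest suboperad containing it. -/
def Suboperad.generated {K : Type u} [Field K] (O : Operad.{u, w} K) {ι : Type} (V : ι → Type)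
    [∀ i, Finite (V i)] (x : ∀ i, O.obj (V i)) : Suboperad O where
  carrier W _ := sInf {M | ∃ P : Suboperad O, (∀ i, x i ∈ P.carrier (V i)) ∧ M = P.carrier W}
  map_mem σ y hy := by
    simp only [Submodule.mem_sInf, Set.mem_ofPred_eq] at hy ⊢
    rintro _ ⟨P, hP, rfl⟩
    exact P.map_mem σ (hy _ ⟨P, hP, rfl⟩)
  unit_mem := by
    simp only [Submodule.mem_sInf, Set.mem_ofPred_eq]
    rintro _ ⟨P, hP, rfl⟩
    exact P.unit_mem
  comp_mem hx hy := by
    simp only [Submodule.mem_sInf, Set.mem_ofPred_eq] at hx hy ⊢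
    rintro _ ⟨P, hP, rfl⟩
    exact P.comp_mem (hx _ ⟨P, hP, rfl⟩) (hy _ ⟨P, hP, rfl⟩)

/-! ### Ideals and quotients -/

/-- An operad ideal. -/
structure OperadIdeal {K : Type u} [Field K] (O : Operad.{u, w} K) extends
    Subspecies O.toSpecies where
  comp_mem_left : ∀ {A B : Type} [Finite A] [Finite B] (x : O.obj (Option A)) (y : O.obj B),
    x ∈ carrier (Option A) → O.comp A B x y ∈ carrier (A ⊕ B)
  comp_mem_right : ∀ {A B : Type} [Finite A] [Finite B] (x : O.obj (Option A)) (y : O.obj B),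
    y ∈ carrier B → O.comp A B x y ∈ carrier (A ⊕ B)

/-- The ideal `(R)` generated by a subspecies `R`: the smallest ideal containing `R`. -/
def OperadIdeal.generated {K : Type u} [Field K] {O : Operad.{u, w} K}
    (R : Subspecies O.toSpecies) : OperadIdeal O where
  carrier W _ := sInf {M | ∃ I : OperadIdeal O,
    (∀ (V : Type) [Finite V], R.carrier V ≤ I.carrier V) ∧ M = I.carrier W}
  map_mem σ y hy := by
    simp only [Submodule.mem_sInf, Set.mem_ofPred_eq] at hy ⊢
    rintro _ ⟨I, hI, rfl⟩
    exact I.map_mem σ (hy _ ⟨I, hI, rfl⟩)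
  comp_mem_left x y hx := by
    simp only [Submodule.mem_sInf, Set.mem_ofPred_eq] at hx ⊢
    rintro _ ⟨I, hI, rfl⟩
    exact I.comp_mem_left x y (hx _ ⟨I, hI, rfl⟩)
  comp_mem_right x y hy := by
    simp only [Submodule.mem_sInf, Set.mem_ofPred_eq] at hy ⊢
    rintro _ ⟨I, hI, rfl⟩
    exact I.comp_mem_right x y (hy _ ⟨I, hI, rfl⟩)

/-- The quotient operad `O / I`, with `(O / I)[V] = O[V] / I[V]`. -/
def Operad.quotient {K : Type u} [Field K] (O : Operad.{u, w} K) (I : OperadIdeal O) :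
    Operad.{u, w} K where
  obj V _ := O.obj V ⧸ I.carrier V
  map {V W} _ _ σ := (I.carrier V).mapQ (I.carrier W) (O.map σ) fun _ hx => I.map_mem σ hx
  map_refl V _ := by
    rintro ⟨x⟩
    exact congrArg (Submodule.Quotient.mk (p := I.carrier V)) (O.map_refl V x)
  map_trans {U V W} _ _ _ σ τ := by
    rintro ⟨x⟩
    exact congrArg (Submodule.Quotient.mk (p := I.carrier W)) (O.map_trans σ τ x)
  positive V _ _ := by
    rintro ⟨x⟩
    exact congrArg (Submodule.Quotient.mk (p := I.carrier V)) (O.positive V x)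
  unit := Submodule.Quotient.mk O.unit
  comp A B _ _ := (I.carrier (Option A)).liftQ
    { toFun := fun x => (I.carrier B).mapQ (I.carrier (A ⊕ B)) (O.comp A B x)
        fun y hy => I.comp_mem_right x y hy
      map_add' := fun x x' => by
        ext y
        simp
      map_smul' := fun c x => by
        ext y
        simp }
    (fun x hx => by
      ext y
      simpa using I.comp_mem_left x y hx)
  comp_map {A A' B B'} _ _ _ _ σ τ := by
    rintro ⟨x⟩ ⟨y⟩
    exact congrArg (Submodule.Quotient.mk (p := I.carrier (A' ⊕ B'))) (O.comp_map σ τ x y)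
  comp_comm {A B C} _ _ _ := by
    rintro ⟨x⟩ ⟨y⟩ ⟨z⟩
    exact congrArg (Submodule.Quotient.mk (p := I.carrier ((A ⊕ B) ⊕ C))) (O.comp_comm x y z)
  comp_assoc {A B C} _ _ _ := by
    rintro ⟨x⟩ ⟨y⟩ ⟨z⟩
    exact congrArg (Submodule.Quotient.mk (p := I.carrier ((A ⊕ B) ⊕ C))) (O.comp_assoc x y z)
  comp_unit {A} _ := by
    rintro ⟨x⟩
    exact congrArg (Submodule.Quotient.mk (p := I.carrier (A ⊕ Unit))) (O.comp_unit x)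
  unit_comp {B} _ := by
    rintro ⟨y⟩
    exact congrArg (Submodule.Quotient.mk (p := I.carrier (Empty ⊕ B))) (O.unit_comp y)

/-! ### The free operad -/

/-- Formal expressions built from elements of `G` with the operations of a linear operad. -/
inductive Term {K : Type u} [Field K] (G : Species.{u, w} K) :
    (V : Type) → [Finite V] → Type (max 1 u w)
  | zero {V : Type} [Finite V] : Term G V
  | add {V : Type} [Finite V] (s t : Term G V) : Term G V
  | smul {V : Type} [Finite V] (c : K) (t : Term G V) : Term G V
  | gen {V : Type} [Finite V] (x : G.obj V) : Term G V
  | unit : Term G Unit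
  | map {V W : Type} [Finite V] [Finite W] (σ : V ≃ W) (t : Term G V) : Term G W
  | comp {A B : Type} [Finite A] [Finite B] (s : Term G (Option A)) (t : Term G B) :
      Term G (A ⊕ B)

/-- The identifications between formal expressions: the laws of vector spaces, species and
operads, the compatibility of `gen` with the species structure of `G`, and congruence. -/
inductive Term.Rel {K : Type u} [Field K] {G : Species.{u, w} K} :
    (V : Type) → [Finite V] → Term G V → Term G V → Prop
  | add_congr_left {V : Type} [Finite V] {s s' : Term G V} (t : Term G V) :
      Rel V s s' → Rel V (s.add t) (s'.add t)
  | add_congr_right {V : Type} [Finite V] (s : Term G V) {t t' : Term G V} :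
      Rel V t t' → Rel V (s.add t) (s.add t')
  | smul_congr {V : Type} [Finite V] (c : K) {t t' : Term G V} :
      Rel V t t' → Rel V (t.smul c) (t'.smul c)
  | map_congr {V W : Type} [Finite V] [Finite W] (σ : V ≃ W) {t t' : Term G V} :
      Rel V t t' → Rel W (t.map σ) (t'.map σ)
  | comp_congr_left {A B : Type} [Finite A] [Finite B] {s s' : Term G (Option A)}
      (t : Term G B) : Rel (Option A) s s' → Rel (A ⊕ B) (s.comp t) (s'.comp t)
  | comp_congr_right {A B : Type} [Finite A] [Finite B] (s : Term G (Option A))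
      {t t' : Term G B} : Rel B t t' → Rel (A ⊕ B) (s.comp t) (s.comp t')
  | add_comm {V : Type} [Finite V] (s t : Term G V) : Rel V (s.add t) (t.add s)
  | add_assoc {V : Type} [Finite V] (r s t : Term G V) :
      Rel V ((r.add s).add t) (r.add (s.add t))
  | zero_add {V : Type} [Finite V] (t : Term G V) : Rel V (zero.add t) t
  | one_smul {V : Type} [Finite V] (t : Term G V) : Rel V (t.smul 1) t
  | mul_smul {V : Type} [Finite V] (c d : K) (t : Term G V) :
      Rel V (t.smul (c * d)) ((t.smul d).smul c)
  | smul_add {V : Type} [Finite V] (c : K) (s t : Term G V) :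
      Rel V ((s.add t).smul c) ((s.smul c).add (t.smul c))
  | add_smul {V : Type} [Finite V] (c d : K) (t : Term G V) :
      Rel V (t.smul (c + d)) ((t.smul c).add (t.smul d))
  | zero_smul {V : Type} [Finite V] (t : Term G V) : Rel V (t.smul 0) zero
  | gen_add {V : Type} [Finite V] (x y : G.obj V) : Rel V (gen (x + y)) ((gen x).add (gen y))
  | gen_smul {V : Type} [Finite V] (c : K) (x : G.obj V) : Rel V (gen (c • x)) ((gen x).smul c)
  | gen_map {V W : Type} [Finite V] [Finite W] (σ : V ≃ W) (x : G.obj V) :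
      Rel W (gen (G.map σ x)) ((gen x).map σ)
  | map_add {V W : Type} [Finite V] [Finite W] (σ : V ≃ W) (s t : Term G V) :
      Rel W ((s.add t).map σ) ((s.map σ).add (t.map σ))
  | map_smul {V W : Type} [Finite V] [Finite W] (σ : V ≃ W) (c : K) (t : Term G V) :
      Rel W ((t.smul c).map σ) ((t.map σ).smul c)
  | map_refl {V : Type} [Finite V] (t : Term G V) : Rel V (t.map (Equiv.refl V)) t
  | map_trans {U V W : Type} [Finite U] [Finite V] [Finite W] (σ : U ≃ V) (τ : V ≃ W)
      (t : Term G U) : Rel W (t.map (σ.trans τ)) ((t.map σ).map τ)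
  | comp_add_left {A B : Type} [Finite A] [Finite B] (s s' : Term G (Option A)) (t : Term G B) :
      Rel (A ⊕ B) ((s.add s').comp t) ((s.comp t).add (s'.comp t))
  | comp_smul_left {A B : Type} [Finite A] [Finite B] (c : K) (s : Term G (Option A))
      (t : Term G B) : Rel (A ⊕ B) ((s.smul c).comp t) ((s.comp t).smul c)
  | comp_add_right {A B : Type} [Finite A] [Finite B] (s : Term G (Option A)) (t t' : Term G B) :
      Rel (A ⊕ B) (s.comp (t.add t')) ((s.comp t).add (s.comp t'))
  | comp_smul_right {A B : Type} [Finite A] [Finite B] (c : K) (s : Term G (Option A))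
      (t : Term G B) : Rel (A ⊕ B) (s.comp (t.smul c)) ((s.comp t).smul c)
  | comp_map {A A' B B' : Type} [Finite A] [Finite A'] [Finite B] [Finite B']
      (σ : A ≃ A') (τ : B ≃ B') (s : Term G (Option A)) (t : Term G B) :
      Rel (A' ⊕ B') ((s.map (Equiv.optionCongr σ)).comp (t.map τ))
        ((s.comp t).map (Equiv.sumCongr σ τ))
  | comp_comm {A B C : Type} [Finite A] [Finite B] [Finite C]
      (r : Term G (Option (Option A))) (s : Term G B) (t : Term G C) :
      Rel ((A ⊕ B) ⊕ C) (((r.comp s).map (starLeft A B)).comp t)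
        (((((r.map (starSwap A)).comp t).map (starLeft A C)).comp s).map (sumRightComm A B C))
  | comp_assoc {A B C : Type} [Finite A] [Finite B] [Finite C]
      (r : Term G (Option A)) (s : Term G (Option B)) (t : Term G C) :
      Rel ((A ⊕ B) ⊕ C) (((r.comp s).map (starRight A B)).comp t)
        ((r.comp (s.comp t)).map (Equiv.sumAssoc A B C).symm)
  | comp_unit {A : Type} [Finite A] (t : Term G (Option A)) :
      Rel (A ⊕ Unit) (t.comp unit) (t.map (Equiv.optionEquivSumPUnit A))
  | unit_comp {B : Type} [Finite B] (t : Term G B) :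
      Rel (Empty ⊕ B) ((unit.map starOnly).comp t) (t.map (Equiv.emptySum Empty B).symm)

/-- The space `Free_G[V]`. -/
def FreeObj {K : Type u} [Field K] (G : Species.{u, w} K) (V : Type) [Finite V] :
    Type (max 1 u w) :=
  Quot (Term.Rel (G := G) V)

namespace FreeObj

variable {K : Type u} [Field K] {G : Species.{u, w} K}

/-- The class of a formal expression. -/
def mk {V : Type} [Finite V] (t : Term G V) : FreeObj G V := Quot.mk _ t

instance (V : Type) [Finite V] : Zero (FreeObj G V) := ⟨mk .zero⟩

instance (V : Type) [Finite V] : Add (FreeObj G V) :=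
  ⟨Quot.map₂ Term.add (fun s _ _ h => .add_congr_right s h) (fun _ _ t h => .add_congr_left t h)⟩

instance (V : Type) [Finite V] : SMul K (FreeObj G V) :=
  ⟨fun c => Quot.map (Term.smul c) (fun _ _ h => .smul_congr c h)⟩

instance (V : Type) [Finite V] : Neg (FreeObj G V) := ⟨fun x => (-1 : K) • x⟩

protected theorem add_comm {V : Type} [Finite V] (x y : FreeObj G V) : x + y = y + x := by
  rcases x with ⟨s⟩; rcases y with ⟨t⟩; exact Quot.sound (.add_comm s t)

protected theorem zero_add {V : Type} [Finite V] (x : FreeObj G V) : 0 + x = x := by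
  rcases x with ⟨s⟩; exact Quot.sound (.zero_add s)

protected theorem one_smul {V : Type} [Finite V] (x : FreeObj G V) : (1 : K) • x = x := by
  rcases x with ⟨s⟩; exact Quot.sound (.one_smul s)

protected theorem add_smul {V : Type} [Finite V] (c d : K) (x : FreeObj G V) :
    (c + d) • x = c • x + d • x := by
  rcases x with ⟨s⟩; exact Quot.sound (.add_smul c d s)

protected theorem zero_smul {V : Type} [Finite V] (x : FreeObj G V) : (0 : K) • x = 0 := by
  rcases x with ⟨s⟩; exact Quot.sound (.zero_smul s)

protected theorem mul_smul {V : Type} [Finite V] (c d : K) (x : FreeObj G V) :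
    (c * d) • x = c • d • x := by
  rcases x with ⟨s⟩; exact Quot.sound (.mul_smul c d s)

protected theorem neg_add_cancel {V : Type} [Finite V] (x : FreeObj G V) : -x + x = 0 := by
  have h := FreeObj.add_smul (-1 : K) 1 x
  rw [neg_add_cancel, FreeObj.zero_smul, FreeObj.one_smul] at h
  exact h.symm

instance (V : Type) [Finite V] : AddCommGroup (FreeObj G V) where
  add_assoc := by rintro ⟨r⟩ ⟨s⟩ ⟨t⟩; exact Quot.sound (.add_assoc r s t)
  zero_add := FreeObj.zero_add
  add_zero x := (FreeObj.add_comm x 0).trans (FreeObj.zero_add x)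
  add_comm := FreeObj.add_comm
  neg_add_cancel := FreeObj.neg_add_cancel
  nsmul := nsmulRec
  zsmul := zsmulRec

instance (V : Type) [Finite V] : Module K (FreeObj G V) where
  one_smul := FreeObj.one_smul
  mul_smul := FreeObj.mul_smul
  add_smul := FreeObj.add_smul
  zero_smul := FreeObj.zero_smul
  smul_zero c := by
    rw [← FreeObj.zero_smul (0 : FreeObj G V), ← FreeObj.mul_smul, mul_zero]
  smul_add c := by rintro ⟨s⟩ ⟨t⟩; exact Quot.sound (.smul_add c s t)

/-- Relabelling. -/
def map {V W : Type} [Finite V] [Finite W] (σ : V ≃ W) : FreeObj G V →ₗ[K] FreeObj G W where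
  toFun := Quot.map (Term.map σ) (fun _ _ h => .map_congr σ h)
  map_add' := by rintro ⟨s⟩ ⟨t⟩; exact Quot.sound (.map_add σ s t)
  map_smul' c := by rintro ⟨s⟩; exact Quot.sound (.map_smul σ c s)

/-- Partial composition. -/
def comp (A B : Type) [Finite A] [Finite B] :
    FreeObj G (Option A) →ₗ[K] FreeObj G B →ₗ[K] FreeObj G (A ⊕ B) :=
  LinearMap.mk₂ K
    (Quot.map₂ Term.comp (fun s _ _ h => .comp_congr_right s h)
      (fun _ _ t h => .comp_congr_left t h))
    (by rintro ⟨s⟩ ⟨s'⟩ ⟨t⟩; exact Quot.sound (.comp_add_left s s' t))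
    (by rintro c ⟨s⟩ ⟨t⟩; exact Quot.sound (.comp_smul_left c s t))
    (by rintro ⟨s⟩ ⟨t⟩ ⟨t'⟩; exact Quot.sound (.comp_add_right s t t'))
    (by rintro c ⟨s⟩ ⟨t⟩; exact Quot.sound (.comp_smul_right c s t))

/-- The inclusion of the generators. -/
def gen (V : Type) [Finite V] : G.obj V →ₗ[K] FreeObj G V where
  toFun x := mk (.gen x)
  map_add' x y := Quot.sound (.gen_add x y)
  map_smul' c x := Quot.sound (.gen_smul c x)

theorem mk_eq_zero {V : Type} [Finite V] (t : Term G V) : IsEmpty V → mk t = 0 := by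
  induction t with
  | zero => exact fun _ => rfl
  | add s t hs ht =>
    intro h
    change mk s + mk t = 0
    rw [hs h, ht h, add_zero]
  | smul c t ht =>
    intro h
    change c • mk t = 0
    rw [ht h, smul_zero]
  | @gen V _ x =>
    intro h
    change gen V x = 0
    rw [G.positive V x, map_zero]
  | unit => exact fun h => (h.false ()).elim
  | map σ t ht =>
    intro h
    change map σ (mk t) = 0
    rw [ht σ.isEmpty, map_zero]
  | @comp A B _ _ s t hs ht =>
    intro h
    change comp A B (mk s) (mk t) = 0
    rw [ht (isEmpty_sum.mp h).2, map_zero]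

end FreeObj

/-- The free operad over the species `G`. It is spanned by the iterated compositions of elements
of `G` (trees with internal nodes labelled by `G`), and is constructed as the space of formal
expressions in elements of `G`, modulo the laws of operads. -/
def Free {K : Type u} [Field K] (G : Species.{u, w} K) : Operad.{u, max 1 u w} K where
  obj V _ := FreeObj G V
  map := FreeObj.map
  map_refl V _ := by rintro ⟨t⟩; exact Quot.sound (.map_refl t)
  map_trans σ τ := by rintro ⟨t⟩; exact Quot.sound (.map_trans σ τ t)
  positive V _ h := by rintro ⟨t⟩; exact FreeObj.mk_eq_zero t h
  unit := FreeObj.mk .unit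
  comp := FreeObj.comp
  comp_map σ τ := by rintro ⟨s⟩ ⟨t⟩; exact Quot.sound (.comp_map σ τ s t)
  comp_comm := by rintro A B C _ _ _ ⟨r⟩ ⟨s⟩ ⟨t⟩; exact Quot.sound (.comp_comm r s t)
  comp_assoc := by rintro A B C _ _ _ ⟨r⟩ ⟨s⟩ ⟨t⟩; exact Quot.sound (.comp_assoc r s t)
  comp_unit := by rintro A _ ⟨t⟩; exact Quot.sound (.comp_unit t)
  unit_comp := by rintro B _ ⟨t⟩; exact Quot.sound (.unit_comp t)

/-- The inclusion of `G` in `Free_G`. -/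
def Free.gen {K : Type u} [Field K] {G : Species.{u, w} K} {V : Type} [Finite V] :
    G.obj V →ₗ[K] (Free G).obj V :=
  FreeObj.gen V

/-- The evaluation of a formal expression in an operad. -/
def Term.eval {K : Type u} [Field K] {G : Species.{u, w} K} (O : Operad.{u, w'} K)
    (φ : ∀ (V : Type) [Finite V], G.obj V →ₗ[K] O.obj V) {V : Type} [Finite V] (t : Term G V) :
    O.obj V := by
  induction t with
  | zero => exact 0
  | add _ _ s t => exact s + t
  | smul c _ t => exact c • t
  | gen x => exact φ _ x
  | unit => exact O.unit
  | map σ _ t => exact O.map σ t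
  | comp _ _ s t => exact O.comp _ _ s t

theorem Term.eval_eq {K : Type u} [Field K] {G : Species.{u, w} K} (O : Operad.{u, w'} K)
    (φ : ∀ (V : Type) [Finite V], G.obj V →ₗ[K] O.obj V)
    (hφ : ∀ {V W : Type} [Finite V] [Finite W] (σ : V ≃ W) (x : G.obj V),
      φ W (G.map σ x) = O.map σ (φ V x))
    {V : Type} [Finite V] {s t : Term G V} (h : Term.Rel V s t) : s.eval O φ = t.eval O φ := by
  induction h with
  | add_congr_left t _ ih => exact congrArg (· + _) ih
  | add_congr_right t _ ih => exact congrArg (_ + ·) ih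
  | smul_congr c _ ih => exact congrArg (c • ·) ih
  | map_congr σ _ ih => exact congrArg (O.map σ) ih
  | comp_congr_left t _ ih => exact congrArg (fun x => O.comp _ _ x _) ih
  | comp_congr_right s _ ih => exact congrArg (O.comp _ _ _) ih
  | add_comm => exact add_comm _ _
  | add_assoc => exact add_assoc _ _ _
  | zero_add => exact zero_add _
  | one_smul => exact one_smul _ _
  | mul_smul => exact mul_smul _ _ _
  | smul_add => exact smul_add _ _ _
  | add_smul => exact add_smul _ _ _
  | zero_smul => exact zero_smul _ _
  | gen_add => simp [Term.eval]
  | gen_smul => simp [Term.eval]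
  | gen_map σ x => exact hφ σ x
  | map_add => simp [Term.eval]
  | map_smul => simp [Term.eval]
  | map_refl => exact O.map_refl _ _
  | map_trans => exact O.map_trans _ _ _
  | comp_add_left => simp [Term.eval]
  | comp_smul_left => simp [Term.eval]
  | comp_add_right => simp [Term.eval]
  | comp_smul_right => simp [Term.eval]
  | comp_map => exact O.comp_map _ _ _ _
  | comp_comm => exact O.comp_comm _ _ _
  | comp_assoc => exact O.comp_assoc _ _ _
  | comp_unit => exact O.comp_unit _
  | unit_comp => exact O.unit_comp _

/-- The universal property of the free operad: every morphism of species from `G` to an operad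
extends uniquely to an operad morphism from `Free_G`. -/
theorem Free.existsUnique_hom {K : Type u} [Field K] {G : Species.{u, w} K}
    (O : Operad.{u, w'} K) (φ : ∀ (V : Type) [Finite V], G.obj V →ₗ[K] O.obj V)
    (hφ : ∀ {V W : Type} [Finite V] [Finite W] (σ : V ≃ W) (x : G.obj V),
      φ W (G.map σ x) = O.map σ (φ V x)) :
    ∃! f : Operad.Hom (Free G) O,
      ∀ (V : Type) [Finite V] (x : G.obj V), f.toFun V (Free.gen x) = φ V x := by
  refine ⟨{
    toFun := fun V _ =>
      { toFun := Quot.lift (Term.eval O φ) fun _ _ h => Term.eval_eq O φ hφ h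
        map_add' := by rintro ⟨s⟩ ⟨t⟩; rfl
        map_smul' := by rintro c ⟨t⟩; rfl }
    map_map := by rintro V W _ _ σ ⟨t⟩; rfl
    map_unit := rfl
    map_comp := by rintro A B _ _ ⟨s⟩ ⟨t⟩; rfl }, fun V _ x => rfl, ?_⟩
  intro g hg
  have key : ∀ {V : Type} [Finite V] (t : Term G V),
      g.toFun V (FreeObj.mk t) = t.eval O φ := by
    intro V _ t
    induction t with
    | zero => exact map_zero _
    | add s t hs ht => exact (map_add _ _ _).trans (congrArg₂ (· + ·) hs ht)
    | smul c t ht => exact (map_smul _ _ _).trans (congrArg (c • ·) ht)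
    | gen x => exact hg _ x
    | unit => exact g.map_unit
    | map σ t ht => exact (g.map_map σ _).trans (congrArg (O.map σ) ht)
    | @comp A B _ _ s t hs ht =>
      exact (g.map_comp _ _).trans (congrArg₂ (fun x y => O.comp A B x y) hs ht)
  rcases g with ⟨g, _, _, _⟩
  congr 1
  funext V _
  ext ⟨t⟩
  exact key t

/-- `IsMonomial k V x` says that `x` is a composition of exactly `k` elements of `G`, that is, a
tree with leaves `V` and exactly `k` internal nodes, labelled by elements of `G`. -/
inductive Free.IsMonomial {K : Type u} [Field K] {G : Species.{u, w} K} :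
    ℕ → (V : Type) → [Finite V] → (Free G).obj V → Prop
  | unit : IsMonomial 0 Unit (Free G).unit
  | gen {V : Type} [Finite V] (x : G.obj V) : IsMonomial 1 V (Free.gen x)
  | map {k : ℕ} {V W : Type} [Finite V] [Finite W] (σ : V ≃ W) {x : (Free G).obj V} :
      IsMonomial k V x → IsMonomial k W ((Free G).map σ x)
  | comp {k l : ℕ} {A B : Type} [Finite A] [Finite B] {x : (Free G).obj (Option A)}
      {y : (Free G).obj B} : IsMonomial k (Option A) x → IsMonomial l B y →
      IsMonomial (k + l) (A ⊕ B) ((Free G).comp A B x y)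

/-- The subspecies `Free_G^{(k)}` spanned by the trees with exactly `k` internal nodes. -/
def Free.graded {K : Type u} [Field K] (G : Species.{u, w} K) (k : ℕ) :
    Subspecies (Free G).toSpecies where
  carrier V _ := Submodule.span K {x | Free.IsMonomial k V x}
  map_mem {V W} _ _ σ x hx := by
    have h : Submodule.span K {x | Free.IsMonomial k V x} ≤
        (Submodule.span K {x | Free.IsMonomial k W x}).comap ((Free G).map σ) :=
      Submodule.span_le.mpr fun y hy => Submodule.subset_span (Free.IsMonomial.map σ hy)
    exact h hx

/-- The operad `Ope(G, R) = Free_G / (R)`. -/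
def Ope {K : Type u} [Field K] (G : Species.{u, w} K) (R : Subspecies (Free G).toSpecies) :
    Operad.{u, max 1 u w} K :=
  (Free G).quotient (OperadIdeal.generated R)

/-- `Ope(G, R)` is binary: `G` is concentrated in cardinality `2`. -/
def IsBinary {K : Type u} [Field K] (G : Species.{u, w} K) : Prop :=
  ∀ (V : Type) [Finite V], Nat.card V ≠ 2 → ∀ x : G.obj V, x = 0

/-- `Ope(G, R)` is quadratic: `R` is a subspecies of `Free_G^{(2)}`. -/
def IsQuadratic {K : Type u} [Field K] {G : Species.{u, w} K}
    (R : Subspecies (Free G).toSpecies) : Prop :=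
  ∀ (V : Type) [Finite V], R.carrier V ≤ (Free.graded G 2).carrier V

/-! ### The operad of graphs -/

/-- Graphs (without loops or multiple edges) on a non-empty vertex set `V`; there are none on
the empty set, so that `V ↦ GraphOn V` is a positive species. -/
@[ext]
structure GraphOn (V : Type) where
  graph : SimpleGraph V
  nonempty : Nonempty V

instance (V : Type) [Finite V] : Finite (GraphOn V) :=
  Finite.of_injective GraphOn.graph fun _ _ h => GraphOn.ext h

/-- Transport of graphs along a bijection. -/
def GraphOn.relabel {V W : Type} (σ : V ≃ W) : GraphOn V ≃ GraphOn W where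
  toFun g := ⟨g.graph.comap σ.symm, g.nonempty.map σ⟩
  invFun g := ⟨g.graph.comap σ, g.nonempty.map σ.symm⟩
  left_inv g := GraphOn.ext (by ext; simp)
  right_inv g := GraphOn.ext (by ext; simp)

/-- The graph `(g₁ ∖ {∗}) ∪ g₂ ∪ {{v, f v} | v ∈ N_∗}`, where `N_∗` is the set of neighbours of
`∗ = none` in `g₁` and `f : N_∗ → B`. -/
def insertAlong {A B : Type} (g₁ : SimpleGraph (Option A)) (g₂ : SimpleGraph B)
    (f : g₁.neighborSet none → B) : SimpleGraph (A ⊕ B) where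
  Adj
    | .inl a, .inl a' => g₁.Adj (some a) (some a')
    | .inr b, .inr b' => g₂.Adj b b'
    | .inl a, .inr b => ∃ h : g₁.Adj none (some a), f ⟨some a, h⟩ = b
    | .inr b, .inl a => ∃ h : g₁.Adj none (some a), f ⟨some a, h⟩ = b
  symm := ⟨by
    rintro (a | b) (a' | b') h
    · exact h.symm
    · exact h
    · exact h
    · exact h.symm⟩
  loopless := ⟨by
    rintro (a | b) h
    · exact g₁.irrefl h
    · exact g₂.irrefl h⟩

/-- The insertion `g₁ ∘_∗ g₂`, the sum of the graphs `insertAlong g₁ g₂ f` for `f : N_∗ → B`. -/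
def insertion (K : Type u) [Field K] {A B : Type} [Finite A] [Finite B]
    (g₁ : GraphOn (Option A)) (g₂ : GraphOn B) : GraphOn (A ⊕ B) →₀ K :=
  ∑ᶠ f : g₁.graph.neighborSet none → B,
    Finsupp.single (⟨insertAlong g₁.graph g₂.graph f, g₂.nonempty.map Sum.inr⟩ : GraphOn (A ⊕ B)) 1

/-- The bilinear extension of `insertion`. -/
def insertionLin (K : Type u) [Field K] (A B : Type) [Finite A] [Finite B] :
    (GraphOn (Option A) →₀ K) →ₗ[K] (GraphOn B →₀ K) →ₗ[K] (GraphOn (A ⊕ B) →₀ K) :=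
  Finsupp.linearCombination K fun g₁ => Finsupp.linearCombination K fun g₂ => insertion K g₁ g₂

/-- Contraction of `B` to a point, a left inverse of all insertions. -/
def contract {A B : Type} (g : SimpleGraph (A ⊕ B)) : SimpleGraph (Option A) where
  Adj
    | some a, some a' => g.Adj (.inl a) (.inl a')
    | none, some a => ∃ b, g.Adj (.inl a) (.inr b)
    | some a, none => ∃ b, g.Adj (.inl a) (.inr b)
    | none, none => False
  symm := ⟨by
    rintro (_ | a) (_ | a') h
    · exact h
    · exact h
    · exact h
    · exact h.symm⟩
  loopless := ⟨by
    rintro (_ | a) h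
    · exact h
    · exact g.irrefl h⟩

/-- Every vertex of `A` has at most one neighbour in `B`. -/
def Thin {A B : Type} (g : SimpleGraph (A ⊕ B)) : Prop :=
  ∀ a b b', g.Adj (.inl a) (.inr b) → g.Adj (.inl a) (.inr b') → b = b'

theorem exists_insertAlong {A B : Type} (g₁ : SimpleGraph (Option A)) (g₂ : SimpleGraph B)
    (g : SimpleGraph (A ⊕ B)) : (∃ f, insertAlong g₁ g₂ f = g) ↔
      Thin g ∧ contract g = g₁ ∧ g.comap Sum.inr = g₂ := by
  constructor
  · rintro ⟨f, rfl⟩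
    refine ⟨?_, ?_, ?_⟩
    · rintro a b b' ⟨h, rfl⟩ ⟨_, rfl⟩
      rfl
    · ext x y
      rcases x with _ | a <;> rcases y with _ | a'
      · simp [contract]
      · simp [contract, insertAlong]
      · simp [contract, insertAlong, g₁.adj_comm]
      · simp [contract, insertAlong]
    · ext
      simp [insertAlong]
  · rintro ⟨ht, rfl, rfl⟩
    have key : ∀ v : (contract g).neighborSet none,
        ∃ b, ∀ a, v.1 = some a → g.Adj (.inl a) (.inr b) := by
      rintro ⟨_ | a, h⟩
      · exact h.elim
      · obtain ⟨b, hb⟩ := h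
        exact ⟨b, fun a' e => by cases e; exact hb⟩
    choose f hf using key
    have h1 : ∀ a b, (∃ h : (contract g).Adj none (some a), f ⟨some a, h⟩ = b) ↔
        g.Adj (.inl a) (.inr b) := by
      intro a b
      constructor
      · rintro ⟨h, rfl⟩
        exact hf ⟨some a, h⟩ a rfl
      · intro h
        exact ⟨⟨b, h⟩, ht a _ _ (hf ⟨some a, ⟨b, h⟩⟩ a rfl) h⟩
    refine ⟨f, ?_⟩
    ext x y
    rcases x with a | b <;> rcases y with a' | b'
    · exact Iff.rfl
    · exact h1 a b'
    · exact (h1 a' b).trans (g.adj_comm _ _)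
    · exact Iff.rfl

theorem insertAlong_injective {A B : Type} (g₁ : SimpleGraph (Option A)) (g₂ : SimpleGraph B) :
    Function.Injective (insertAlong g₁ g₂) := by
  intro f f' h
  ext ⟨_ | a, ha⟩
  · exact (g₁.irrefl ha).elim
  · have h1 : (insertAlong g₁ g₂ f).Adj (.inl a) (.inr (f ⟨some a, ha⟩)) := ⟨ha, rfl⟩
    rw [h] at h1
    exact h1.2.symm

open Classical in
theorem insertion_apply (K : Type u) [Field K] {A B : Type} [Finite A] [Finite B]
    (g₁ : GraphOn (Option A)) (g₂ : GraphOn B) (g : GraphOn (A ⊕ B)) :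
    insertion K g₁ g₂ g =
      if Thin g.graph ∧ contract g.graph = g₁.graph ∧ g.graph.comap Sum.inr = g₂.graph then 1 else 0 := by
  have := Fintype.ofFinite (g₁.graph.neighborSet none → B)
  rw [insertion, finsum_eq_sum_of_fintype, Finsupp.finsetSum_apply]
  rw [← if_congr (exists_insertAlong g₁.graph g₂.graph g.graph) rfl rfl]
  split_ifs with h
  · obtain ⟨f, hf⟩ := h
    rw [Finset.sum_eq_single f]
    · have : (⟨insertAlong g₁.graph g₂.graph f, g₂.nonempty.map Sum.inr⟩ : GraphOn (A ⊕ B)) = g :=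
        GraphOn.ext hf
      rw [this, Finsupp.single_eq_same]
    · intro f' _ hne
      refine Finsupp.single_eq_of_ne fun e => hne (insertAlong_injective g₁.graph g₂.graph ?_)
      rw [hf, e]
    · simp
  · refine Finset.sum_eq_zero fun f _ => Finsupp.single_eq_of_ne fun e => h ⟨f, ?_⟩
    rw [e]

open Classical in
theorem insertionLin_apply (K : Type u) [Field K] {A B : Type} [Finite A] [Finite B] [Nonempty B]
    (x : GraphOn (Option A) →₀ K) (y : GraphOn B →₀ K) (g : GraphOn (A ⊕ B)) :
    insertionLin K A B x y g =
      if Thin g.graph then x ⟨contract g.graph, ⟨none⟩⟩ * y ⟨g.graph.comap Sum.inr, inferInstance⟩ else 0 := by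
  induction x using Finsupp.induction_linear with
  | zero => simp
  | add x x' hx hx' =>
    rw [map_add, LinearMap.add_apply, Finsupp.add_apply, hx, hx', Finsupp.add_apply]
    split_ifs <;> ring
  | single g₁ c =>
    induction y using Finsupp.induction_linear with
    | zero => simp
    | add y y' hy hy' =>
      rw [map_add, Finsupp.add_apply, hy, hy', Finsupp.add_apply]
      split_ifs <;> ring
    | single g₂ d =>
      have e1 : g₁ = ⟨contract g.graph, ⟨none⟩⟩ ↔ contract g.graph = g₁.graph :=
        ⟨fun h => by rw [h], fun h => GraphOn.ext h.symm⟩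
      have e2 : g₂ = ⟨g.graph.comap Sum.inr, inferInstance⟩ ↔ g.graph.comap Sum.inr = g₂.graph :=
        ⟨fun h => by rw [h], fun h => GraphOn.ext h.symm⟩
      simp only [insertionLin, Finsupp.linearCombination_single, LinearMap.smul_apply,
        Finsupp.smul_apply, insertion_apply, Finsupp.single_apply, e1, e2, smul_eq_mul]
      by_cases h1 : contract g.graph = g₁.graph <;> by_cases h2 : g.graph.comap Sum.inr = g₂.graph <;>
        by_cases h3 : Thin g.graph <;> simp [h1, h2, h3]

theorem insertionLin_of_isEmpty (K : Type u) [Field K] {A B : Type} [Finite A] [Finite B]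
    [IsEmpty B] (x : GraphOn (Option A) →₀ K) (y : GraphOn B →₀ K) :
    insertionLin K A B x y = 0 := by
  have : y = 0 := by
    ext g
    exact (not_isEmpty_iff.mpr g.nonempty inferInstance).elim
  rw [this, map_zero]

/-- Relabelling of linear combinations of graphs. -/
def relabelLin (K : Type u) [Field K] {V W : Type} (σ : V ≃ W) :
    (GraphOn V →₀ K) →ₗ[K] (GraphOn W →₀ K) :=
  Finsupp.lmapDomain K K (GraphOn.relabel σ)

theorem relabelLin_apply (K : Type u) [Field K] {V W : Type} (σ : V ≃ W) (x : GraphOn V →₀ K)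
    (g : GraphOn W) :
    relabelLin K σ x g = x ⟨g.graph.comap σ, g.nonempty.map σ.symm⟩ := by
  have h : g = GraphOn.relabel σ ⟨g.graph.comap σ, g.nonempty.map σ.symm⟩ :=
    ((GraphOn.relabel σ).apply_symm_apply g).symm
  conv_lhs => rw [h]
  exact Finsupp.mapDomain_apply (GraphOn.relabel σ).injective _ _

theorem relabel_congr (K : Type u) [Field K] {V : Type} (x : GraphOn V →₀ K)
    (g g' : GraphOn V) (h : ∀ u v, g.graph.Adj u v ↔ g'.graph.Adj u v) : x g = x g' :=
  congrArg x (GraphOn.ext (by ext u v; exact h u v))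

theorem thin_comm {A B C : Type} (g : SimpleGraph ((A ⊕ B) ⊕ C)) :
    (Thin g ∧ Thin ((contract g).comap (starLeft A B))) ↔
      (Thin (g.comap (sumRightComm A B C)) ∧
        Thin ((contract (g.comap (sumRightComm A B C))).comap (starLeft A C))) := by
  have hs : ∀ b c, g.Adj (.inr c) (.inl (.inr b)) ↔ g.Adj (.inl (.inr b)) (.inr c) :=
    fun b c => g.adj_comm _ _
  simp only [Thin, contract, starLeft, sumRightComm, SimpleGraph.comap_adj, Sum.forall,
    Option.forall, Equiv.coe_fn_mk, hs, forall_exists_index]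
  constructor
  · rintro ⟨⟨h1, h2⟩, h3, h4⟩
    exact ⟨⟨h4, fun c b b' hb hb' => h3 b b' c hb c hb'⟩,
      fun c c' b hb b' hb' => by
        obtain rfl := h3 b b' c hb c' hb'
        exact h2 b c c' hb hb', h1⟩
  · rintro ⟨⟨h1, h2⟩, h3, h4⟩
    exact ⟨⟨h4, fun b c c' hc hc' => h3 c c' b hc b hc'⟩,
      fun b b' c hc c' hc' => by
        obtain rfl := h3 c c' b hc b' hc'
        exact h2 c b b' hc hc', h1⟩

theorem contract_comm {A B C : Type} (g : SimpleGraph ((A ⊕ B) ⊕ C)) (u v : Option (Option A)) :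
    (contract ((contract g).comap (starLeft A B))).Adj u v ↔
      (contract ((contract (g.comap (sumRightComm A B C))).comap (starLeft A C))).Adj
        (starSwap A u) (starSwap A v) := by
  have hs : ∀ b c, g.Adj (.inr c) (.inl (.inr b)) ↔ g.Adj (.inl (.inr b)) (.inr c) :=
    fun b c => g.adj_comm _ _
  rcases u with _ | (_ | a) <;> rcases v with _ | (_ | a') <;>
    simp only [contract, starLeft, starSwap, sumRightComm, SimpleGraph.comap_adj,
      Equiv.coe_fn_mk, hs]
  all_goals exact exists_comm

theorem thin_assoc {A B C : Type} (g : SimpleGraph ((A ⊕ B) ⊕ C)) :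
    (Thin g ∧ Thin ((contract g).comap (starRight A B))) ↔
      (Thin (g.comap (Equiv.sumAssoc A B C).symm) ∧
        Thin ((g.comap (Equiv.sumAssoc A B C).symm).comap Sum.inr)) := by
  simp only [Thin, contract, starRight, SimpleGraph.comap_adj, Sum.forall,
    Option.forall, Equiv.coe_fn_mk, Equiv.sumAssoc_symm_apply_inl,
    Equiv.sumAssoc_symm_apply_inr_inl, Equiv.sumAssoc_symm_apply_inr_inr]
  grind

theorem contract_assoc {A B C : Type} (g : SimpleGraph ((A ⊕ B) ⊕ C)) (u v : Option A) :
    (contract ((contract g).comap (starRight A B))).Adj u v ↔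
      (contract (g.comap (Equiv.sumAssoc A B C).symm)).Adj u v := by
  rcases u with _ | a <;> rcases v with _ | a' <;>
    simp [contract, starRight, Option.exists, or_comm]

theorem ite_mul_aux {K : Type u} [Field K] {p q p' q' : Prop} [Decidable p] [Decidable q]
    [Decidable p'] [Decidable q'] {a b c a' b' c' : K} (h : p ∧ q ↔ p' ∧ q')
    (e : a * b * c = a' * b' * c') :
    (if p then (if q then a * b else 0) * c else 0) =
      if p' then (if q' then a' * b' else 0) * c' else 0 := by
  by_cases hp : p <;> by_cases hq : q <;> by_cases hp' : p' <;> by_cases hq' : q' <;> simp_all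

theorem ite_mul_aux' {K : Type u} [Field K] {p q p' q' : Prop} [Decidable p] [Decidable q]
    [Decidable p'] [Decidable q'] {a b c a' b' c' : K} (h : p ∧ q ↔ p' ∧ q')
    (e : a * b * c = a' * (b' * c')) :
    (if p then (if q then a * b else 0) * c else 0) =
      if p' then a' * (if q' then b' * c' else 0) else 0 := by
  by_cases hp : p <;> by_cases hq : q <;> by_cases hp' : p' <;> by_cases hq' : q' <;> simp_all

/-- The operad `K G` of graphs. -/
def KG (K : Type u) [Field K] : Operad.{u, u} K where
  obj V _ := GraphOn V →₀ K
  map := relabelLin K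
  map_refl V _ x := by
    ext g
    rw [relabelLin_apply]
    rfl
  map_trans σ τ x := by
    ext g
    rw [relabelLin_apply, relabelLin_apply, relabelLin_apply]
    rfl
  positive V _ h x := by
    ext g
    exact (not_isEmpty_iff.mpr g.nonempty h).elim
  unit := Finsupp.single ⟨⊥, ⟨()⟩⟩ 1
  comp A B _ _ := insertionLin K A B
  comp_map {A A' B B'} _ _ _ _ σ τ x y := by
    classical
    rcases isEmpty_or_nonempty B with hB | hB
    · have := τ.symm.isEmpty
      rw [insertionLin_of_isEmpty, insertionLin_of_isEmpty, map_zero]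
    · have := τ.symm.nonempty
      ext g
      rw [relabelLin_apply, insertionLin_apply, insertionLin_apply, relabelLin_apply,
        relabelLin_apply]
      refine if_congr ?_ (congrArg₂ _ (relabel_congr K _ _ _ ?_) rfl) rfl
      · constructor
        · intro h a b b' h1 h2
          exact τ.injective (h (σ a) (τ b) (τ b') h1 h2)
        · intro h a b b' h1 h2
          have := h (σ.symm a) (τ.symm b) (τ.symm b') (by simpa using h1) (by simpa using h2)
          exact τ.symm.injective this
      · have h : ∀ a, (∃ b', g.graph.Adj (.inl (σ a)) (.inr b')) ↔
            ∃ b, g.graph.Adj (.inl (σ a)) (.inr (τ b)) := fun a =>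
          τ.surjective.exists
        rintro (_ | a) (_ | a')
        · exact Iff.rfl
        · exact h a'
        · exact h a
        · exact Iff.rfl
  comp_comm {A B C} _ _ _ x y z := by
    classical
    rcases isEmpty_or_nonempty B with hB | hB
    · rw [insertionLin_of_isEmpty K (B := B), insertionLin_of_isEmpty K (B := B)]; simp
    rcases isEmpty_or_nonempty C with hC | hC
    · rw [insertionLin_of_isEmpty K (B := C), insertionLin_of_isEmpty K (B := C)]; simp
    ext g
    simp only [relabelLin_apply, insertionLin_apply]
    refine ite_mul_aux (thin_comm g.graph) ?_
    rw [mul_right_comm]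
    exact congrArg₂ _ (congrArg₂ _ (relabel_congr K _ _ _ (contract_comm g.graph))
      (relabel_congr K _ _ _ fun _ _ => Iff.rfl)) (relabel_congr K _ _ _ fun _ _ => Iff.rfl)
  comp_assoc {A B C} _ _ _ x y z := by
    classical
    rcases isEmpty_or_nonempty C with hC | hC
    · rw [insertionLin_of_isEmpty K (B := C), insertionLin_of_isEmpty K (B := C)]; simp
    ext g
    simp only [relabelLin_apply, insertionLin_apply]
    refine ite_mul_aux' (thin_assoc g.graph) ?_
    rw [mul_assoc]
    refine congrArg₂ _ (relabel_congr K _ _ _ (contract_assoc g.graph))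
      (congrArg₂ _ (relabel_congr K _ _ _ ?_) (relabel_congr K _ _ _ fun _ _ => Iff.rfl))
    rintro (_ | b) (_ | b') <;> exact Iff.rfl
  comp_unit {A} _ x := by
    classical
    ext g
    have ht : Thin g.graph := fun _ _ _ _ _ => rfl
    rw [relabelLin_apply, insertionLin_apply, if_pos ht]
    have hu : (⟨g.graph.comap Sum.inr, inferInstance⟩ : GraphOn Unit) = ⟨⊥, ⟨()⟩⟩ :=
      GraphOn.ext (Subsingleton.elim _ _)
    rw [hu, Finsupp.single_eq_same, mul_one]
    refine relabel_congr K _ _ _ ?_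
    rintro (_ | a) (_ | a')
    · simp
    · exact ⟨fun ⟨_, h⟩ => h.symm, fun h => ⟨(), h.symm⟩⟩
    · exact ⟨fun ⟨_, h⟩ => h, fun h => ⟨(), h⟩⟩
    · exact Iff.rfl
  unit_comp {B} _ y := by
    classical
    rcases isEmpty_or_nonempty B with hB | hB
    · rw [insertionLin_of_isEmpty]
      ext g
      exact (not_isEmpty_iff.mpr g.nonempty inferInstance).elim
    ext g
    have ht : Thin g.graph := fun a => a.elim
    rw [relabelLin_apply, insertionLin_apply, relabelLin_apply, if_pos ht]
    have hu : (⟨(contract g.graph).comap starOnly, ⟨()⟩⟩ : GraphOn Unit) = ⟨⊥, ⟨()⟩⟩ :=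
      GraphOn.ext (Subsingleton.elim _ _)
    rw [hu, Finsupp.single_eq_same, one_mul]
    exact relabel_congr K _ _ _ fun _ _ => Iff.rfl

/-! ### The operad `SP` and its presentation -/

/-- The two-vertex graph with no edge, on the vertex set `{0, 1}`. -/
def points (K : Type u) [Field K] : (KG K).obj (Fin 2) :=
  Finsupp.single (⟨⊥, ⟨0⟩⟩ : GraphOn (Fin 2)) 1

/-- The two-vertex graph with one edge, on the vertex set `{0, 1}`. -/
def segment (K : Type u) [Field K] : (KG K).obj (Fin 2) :=
  Finsupp.single (⟨⊤, ⟨0⟩⟩ : GraphOn (Fin 2)) 1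

/-- The suboperad of `K G` generated by the two graphs `points` and `segment`. -/
def SP (K : Type u) [Field K] : Operad.{u, u} K :=
  (Suboperad.generated (KG K) (fun _ : Fin 2 => Fin 2) ![points K, segment K]).toOperad

/-- The subspecies of `K G` generated by `points` and `segment`. -/
def genSubspecies (K : Type u) [Field K] : Subspecies (KG K).toSpecies :=
  Subspecies.generated (KG K).toSpecies (fun _ : Fin 2 => Fin 2) ![points K, segment K]

/-- The species `G` of generators. -/
def G (K : Type u) [Field K] : Species.{u, u} K := (genSubspecies K).toSpecies

/-- The graph `points`, as an element of `G`. -/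
def ptG (K : Type u) [Field K] : (G K).obj (Fin 2) :=
  ⟨points K, Subspecies.mem_generated (KG K).toSpecies (fun _ : Fin 2 => Fin 2)
    ![points K, segment K] 0⟩

/-- The graph `segment`, as an element of `G`. -/
def segG (K : Type u) [Field K] : (G K).obj (Fin 2) :=
  ⟨segment K, Subspecies.mem_generated (KG K).toSpecies (fun _ : Fin 2 => Fin 2)
    ![points K, segment K] 1⟩

/-- The bijection `{∗'} ⊔ {0, 1} ≃ {0, 1, 2}` with `∗' ↦ i`, `0 ↦ j`, `1 ↦ k`. -/
def place (i j k : Fin 3)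
    (h : Function.Bijective (Sum.elim (fun _ => i) ![j, k] : Unit ⊕ Fin 2 → Fin 3)) :
    Unit ⊕ Fin 2 ≃ Fin 3 :=
  Equiv.ofBijective _ h

/-- The bijection `{0, 1} ≃ {∗'} ⊔ {∗}` with `0 ↦ ∗'`, `1 ↦ ∗`. -/
def starPair : Fin 2 ≃ Option Unit where
  toFun := ![some (), none]
  invFun
    | some _ => 0
    | none => 1
  left_inv v := by fin_cases v <;> rfl
  right_inv := by rintro (_ | _) <;> rfl

/-- For `x, y ∈ G[{0, 1}]` and `{i, j, k} = {0, 1, 2}`, the element `x_{i ∗} ∘_∗ y_{j k}` of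
`Free_G[{0, 1, 2}]`, where `x_{i ∗}` is `x` transported along `0 ↦ i, 1 ↦ ∗`, and `y_{j k}` is `y`
transported along `0 ↦ j, 1 ↦ k`. -/
def graft (K : Type u) [Field K] (x y : (G K).obj (Fin 2)) (i j k : Fin 3)
    (h : Function.Bijective (Sum.elim (fun _ => i) ![j, k] : Unit ⊕ Fin 2 → Fin 3)) :
    (Free (G K)).obj (Fin 3) :=
  (Free (G K)).map (place i j k h)
    ((Free (G K)).comp Unit (Fin 2) (Free.gen ((G K).map starPair x)) (Free.gen y))

/-- With `a, b, c = 0, 1, 2`: `points_{c ∗} ∘_∗ points_{a b} - points_{a ∗} ∘_∗ points_{b c}`. -/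
def rel₁ (K : Type u) [Field K] : (Free (G K)).obj (Fin 3) :=
  graft K (ptG K) (ptG K) 2 0 1 (by decide) - graft K (ptG K) (ptG K) 0 1 2 (by decide)

/-- With `a, b, c = 0, 1, 2`: `segment_{a ∗} ∘_∗ points_{b c} - points_{c ∗} ∘_∗ segment_{a b} -
points_{b ∗} ∘_∗ segment_{a c}`. -/
def rel₂ (K : Type u) [Field K] : (Free (G K)).obj (Fin 3) :=
  graft K (segG K) (ptG K) 0 1 2 (by decide) - graft K (ptG K) (segG K) 2 0 1 (by decide) -
    graft K (ptG K) (segG K) 1 0 2 (by decide)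

/-- The subspecies `R` of `Free_G` generated by the two relations. -/
def R (K : Type u) [Field K] : Subspecies (Free (G K)).toSpecies :=
  Subspecies.generated (Free (G K)).toSpecies (fun _ : Fin 2 => Fin 3) ![rel₁ K, rel₂ K]

end GraphOperad

end

/-!
The relations of the presentation hold in the operad of graphs, so the morphism from the free operad
to `SP` factors through a surjective morphism `ψ : Ope(G, R) → SP`. The content of the theorem is the
injectivity of `ψ`.

Let `p` and `s` be the classes of the two generators in `O = Ope(G, R)`. For a finite set `V`, the
product `M` of the spaces `O[A]`, for `A ⊆ V`, is a commutative algebra for `p`, with a symmetric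
bracket defined by `s`; both operations vanish on elements which share a label. The two relations say
that the product is associative and that the bracket is a derivation in each argument (`LabelAlg`).
Every element of `O[V]` comes from the unit by products and brackets (`binaryGen`).

In the operad of graphs, the product is the disjoint union, and the bracket of two graphs is the sum
of the graphs obtained by joining them with an edge in all possible ways. If a graph is encoded by the
monomial formed by its edges, then the bracket of polynomials `f`, `g` attached to disjoint sets
`A`, `B` is `(∑ i ∈ A, ∑ j ∈ B, X_{ij}) f g` (`weight_op_segment`).

The key point is the existence of elements `τ(T)` of `M`, one for each tree `T` with vertices in `V`,
with prescribed values on one-vertex trees and such that `[τ(T), τ(T')]` is the sum of `τ` over the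
trees joining `T` and `T'` by an edge (`exists_treeMap`). They are chosen by induction on the number
of vertices. This is possible because the sums obtained by adding an edge to a forest with two
components, in all the ways that produce a tree, are linearly independent
(`linearIndependent_addEdge`). Dually, a function `c` on two-component forests whose sum over the
forests `T ∖ e`, for `e ∈ T`, is zero for all trees `T` vanishes (`eq_zero_of_sum_erase_eq_zero`):
comparing two trees which differ by the place where a leaf is attached, one sees by induction that
`c` does not change when a leaf is moved, hence `c` is constant, and it is zero since the
characteristic is zero.

Extend `τ` to forests by products. By the derivation property, each element `x` of `O[V]` is then a
combination of the elements `τ(F)` for forests `F` with vertex set `V`, in such a way that `ψ(x)` is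
the same combination of the monomials of the forests `F` (`BinaryGen.lab_weight_mem`). Different
forests have different monomials, so `ψ(x) = 0` implies that the coefficients, and therefore `x`,
vanish (`eq_zero_of_mem_forestPairs`).
-/

noncomputable section

namespace GraphOperad

universe u w w' w''

/-! ### Trees and two-component forests -/

section Forests

variable {V : Type} [DecidableEq V]

/-- `Built S A E` says that `E` is the edge set of a forest with vertex set `A`, each component of
which contains exactly one element of the root set `S`. Forests are grown from their roots by
attaching leaves. -/
inductive Built (S : Finset V) : Finset V → Finset (Sym2 V) → Prop
  | root : Built S S ∅
  | leaf {A : Finset V} {E : Finset (Sym2 V)} {a v : V} (h : Built S A E) (ha : a ∈ A)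
      (hv : v ∉ A) : Built S (insert v A) (insert s(a, v) E)

/-- `E` is the edge set of a tree with vertex set `A`. -/
def IsTree (A : Finset V) (E : Finset (Sym2 V)) : Prop := ∃ r, Built {r} A E

/-- `E` is the edge set of a forest with vertex set `A` and exactly two components. -/
def IsTwoForest (A : Finset V) (E : Finset (Sym2 V)) : Prop :=
  ∃ r s, r ≠ s ∧ Built {r, s} A E

theorem Built.subset {S A : Finset V} {E : Finset (Sym2 V)} (h : Built S A E) : S ⊆ A := by
  induction h with
  | root => exact subset_rfl
  | leaf _ _ _ ih => exact ih.trans (Finset.subset_insert _ _)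

theorem Built.mem {S A : Finset V} {E : Finset (Sym2 V)} (h : Built S A E) {e : Sym2 V}
    (he : e ∈ E) {x : V} (hx : x ∈ e) : x ∈ A := by
  induction h with
  | root => simp at he
  | leaf _ ha _ ih =>
    rcases Finset.mem_insert.mp he with rfl | he
    · rcases Sym2.mem_iff.mp hx with rfl | rfl
      · exact Finset.mem_insert_of_mem ha
      · exact Finset.mem_insert_self _ _
    · exact Finset.mem_insert_of_mem (ih he)

theorem Built.notMem {S A : Finset V} {E : Finset (Sym2 V)} (h : Built S A E) {a v : V}
    (hv : v ∉ A) : s(a, v) ∉ E :=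
  fun he => hv (h.mem he (Sym2.mem_mk_right a v))

theorem IsTree.mem {A : Finset V} {E : Finset (Sym2 V)} (h : IsTree A E) {e : Sym2 V}
    (he : e ∈ E) {x : V} (hx : x ∈ e) : x ∈ A := h.choose_spec.mem he hx

theorem IsTree.nonempty {A : Finset V} {E : Finset (Sym2 V)} (h : IsTree A E) : A.Nonempty :=
  ⟨h.choose, h.choose_spec.subset (Finset.mem_singleton_self _)⟩

/-- Trees are connected: a set of vertices closed under adjacency contains all or nothing. -/
theorem IsTree.subset_of_closed {A : Finset V} {E : Finset (Sym2 V)} (h : IsTree A E)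
    {X : Set V} (hX : ∀ x y, s(x, y) ∈ E → x ∈ X → y ∈ X) {x : V} (hxA : x ∈ A) (hx : x ∈ X) :
    ∀ y ∈ A, y ∈ X := by
  obtain ⟨r, h⟩ := h
  induction h generalizing x with
  | root =>
    intro y hy
    rw [Finset.mem_singleton] at hxA hy
    exact hy ▸ hxA ▸ hx
  | @leaf A E a v h ha hv ih =>
    have hX' : ∀ x y, s(x, y) ∈ E → x ∈ X → y ∈ X :=
      fun x y he => hX x y (Finset.mem_insert_of_mem he)
    have hA : ∀ y ∈ A, y ∈ X := by
      rcases Finset.mem_insert.mp hxA with rfl | hxA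
      · exact ih hX' ha (hX x a (by simp [Sym2.eq_swap]) hx)
      · exact ih hX' hxA hx
    intro y hy
    rcases Finset.mem_insert.mp hy with rfl | hy
    · exact hX a y (Finset.mem_insert_self _ _) (hA a ha)
    · exact hA y hy

theorem Built.insert_root {S A : Finset V} {E : Finset (Sym2 V)} (h : Built S A E) {v : V}
    (hv : v ∉ A) : Built (insert v S) (insert v A) E := by
  induction h with
  | root => exact .root
  | @leaf A E a x h ha hx ih =>
    rw [Finset.mem_insert, not_or] at hv
    rw [Finset.insert_comm]
    refine .leaf (ih hv.2) (Finset.mem_insert_of_mem ha) ?_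
    rw [Finset.mem_insert, not_or]
    exact ⟨fun e => hv.1 e.symm, hx⟩

/-- Two disjoint trees form a forest with two components. -/
theorem IsTree.isTwoForest_union {A B : Finset V} {E F : Finset (Sym2 V)} (hA : IsTree A E)
    (hB : IsTree B F) (hAB : Disjoint A B) : IsTwoForest (A ∪ B) (E ∪ F) := by
  obtain ⟨r, hr⟩ := hA
  obtain ⟨s, hs⟩ := hB
  refine ⟨s, r, fun e => Finset.disjoint_left.mp hAB (hr.subset (Finset.mem_singleton_self r))
    (e ▸ hs.subset (Finset.mem_singleton_self s)), ?_⟩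
  induction hs with
  | root =>
    rw [Finset.union_empty, Finset.union_comm, ← Finset.insert_eq]
    exact hr.insert_root (Finset.disjoint_singleton_right.mp hAB)
  | @leaf B F b v h hb hv ih =>
    rw [Finset.disjoint_insert_right] at hAB
    rw [Finset.union_insert, Finset.union_insert]
    refine .leaf (ih hAB.2) (Finset.mem_union_right _ hb) ?_
    rw [Finset.mem_union, not_or]
    exact ⟨hAB.1, hv⟩

/-- Grafting a tree, rooted at `b`, to the vertex `a` of a forest. -/
theorem Built.graft {S A B : Finset V} {E F : Finset (Sym2 V)} {a b : V} (hA : Built S A E)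
    (ha : a ∈ A) (hB : Built {b} B F) (hAB : Disjoint A B) :
    Built S (A ∪ B) (insert s(a, b) (E ∪ F)) := by
  induction hB with
  | root =>
    rw [Finset.union_empty, Finset.union_comm, ← Finset.insert_eq]
    exact .leaf hA ha (Finset.disjoint_singleton_right.mp hAB)
  | @leaf B F c v h hc hv ih =>
    rw [Finset.disjoint_insert_right] at hAB
    rw [Finset.union_insert, Finset.union_insert, Finset.insert_comm]
    refine .leaf (ih hAB.2) (Finset.mem_union_right _ hc) ?_
    rw [Finset.mem_union, not_or]
    exact ⟨hAB.1, hv⟩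

/-- A tree may be grown from any of its vertices. -/
theorem IsTree.built {A : Finset V} {E : Finset (Sym2 V)} (h : IsTree A E) {x : V}
    (hx : x ∈ A) : Built {x} A E := by
  obtain ⟨r, h⟩ := h
  induction h generalizing x with
  | root => rw [Finset.mem_singleton] at hx; exact hx ▸ .root
  | @leaf A E a v h ha hv ih =>
    rcases Finset.mem_insert.mp hx with rfl | hx
    · have := (Built.root (S := {x})).graft (Finset.mem_singleton_self x) (ih ha)
        (Finset.disjoint_singleton_left.mpr hv)
      rwa [Finset.empty_union, ← Finset.insert_eq, Sym2.eq_swap] at this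
    · exact .leaf (ih hx) ha hv

/-- Two disjoint trees joined by an edge form a tree. -/
theorem IsTree.join {A B : Finset V} {E F : Finset (Sym2 V)} {a b : V} (hA : IsTree A E)
    (ha : a ∈ A) (hB : IsTree B F) (hb : b ∈ B) (hAB : Disjoint A B) :
    IsTree (A ∪ B) (insert s(a, b) (E ∪ F)) :=
  ⟨a, (hA.built ha).graft ha (hB.built hb) hAB⟩

theorem IsTree.leaf {A : Finset V} {E : Finset (Sym2 V)} {a v : V} (h : IsTree A E) (ha : a ∈ A)
    (hv : v ∉ A) : IsTree (insert v A) (insert s(a, v) E) :=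
  let ⟨r, h⟩ := h
  ⟨r, .leaf h ha hv⟩

theorem IsTwoForest.leaf {A : Finset V} {E : Finset (Sym2 V)} {a v : V} (h : IsTwoForest A E)
    (ha : a ∈ A) (hv : v ∉ A) : IsTwoForest (insert v A) (insert s(a, v) E) :=
  let ⟨r, s, hrs, h⟩ := h
  ⟨r, s, hrs, .leaf h ha hv⟩

theorem IsTree.isTwoForest_insert {A : Finset V} {E : Finset (Sym2 V)} {v : V} (h : IsTree A E)
    (hv : v ∉ A) : IsTwoForest (insert v A) E := by
  have := h.isTwoForest_union ⟨v, .root⟩ (Finset.disjoint_singleton_right.mpr hv)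
  rwa [Finset.union_empty, Finset.union_comm, ← Finset.insert_eq] at this

/-- Removing an edge of a tree leaves two components. -/
theorem IsTree.isTwoForest_erase {A : Finset V} {E : Finset (Sym2 V)} (h : IsTree A E)
    {e : Sym2 V} (he : e ∈ E) : IsTwoForest A (E.erase e) := by
  obtain ⟨r, h⟩ := h
  induction h with
  | root => simp at he
  | @leaf A E a v h ha hv ih =>
    by_cases hav : e = s(a, v)
    · rw [hav, Finset.erase_insert (h.notMem hv)]
      exact IsTree.isTwoForest_insert ⟨r, h⟩ hv
    · rw [Finset.erase_insert_of_ne (fun h => hav h.symm)]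
      exact (ih (Finset.mem_of_mem_insert_of_ne he hav)).leaf ha hv

/-- The two components of a two-component forest. -/
theorem IsTwoForest.exists_trees {A : Finset V} {F : Finset (Sym2 V)} (h : IsTwoForest A F) :
    ∃ B C E₁ E₂, IsTree B E₁ ∧ IsTree C E₂ ∧ Disjoint B C ∧ B ∪ C = A ∧ E₁ ∪ E₂ = F := by
  obtain ⟨r, s, hrs, h⟩ := h
  induction h with
  | root =>
    exact ⟨{r}, {s}, ∅, ∅, ⟨r, .root⟩, ⟨s, .root⟩, Finset.disjoint_singleton.mpr hrs, rfl, rfl⟩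
  | @leaf A E a v h ha hv ih =>
    obtain ⟨B, C, E₁, E₂, hB, hC, hBC, rfl, rfl⟩ := ih
    rw [Finset.mem_union, not_or] at hv
    rcases Finset.mem_union.mp ha with ha | ha
    · exact ⟨insert v B, C, _, E₂, hB.leaf ha hv.1, hC, Finset.disjoint_insert_left.mpr ⟨hv.2, hBC⟩,
        Finset.insert_union _ _ _, Finset.insert_union _ _ _⟩
    · exact ⟨B, insert v C, E₁, _, hB, hC.leaf ha hv.2, Finset.disjoint_insert_right.mpr ⟨hv.1, hBC⟩,
        Finset.union_insert _ _ _, Finset.union_insert _ _ _⟩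

theorem exists_isTree {A : Finset V} (hA : A.Nonempty) : ∃ E, IsTree A E := by
  induction hA using Finset.Nonempty.cons_induction with
  | singleton a => exact ⟨∅, a, .root⟩
  | cons a s h hs ih =>
    obtain ⟨E, hE⟩ := ih
    obtain ⟨b, hb⟩ := hs
    rw [Finset.cons_eq_insert]
    exact ⟨_, hE.leaf hb h⟩

theorem IsTwoForest.two_le_card {A : Finset V} {F : Finset (Sym2 V)} (h : IsTwoForest A F) :
    2 ≤ A.card := by
  obtain ⟨r, s, hrs, h⟩ := h
  rw [← Finset.card_pair hrs]
  exact Finset.card_le_card h.subset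

theorem IsTwoForest.eq_empty {A : Finset V} {F : Finset (Sym2 V)} (h : IsTwoForest A F)
    (hA : A.card = 2) : F = ∅ := by
  obtain ⟨r, s, hrs, h⟩ := h
  cases h with
  | root => rfl
  | @leaf A E a v h ha hv =>
    rw [Finset.card_insert_of_notMem hv] at hA
    have := IsTwoForest.two_le_card ⟨r, s, hrs, h⟩
    omega

/-- A two-component forest on at least three vertices has a leaf whose removal leaves two
components. -/
theorem IsTwoForest.exists_leaf {A : Finset V} {F : Finset (Sym2 V)} (h : IsTwoForest A F)
    (hA : 3 ≤ A.card) : ∃ B E a v, IsTwoForest B E ∧ a ∈ B ∧ v ∉ B ∧ insert v B = A ∧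
      insert s(a, v) E = F := by
  obtain ⟨r, s, hrs, h⟩ := h
  cases h with
  | root => rw [Finset.card_pair hrs] at hA; omega
  | @leaf B E a v h ha hv => exact ⟨B, E, a, v, ⟨r, s, hrs, h⟩, ha, hv, rfl, rfl⟩

/-- A function on the two-component forests on `A` which does not change when a leaf is moved to
another vertex is constant. -/
theorem exists_eq_of_leaf_invariant {X : Type*} {A : Finset V} (c : Finset (Sym2 V) → X)
    (hA : 2 ≤ A.card)
    (hc : ∀ B v, v ∉ B → insert v B = A → ∀ a ∈ B, ∀ b ∈ B, ∀ F, IsTwoForest B F →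
      c (insert s(a, v) F) = c (insert s(b, v) F)) :
    ∃ k, ∀ F, IsTwoForest A F → c F = k := by
  obtain ⟨n, hn⟩ : ∃ n, A.card = n := ⟨_, rfl⟩
  induction n generalizing A c with
  | zero => omega
  | succ n ih =>
    rcases Nat.lt_or_ge n 2 with h2 | h2
    · exact ⟨c ∅, fun F hF => by rw [hF.eq_empty (by omega)]⟩
    have key : ∀ v ∈ A, ∃ k, ∀ F, IsTwoForest (A.erase v) F → ∀ a ∈ A.erase v,
        c (insert s(a, v) F) = k := by
      intro v hv
      have hcard : (A.erase v).card = n := by rw [Finset.card_erase_of_mem hv]; omega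
      obtain ⟨a₀, ha₀⟩ : (A.erase v).Nonempty := Finset.card_pos.mp (by omega)
      have hmove : ∀ F, IsTwoForest (A.erase v) F → ∀ a ∈ A.erase v, ∀ b ∈ A.erase v,
          c (insert s(a, v) F) = c (insert s(b, v) F) := fun F hF a ha b hb =>
        hc _ v (Finset.notMem_erase v A) (Finset.insert_erase hv) a ha b hb F hF
      obtain ⟨k, hk⟩ := ih (A := A.erase v) (fun F => c (insert s(a₀, v) F)) (by omega) (by
        intro B x hx hB a ha b hb F hF
        have hvB : v ∉ B := fun h => by
          have : v ∈ A.erase v := hB ▸ Finset.mem_insert_of_mem h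
          exact Finset.notMem_erase v A this
        have hxv : x ≠ v := fun h => by
          have : x ∈ A.erase v := hB ▸ Finset.mem_insert_self x B
          exact Finset.notMem_erase v A (h ▸ this)
        have haA : a ∈ A.erase v := hB ▸ Finset.mem_insert_of_mem ha
        have hG : ∀ b ∈ B, IsTwoForest (A.erase v) (insert s(b, x) F) := fun b hb =>
          hB ▸ hF.leaf hb hx
        have hAB : insert x (insert v B) = A := by
          rw [Finset.insert_comm, hB, Finset.insert_erase hv]
        have hx' : x ∉ insert v B := by simp [hx, hxv]
        -- `a₀` may be `x`, so that `v` is first moved to `a`, which stays when `x` is removed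
        change c (insert s(a₀, v) (insert s(a, x) F)) = c (insert s(a₀, v) (insert s(b, x) F))
        rw [hmove _ (hG a ha) a₀ ha₀ a haA, hmove _ (hG b hb) a₀ ha₀ a haA,
          Finset.insert_comm, Finset.insert_comm _ s(b, x)]
        exact hc _ x hx' hAB a (Finset.mem_insert_of_mem ha) b (Finset.mem_insert_of_mem hb) _
          (hF.leaf ha hvB)) hcard
      exact ⟨k, fun F hF a ha => (hmove F hF a ha a₀ ha₀).trans (hk F hF)⟩
    have : Nonempty X := ⟨c ∅⟩
    choose! k hk using key
    have hconst : ∀ v ∈ A, ∀ x ∈ A, k v = k x := by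
      intro v hv x hx
      by_cases hvx : v = x
      · rw [hvx]
      have hxv : x ∈ A.erase v := Finset.mem_erase.mpr ⟨fun h => hvx h.symm, hx⟩
      have hvx' : v ∈ A.erase x := Finset.mem_erase.mpr ⟨hvx, hv⟩
      have hne : ((A.erase v).erase x).Nonempty := Finset.card_pos.mp (by
        rw [Finset.card_erase_of_mem hxv, Finset.card_erase_of_mem hv]; omega)
      -- a tree on `A ∖ {v, x}`, together with the edge `xv`, has both `v` and `x` as leaves
      obtain ⟨T, hT⟩ := exists_isTree hne
      have h1 : IsTwoForest (A.erase v) T := by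
        have := hT.isTwoForest_insert (Finset.notMem_erase x _)
        rwa [Finset.insert_erase hxv] at this
      have h2 : IsTwoForest (A.erase x) T := by
        rw [Finset.erase_right_comm] at hT
        have := hT.isTwoForest_insert (Finset.notMem_erase v _)
        rwa [Finset.insert_erase hvx'] at this
      rw [← hk v hv T h1 x hxv, ← hk x hx T h2 v hvx', Sym2.eq_swap]
    obtain ⟨v₀, hv₀⟩ : A.Nonempty := Finset.card_pos.mp (by omega)
    refine ⟨k v₀, fun F hF => ?_⟩
    obtain ⟨B, E, a, v, hE, ha, hv, rfl, rfl⟩ := hF.exists_leaf (by omega)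
    have hB : (insert v B).erase v = B := Finset.erase_insert hv
    rw [hk v (Finset.mem_insert_self v B) E (hB.symm ▸ hE) a (hB.symm ▸ ha)]
    exact hconst _ (Finset.mem_insert_self v B) _ hv₀

/-- The map sending a tree to the sum of the two-component forests obtained by removing an edge
is onto, in dual form. By induction, the value of `c` at a forest does not change when a leaf is
moved to another vertex, so that `c` is constant; its value vanishes in characteristic zero. -/
theorem eq_zero_of_sum_erase_eq_zero {K : Type*} [Field K] [CharZero K] {A : Finset V}
    (c : Finset (Sym2 V) → K) (hc : ∀ T, IsTree A T → ∑ e ∈ T, c (T.erase e) = 0)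
    {F : Finset (Sym2 V)} (hF : IsTwoForest A F) : c F = 0 := by
  obtain ⟨n, hn⟩ : ∃ n, A.card = n := ⟨_, rfl⟩
  induction n generalizing A c F with
  | zero => have := hF.two_le_card; omega
  | succ n ih =>
    have h2 := hF.two_le_card
    obtain ⟨k, hk⟩ := exists_eq_of_leaf_invariant c h2 (by
      intro B v hv hB a ha b hb F hF
      have hcard : B.card = n := by
        rw [← hB, Finset.card_insert_of_notMem hv] at hn
        omega
      refine sub_eq_zero.mp (ih (A := B)
        (fun F => c (insert s(a, v) F) - c (insert s(b, v) F)) (fun T hT => ?_) hF hcard)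
      -- the hypothesis for the tree `T` with the leaf `v` attached to `a`; the first term comes
      -- from the edge `av` and does not depend on `a`
      have h : ∀ a ∈ B, c T + ∑ e ∈ T, c (insert s(a, v) (T.erase e)) = 0 := by
        intro a ha
        have hav : s(a, v) ∉ T := fun h => hv (hT.mem h (Sym2.mem_mk_right a v))
        rw [← hc _ (hB ▸ hT.leaf ha hv), Finset.sum_insert hav, Finset.erase_insert hav]
        refine congrArg _ (Finset.sum_congr rfl fun e he => ?_)
        rw [Finset.erase_insert_of_ne (fun h : s(a, v) = e => hav (h ▸ he))]
      rw [Finset.sum_sub_distrib, sub_eq_zero]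
      exact add_left_cancel ((h a ha).trans (h b hb).symm))
    obtain ⟨T, hT⟩ := exists_isTree (A := A) (Finset.card_pos.mp (by omega))
    have hT0 : T.Nonempty := by
      obtain ⟨r, hr⟩ := hT
      cases hr with
      | root => simp at h2
      | leaf => exact Finset.insert_nonempty _ _
    have h := hc T hT
    rw [Finset.sum_congr rfl fun e he => hk _ (hT.isTwoForest_erase he), Finset.sum_const,
      smul_eq_zero] at h
    rw [hk F hF]
    exact h.resolve_left (Finset.card_pos.mpr hT0).ne'

variable [Fintype V]

open Classical in
/-- The sum of the trees on `A` obtained by adding an edge to `F`. -/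
def addEdge (K : Type u) [Field K] (A : Finset V) (F : Finset (Sym2 V)) :
    Finset (Sym2 V) →₀ K :=
  ∑ e with e ∉ F ∧ IsTree A (insert e F), Finsupp.single (insert e F) 1

/-- The coefficients of a linear relation form a function on two-component forests whose sum over
the forests `T.erase e` is zero for all trees `T`. -/
theorem linearIndependent_addEdge (K : Type u) [Field K] [CharZero K] (A : Finset V) :
    LinearIndependent K fun F : {F // IsTwoForest A F} => addEdge K A F.1 := by
  classical
  rw [Fintype.linearIndependent_iff]
  intro g hg ⟨F, hF⟩
  let c : Finset (Sym2 V) → K := fun F => if h : IsTwoForest A F then g ⟨F, h⟩ else 0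
  have hc : c F = g ⟨F, hF⟩ := dif_pos hF
  rw [← hc]
  refine eq_zero_of_sum_erase_eq_zero c (fun T hT => ?_) hF
  have hcoeff : ∀ F, addEdge K A F T = ∑ e ∈ T, if F = T.erase e then 1 else 0 := by
    intro F
    rw [addEdge, Finsupp.finsetSum_apply, Finset.sum_filter, ← Finset.sum_subset T.subset_univ]
    · refine Finset.sum_congr rfl fun e he => ?_
      rw [Finsupp.single_apply, ← ite_and]
      refine if_congr ⟨?_, ?_⟩ rfl rfl
      · rintro ⟨⟨h, -⟩, rfl⟩
        exact (Finset.erase_insert h).symm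
      · rintro rfl
        rw [Finset.insert_erase he]
        exact ⟨⟨Finset.notMem_erase _ _, hT⟩, rfl⟩
    · intro e _ he
      refine ite_eq_right_iff.mpr fun _ => Finsupp.single_eq_of_ne ?_
      rintro rfl
      exact he (Finset.mem_insert_self _ _)
  have hgT := DFunLike.congr_fun hg T
  simp only [Finsupp.finsetSum_apply, Finsupp.smul_apply, hcoeff, smul_eq_mul, Finset.mul_sum,
    Finsupp.zero_apply] at hgT
  rw [Finset.sum_comm] at hgT
  rw [← hgT]
  refine Finset.sum_congr rfl fun e he => ?_
  have hTe := hT.isTwoForest_erase he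
  rw [Finset.sum_eq_single ⟨T.erase e, hTe⟩, if_pos rfl, mul_one]
  · exact dif_pos hTe
  · intro F _ hne
    rw [if_neg fun h => hne (Subtype.ext h), mul_zero]
  · exact fun h => (h (Finset.mem_univ _)).elim

/-- Adding an edge between the two components of a forest is the only way to make it a tree. -/
theorem addEdge_union (K : Type u) [Field K] {A B : Finset V} {E F : Finset (Sym2 V)}
    (hA : IsTree A E) (hB : IsTree B F) (hAB : Disjoint A B) :
    addEdge K (A ∪ B) (E ∪ F) =
      ∑ a ∈ A, ∑ b ∈ B, Finsupp.single (insert s(a, b) (E ∪ F)) 1 := by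
  classical
  rw [← Finset.sum_product', addEdge]
  symm
  refine Finset.sum_bij (fun p _ => s(p.1, p.2)) ?_ ?_ ?_ (fun _ _ => rfl)
  · rintro ⟨a, b⟩ h
    obtain ⟨ha, hb⟩ := Finset.mem_product.mp h
    refine Finset.mem_filter.mpr ⟨Finset.mem_univ _, ?_, hA.join ha hB hb hAB⟩
    rw [Finset.mem_union, not_or]
    exact ⟨fun h => Finset.disjoint_left.mp hAB (hA.mem h (Sym2.mem_mk_right a b)) hb,
      fun h => Finset.disjoint_left.mp hAB ha (hB.mem h (Sym2.mem_mk_left a b))⟩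
  · rintro ⟨a, b⟩ h ⟨a', b'⟩ h' e
    obtain ⟨ha, hb⟩ := Finset.mem_product.mp h
    obtain ⟨ha', hb'⟩ := Finset.mem_product.mp h'
    rcases Sym2.eq_iff.mp e with ⟨rfl, rfl⟩ | ⟨rfl, rfl⟩
    · rfl
    · exact (Finset.disjoint_left.mp hAB ha hb').elim
  · intro e he
    obtain ⟨-, heF, hT⟩ := Finset.mem_filter.mp he
    induction e with | _ x y
    have hxy : ∀ z ∈ s(x, y), z ∈ A ∪ B := fun z hz => hT.mem (Finset.mem_insert_self _ _) hz
    have hx := Finset.mem_union.mp (hxy x (Sym2.mem_mk_left x y))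
    have hy := Finset.mem_union.mp (hxy y (Sym2.mem_mk_right x y))
    by_contra hcon
    have hcross : ∀ a ∈ A, ∀ b ∈ B, s(a, b) ≠ s(x, y) := fun a ha b hb h =>
      hcon ⟨(a, b), Finset.mem_product.mpr ⟨ha, hb⟩, h⟩
    -- otherwise `A` is closed under adjacency in the tree
    obtain ⟨a, ha⟩ := hA.nonempty
    obtain ⟨b, hb⟩ := hB.nonempty
    refine Finset.disjoint_left.mp hAB (hT.subset_of_closed (X := A) ?_
      (Finset.mem_union_left _ ha) ha b (Finset.mem_union_right _ hb)) hb
    intro p q hpq hp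
    rcases Finset.mem_insert.mp hpq with h | h
    · by_contra hq
      refine hcross p hp q ?_ h
      have : q ∈ s(x, y) := h ▸ Sym2.mem_mk_right p q
      exact (Finset.mem_union.mp (hxy q this)).resolve_left hq
    · rcases Finset.mem_union.mp h with h | h
      · exact hA.mem h (Sym2.mem_mk_right p q)
      · exact (Finset.disjoint_left.mp hAB hp (hB.mem h (Sym2.mem_mk_left p q))).elim

end Forests

/-! ### Binary operations of an operad -/

namespace Operad

section Op

variable {K : Type u} [Field K] (O : Operad.{u, w'} K)

theorem map_map {U V W : Type} [Finite U] [Finite V] [Finite W] (σ : U ≃ V) (τ : V ≃ W)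
    (x : O.obj U) : O.map τ (O.map σ x) = O.map (σ.trans τ) x :=
  (O.map_trans σ τ x).symm

theorem map_injective {V W : Type} [Finite V] [Finite W] (σ : V ≃ W) :
    Function.Injective (O.map σ) := fun x y h => by
  have := congrArg (O.map σ.symm) h
  rwa [map_map, map_map, σ.self_trans_symm, O.map_refl, O.map_refl] at this

theorem comp_map_left {A A' B : Type} [Finite A] [Finite A'] [Finite B] (σ : A ≃ A')
    (x : O.obj (Option A)) (y : O.obj B) :
    O.comp A' B (O.map (Equiv.optionCongr σ) x) y =
      O.map (Equiv.sumCongr σ (Equiv.refl B)) (O.comp A B x y) := by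
  rw [← O.comp_map, O.map_refl]

theorem comp_map_right {A B B' : Type} [Finite A] [Finite B] [Finite B'] (τ : B ≃ B')
    (x : O.obj (Option A)) (y : O.obj B) :
    O.comp A B' x (O.map τ y) = O.map (Equiv.sumCongr (Equiv.refl A) τ) (O.comp A B x y) := by
  rw [← O.comp_map, Equiv.optionCongr_refl, O.map_refl]

/-- The two points of `Fin 2`, as two adjoined points, the first one outermost. -/
def pairSlots : Fin 2 ≃ Option (Option Empty) where
  toFun := ![none, some none]
  invFun
    | none => 0
    | some _ => 1
  left_inv v := by fin_cases v <;> rfl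
  right_inv := by rintro (_ | _ | a) <;> [rfl; rfl; exact a.elim]

/-- The operation `(x, y) ↦ (q ∘₀ x) ∘₁ y` defined by an element `q` of arity two. -/
def op (q : O.obj (Fin 2)) (A B : Type) [Finite A] [Finite B] :
    O.obj A →ₗ[K] O.obj B →ₗ[K] O.obj (A ⊕ B) :=
  LinearMap.mk₂ K (fun x y => O.map (Equiv.sumCongr (Equiv.emptySum Empty A) (Equiv.refl B))
      (O.comp (Empty ⊕ A) B
        (O.map (starLeft Empty A) (O.comp (Option Empty) A (O.map pairSlots q) x)) y))
    (by simp) (by simp) (by simp) (by simp)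

variable {O} {A A' B B' C : Type} [Finite A] [Finite A'] [Finite B] [Finite B'] [Finite C]
  (q : O.obj (Fin 2))

theorem op_apply (x : O.obj A) (y : O.obj B) : O.op q A B x y =
    O.map (Equiv.sumCongr (Equiv.emptySum Empty A) (Equiv.refl B)) (O.comp (Empty ⊕ A) B
      (O.map (starLeft Empty A) (O.comp (Option Empty) A (O.map pairSlots q) x)) y) := rfl

theorem op_map (σ : A ≃ A') (τ : B ≃ B') (x : O.obj A) (y : O.obj B) :
    O.op q A' B' (O.map σ x) (O.map τ y) = O.map (Equiv.sumCongr σ τ) (O.op q A B x y) := by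
  have h : ((Equiv.refl (Option Empty)).sumCongr σ).trans (starLeft Empty A') =
      (starLeft Empty A).trans (Equiv.optionCongr ((Equiv.refl Empty).sumCongr σ)) := by
    ext1 ((_ | a) | a) <;> rfl
  rw [op_apply, op_apply, comp_map_right, comp_map_right, map_map O _ (starLeft Empty A'), h,
    ← map_map O (starLeft Empty A), comp_map_left, map_map, map_map, map_map]
  congr 2
  ext1 ((a | a) | b)
  · exact a.elim
  · rfl
  · rfl

theorem op_comm (hq : O.map (Equiv.swap 0 1) q = q) (x : O.obj A) (y : O.obj B) :
    O.op q B A y x = O.map (Equiv.sumComm A B) (O.op q A B x y) := by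
  have h : O.map (starSwap Empty) (O.map pairSlots q) = O.map pairSlots q := by
    conv_rhs => rw [← hq]
    rw [map_map, map_map]
    congr 2
    ext1 v
    fin_cases v <;> rfl
  rw [op_apply, op_apply, O.comp_comm, h, map_map, map_map]
  congr 2
  ext1 ((a | a) | b)
  · exact a.elim
  · rfl
  · rfl

/-- Composition at a point of the second argument. -/
theorem op_comp_right (x : O.obj A) (y : O.obj (Option B)) (z : O.obj C) :
    O.comp (A ⊕ B) C (O.map (starRight A B) (O.op q A (Option B) x y)) z =
      O.map (Equiv.sumAssoc A B C).symm (O.op q A (B ⊕ C) x (O.comp B C y z)) := by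
  have h : ((Equiv.emptySum Empty A).sumCongr (Equiv.refl (Option B))).trans (starRight A B) =
      (starRight (Empty ⊕ A) B).trans
        (Equiv.optionCongr ((Equiv.emptySum Empty A).sumCongr (Equiv.refl B))) := by
    ext1 ((a | a) | (_ | b))
    · exact a.elim
    all_goals rfl
  rw [op_apply, op_apply, map_map, h, ← map_map, comp_map_left, O.comp_assoc, map_map, map_map]
  congr 2
  ext1 ((a | a) | (b | c))
  · exact a.elim
  all_goals rfl

/-- Composition at a point of the first argument. -/
theorem op_comp_left (x : O.obj (Option A)) (y : O.obj B) (z : O.obj C) :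
    O.comp (A ⊕ B) C (O.map (starLeft A B) (O.op q (Option A) B x y)) z =
      O.map (sumRightComm A B C) (O.op q (A ⊕ C) B (O.comp A C x z) y) := by
  -- the substitution at the second slot of `q` is exchanged with the one in `x`, and the latter
  -- is then nested
  have h := O.comp_comm (O.map ((starLeft Empty (Option A)).trans
    (Equiv.optionCongr (starRight Empty A)))
    (O.comp (Option Empty) (Option A) (O.map pairSlots q) x)) y z
  have h' : ((starLeft Empty (Option A)).trans (Equiv.optionCongr (starRight Empty A))).trans
      (starSwap (Empty ⊕ A)) = (starRight (Option Empty) A).trans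
        (Equiv.optionCongr (starLeft Empty A)) := by
    ext1 ((_ | a) | (_ | b)) <;> rfl
  rw [map_map, h', ← map_map, ← map_map, comp_map_left, comp_map_left, O.comp_assoc] at h
  rw [op_apply, op_apply]
  have h1 : ((Equiv.emptySum Empty (Option A)).sumCongr (Equiv.refl B)).trans (starLeft A B) =
      (((starRight Empty A).sumCongr (Equiv.refl B)).trans (starLeft (Empty ⊕ A) B)).trans
        (Equiv.optionCongr ((Equiv.emptySum Empty A).sumCongr (Equiv.refl B))) := by
    ext1 ((a | (_ | a)) | b) <;> first | rfl | exact a.elim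
  rw [map_map, h1, ← map_map, comp_map_left, ← map_map, h, map_map, map_map, map_map, map_map]
  have h2 : (Equiv.sumAssoc (Option Empty) A C).symm.trans
      (((starLeft Empty A).sumCongr (Equiv.refl C)).trans (starLeft (Empty ⊕ A) C)) =
      (starLeft Empty (A ⊕ C)).trans (Equiv.optionCongr (Equiv.sumAssoc Empty A C).symm) := by
    ext1 ((_ | a) | (_ | b)) <;> rfl
  rw [h2, ← map_map O (starLeft Empty (A ⊕ C)), comp_map_left, map_map]
  congr 2
  ext1 ((a | (a | b)) | c) <;> first | rfl | exact a.elim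

/-- The points of `Unit ⊕ Unit`, numbered. -/
def pairUnits : Unit ⊕ Unit ≃ Fin 2 where
  toFun := Sum.elim (fun _ => 0) (fun _ => 1)
  invFun := ![.inl (), .inr ()]
  left_inv := by rintro (_ | _) <;> rfl
  right_inv v := by fin_cases v <;> rfl

theorem comp_starPair_eq_op (y : O.obj B) :
    O.comp Unit B (O.map starPair q) y = O.op q Unit B O.unit y := by
  have h : pairSlots.trans (((Equiv.optionEquivSumPUnit (Option Empty)).trans
      (starLeft Empty Unit)).trans (Equiv.optionCongr (Equiv.emptySum Empty Unit))) = starPair := by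
    ext1 v
    fin_cases v <;> rfl
  rw [op_apply, O.comp_unit, map_map, ← comp_map_left, map_map, map_map, h]

theorem op_unit_unit : O.op q Unit Unit O.unit O.unit = O.map pairUnits.symm q := by
  rw [← comp_starPair_eq_op, O.comp_unit, map_map]
  congr 2
  ext1 v
  fin_cases v <;> rfl

/-- Composition at a first argument which is a single point. -/
theorem comp_op_unit_left {D : Type} [Finite D] (e : Unit ⊕ B ≃ Option D) (g : B ≃ D)
    (h₀ : e (.inl ()) = none) (h : ∀ b, e (.inr b) = some (g b)) (y : O.obj B) (z : O.obj C) :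
    O.comp D C (O.map e (O.op q Unit B O.unit y)) z =
      O.map ((Equiv.sumComm C B).trans (g.sumCongr (Equiv.refl C))) (O.op q C B z y) := by
  have he : e = (starOnly.sumCongr (Equiv.refl B)).trans ((starLeft Empty B).trans
      (Equiv.optionCongr ((Equiv.emptySum Empty B).trans g))) := by
    ext1 (_ | b)
    · exact h₀
    · exact h b
  rw [he, ← map_map, ← op_map, O.map_refl, ← map_map, comp_map_left, op_comp_left, O.unit_comp,
    map_map]
  have := op_map q (Equiv.emptySum Empty C).symm (Equiv.refl B) z y
  rw [O.map_refl] at this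
  rw [this, map_map]
  congr 2
  ext1 (c | b) <;> rfl

/-- Composition at a point of the second argument, up to relabellings. -/
theorem comp_op_right {D B' : Type} [Finite D] [Finite B'] (e : A ⊕ B ≃ Option D)
    (e' : B ≃ Option B') (g : A ⊕ B' ≃ D) (h₁ : ∀ a, e (.inl a) = some (g (.inl a)))
    (h₂ : ∀ b, e (.inr b) = (e' b).map fun b' => g (.inr b'))
    (x : O.obj A) (y : O.obj B) (z : O.obj C) :
    O.comp D C (O.map e (O.op q A B x y)) z =
      O.map ((Equiv.sumAssoc A B' C).symm.trans (g.sumCongr (Equiv.refl C)))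
        (O.op q A (B' ⊕ C) x (O.comp B' C (O.map e' y) z)) := by
  have he : e = ((Equiv.refl A).sumCongr e').trans ((starRight A B').trans
      (Equiv.optionCongr g)) := by
    ext1 (a | b)
    · exact h₁ a
    · rw [h₂ b]
      change _ = Option.map g (starRight A B' (.inr (e' b)))
      rcases e' b with _ | b <;> rfl
  rw [he, ← map_map, ← op_map, O.map_refl, ← map_map, comp_map_left, op_comp_right, map_map]

/-- Composition at a second argument which is a single point. -/
theorem comp_op_unit_right {D : Type} [Finite D] (e : A ⊕ Unit ≃ Option D) (g : A ≃ D)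
    (h₁ : ∀ a, e (.inl a) = some (g a)) (h₀ : e (.inr ()) = none) (x : O.obj A) (z : O.obj C) :
    O.comp D C (O.map e (O.op q A Unit x O.unit)) z =
      O.map (g.sumCongr (Equiv.refl C)) (O.op q A C x z) := by
  rw [comp_op_right q e starOnly ((Equiv.sumEmpty A Empty).trans g) h₁ (fun _ => h₀),
    O.unit_comp]
  have := op_map q (Equiv.refl A) (Equiv.emptySum Empty C).symm x z
  rw [O.map_refl] at this
  rw [this, map_map]
  congr 2
  ext1 (c | b) <;> rfl

variable {q} (q' : O.obj (Fin 2))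

theorem comp_op_op_unit_left {D B' : Type} [Finite D] [Finite B'] (e : A ⊕ (Unit ⊕ B) ≃ Option D)
    (g : A ⊕ B ≃ D) (h₁ : ∀ a, e (.inl a) = some (g (.inl a))) (h₀ : e (.inr (.inl ())) = none)
    (h₂ : ∀ b, e (.inr (.inr b)) = some (g (.inr b)))
    (x : O.obj A) (y : O.obj B) (z : O.obj C) :
    O.comp D C (O.map e (O.op q A (Unit ⊕ B) x (O.op q' Unit B O.unit y))) z =
      O.map (((Equiv.refl A).sumCongr (Equiv.sumComm C B)).trans
        ((Equiv.sumAssoc A B C).symm.trans (g.sumCongr (Equiv.refl C))))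
        (O.op q A (C ⊕ B) x (O.op q' C B z y)) := by
  rw [comp_op_right q e ((Equiv.sumComm Unit B).trans (Equiv.optionEquivSumPUnit B).symm) g h₁
      (by rintro (_ | b) <;> [exact h₀; exact h₂ b]),
    comp_op_unit_left q' _ (Equiv.refl B) rfl (fun _ => rfl)]
  have := op_map q (Equiv.refl A) ((Equiv.sumComm C B).trans
    ((Equiv.refl B).sumCongr (Equiv.refl C))) x (O.op q' C B z y)
  rw [O.map_refl] at this
  rw [this, map_map]
  congr 2
  ext1 (a | (c | b)) <;> rfl

theorem comp_op_op_unit_right {D : Type} [Finite D] (e : A ⊕ (B ⊕ Unit) ≃ Option D)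
    (g : A ⊕ B ≃ D) (h₁ : ∀ a, e (.inl a) = some (g (.inl a)))
    (h₂ : ∀ b, e (.inr (.inl b)) = some (g (.inr b))) (h₀ : e (.inr (.inr ())) = none)
    (x : O.obj A) (y : O.obj B) (z : O.obj C) :
    O.comp D C (O.map e (O.op q A (B ⊕ Unit) x (O.op q' B Unit y O.unit))) z =
      O.map ((Equiv.sumAssoc A B C).symm.trans (g.sumCongr (Equiv.refl C)))
        (O.op q A (B ⊕ C) x (O.op q' B C y z)) := by
  rw [comp_op_right q e (Equiv.optionEquivSumPUnit B).symm g h₁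
      (by rintro (b | _) <;> [exact h₂ b; exact h₀]),
    comp_op_unit_right q' _ (Equiv.refl B) (fun _ => rfl) rfl]
  rw [Equiv.sumCongr_refl, O.map_refl]

end Op

/-! ### Substitution into the ternary operations -/

section Substitution

variable {K : Type u} [Field K] {O : Operad.{u, w'} K}
  {A B C : Type} [Finite A] [Finite B] [Finite C]

/-- The points `0`, `1`, `2` as successively adjoined points, the first one outermost. -/
def tripleSlots : Fin 3 ≃ Option (Option Unit) where
  toFun := ![none, some none, some (some ())]
  invFun
    | none => 0
    | some none => 1
    | some (some _) => 2
  left_inv v := by fin_cases v <;> rfl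
  right_inv := by rintro (_ | _ | _) <;> rfl

/-- `({∗} ⊔ A) ⊔ B ≃ (A ⊔ B) ⊔ {∗}`. -/
def lastSlot (A B : Type) : (Unit ⊕ A) ⊕ B ≃ Option (A ⊕ B) where
  toFun
    | .inl (.inl _) => none
    | .inl (.inr a) => some (.inl a)
    | .inr b => some (.inr b)
  invFun
    | none => .inl (.inl ())
    | some (.inl a) => .inl (.inr a)
    | some (.inr b) => .inr b
  left_inv := by rintro ((_ | a) | b) <;> rfl
  right_inv := by rintro (_ | (a | b)) <;> rfl

/-- The composite of an element of arity three with `x`, `y`, `z` at the points `0`, `1`, `2`. -/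
def substTriple (x : O.obj A) (y : O.obj B) (z : O.obj C) :
    O.obj (Fin 3) →ₗ[K] O.obj ((A ⊕ B) ⊕ C) where
  toFun θ := O.comp (A ⊕ B) C (O.map (lastSlot A B) (O.comp (Unit ⊕ A) B (O.map (starLeft Unit A)
    (O.comp (Option Unit) A (O.map tripleSlots θ) x)) y)) z
  map_add' := by simp
  map_smul' := by simp

theorem substTriple_apply (x : O.obj A) (y : O.obj B) (z : O.obj C) (θ : O.obj (Fin 3)) :
    substTriple x y z θ = O.comp (A ⊕ B) C (O.map (lastSlot A B)
      (O.comp (Unit ⊕ A) B (O.map (starLeft Unit A)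
        (O.comp (Option Unit) A (O.map tripleSlots θ) x)) y)) z := rfl

variable (q q' : O.obj (Fin 2)) (x : O.obj A) (y : O.obj B) (z : O.obj C)

/-- The element `q_{i ∗} ∘_∗ q'_{j k}` of arity three. -/
def ternary (q q' : O.obj (Fin 2)) (i j k : Fin 3)
    (h : Function.Bijective (Sum.elim (fun _ => i) ![j, k] : Unit ⊕ Fin 2 → Fin 3)) :
    O.obj (Fin 3) :=
  O.map (place i j k h) (O.comp Unit (Fin 2) (O.map starPair q) q')

theorem ternary_eq (i j k : Fin 3)
    (h : Function.Bijective (Sum.elim (fun _ => i) ![j, k] : Unit ⊕ Fin 2 → Fin 3)) :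
    ternary q q' i j k h =
      O.map (((Equiv.refl Unit).sumCongr pairUnits).trans (place i j k h))
        (O.op q Unit (Unit ⊕ Unit) O.unit (O.op q' Unit Unit O.unit O.unit)) := by
  have := op_map q (Equiv.refl Unit) pairUnits O.unit (O.op q' Unit Unit O.unit O.unit)
  rw [op_unit_unit, O.map_refl, map_map, Equiv.symm_trans_self, O.map_refl] at this
  rw [ternary, comp_starPair_eq_op, this, map_map, op_unit_unit]

theorem substTriple_ternary_first (h) : substTriple x y z (ternary q q' 0 1 2 h) =
    O.map (Equiv.sumAssoc A B C).symm (O.op q A (B ⊕ C) x (O.op q' B C y z)) := by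
  rw [ternary_eq, substTriple_apply, map_map, comp_op_unit_left q _
    ((Equiv.sumComm _ _).trans (Equiv.optionEquivSumPUnit Unit).symm) rfl
    (by rintro (_ | _) <;> rfl), map_map, comp_op_op_unit_left (B' := Unit) q' _ (Equiv.sumComm A Unit)
    (fun _ => rfl) rfl (fun _ => rfl), map_map, comp_op_op_unit_right q' _ (Equiv.refl _)
    (fun _ => rfl) (fun _ => rfl) rfl]
  simp

theorem substTriple_ternary_last (h) : substTriple x y z (ternary q q' 2 0 1 h) =
    O.map (Equiv.sumComm C (A ⊕ B)) (O.op q C (A ⊕ B) z (O.op q' A B x y)) := by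
  rw [ternary_eq, substTriple_apply, map_map, comp_op_op_unit_left (B' := Unit) q' _
    (Equiv.optionEquivSumPUnit Unit).symm (fun _ => rfl) rfl (fun _ => rfl), map_map,
    comp_op_op_unit_right q' _ (Equiv.refl _) (fun _ => rfl) (fun _ => rfl) rfl, map_map,
    comp_op_unit_left q _ (Equiv.refl _) rfl (by rintro (_ | _) <;> rfl)]
  simp

theorem substTriple_ternary_middle (h) : substTriple x y z (ternary q q' 1 0 2 h) =
    O.map ((Equiv.sumAssoc B A C).symm.trans ((Equiv.sumComm B A).sumCongr (Equiv.refl C)))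
      (O.op q B (A ⊕ C) y (O.op q' A C x z)) := by
  rw [ternary_eq, substTriple_apply, map_map, comp_op_op_unit_left (B' := Unit) q' _
    ((Equiv.sumComm _ _).trans (Equiv.optionEquivSumPUnit Unit).symm)
    (fun _ => rfl) rfl (fun _ => rfl), map_map,
    comp_op_unit_left q _ (Equiv.sumComm A Unit) rfl (by rintro (_ | _) <;> rfl), map_map,
    comp_op_op_unit_right q' _ (Equiv.sumComm B A) (fun _ => rfl) (fun _ => rfl) rfl]

end Substitution

end Operad

/-! ### The commutative algebra with a symmetric biderivation of an operad -/

section LabelAlgebra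

variable {K : Type u} [Field K]

/-- The defining relations of the presentation, for two elements `p`, `s` of arity two of an
operad: both are symmetric, `p` is associative, and `s` is a derivation for `p` in its second
argument. -/
structure IsSPPair (O : Operad.{u, w'} K) (p s : O.obj (Fin 2)) : Prop where
  symm_left : O.map (Equiv.swap 0 1) p = p
  symm_right : O.map (Equiv.swap 0 1) s = s
  assoc : Operad.ternary p p 2 0 1 (by decide) = Operad.ternary p p 0 1 2 (by decide)
  leibniz : Operad.ternary s p 0 1 2 (by decide) =
    Operad.ternary p s 2 0 1 (by decide) + Operad.ternary p s 1 0 2 (by decide)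

variable {O : Operad.{u, w'} K} {p s : O.obj (Fin 2)}

/-- Elements of `O` with labels in `V`: the product of the spaces `O[A]` over the subsets `A`
of `V`. -/
def LabelAlg (_h : IsSPPair O p s) (V : Type) [Fintype V] : Type w' := ∀ A : Set V, O.obj A

namespace LabelAlg

variable {h : IsSPPair O p s} {V : Type} [Fintype V]

instance : AddCommGroup (LabelAlg h V) := inferInstanceAs (AddCommGroup (∀ A : Set V, O.obj A))

instance : Module K (LabelAlg h V) := inferInstanceAs (Module K (∀ A : Set V, O.obj A))

/-- The component of an element in `O[A]`. -/
def coord (A : Set V) : LabelAlg h V →ₗ[K] O.obj A :=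
  LinearMap.proj (φ := fun A : Set V => O.obj A) A

open Classical in
/-- The inclusion of `O[A]`. -/
def single (h : IsSPPair O p s) (A : Set V) : O.obj A →ₗ[K] LabelAlg h V :=
  LinearMap.single K (fun A : Set V => O.obj A) A

@[ext]
theorem ext {α β : LabelAlg h V} (H : ∀ A, coord A α = coord A β) : α = β := funext H

theorem coord_single_same (A : Set V) (x : O.obj A) : coord A (single h A x) = x :=
  Pi.single_eq_same _ _

theorem coord_single_of_ne {A B : Set V} (hAB : A ≠ B) (x : O.obj B) :
    coord A (single h B x) = 0 := Pi.single_eq_of_ne hAB _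

open Classical in
/-- The element `x ∈ O[B]`, labelled by `f : B → V`; it is `0` if two labels coincide. -/
def lab (h : IsSPPair O p s) {B : Type} [Finite B] (f : B → V) : O.obj B →ₗ[K] LabelAlg h V :=
  if hf : Function.Injective f then
    (single h (Set.range f)).comp (O.map (Equiv.ofInjective f hf))
  else 0

variable {A B C : Type} [Finite A] [Finite B] [Finite C]

theorem lab_of_not_injective {f : B → V} (hf : ¬ Function.Injective f) (x : O.obj B) :
    lab h f x = 0 := by
  rw [lab, dif_neg hf, LinearMap.zero_apply]

theorem coord_lab {f : B → V} (hf : Function.Injective f) (x : O.obj B) :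
    coord (Set.range f) (lab h f x) = O.map (Equiv.ofInjective f hf) x := by
  rw [lab, dif_pos hf, LinearMap.comp_apply, coord_single_same]

theorem coord_lab_of_ne {f : B → V} (x : O.obj B) {D : Set V} (hD : D ≠ Set.range f) :
    coord D (lab h f x) = 0 := by
  by_cases hf : Function.Injective f
  · rw [lab, dif_pos hf, LinearMap.comp_apply, coord_single_of_ne hD]
  · rw [lab_of_not_injective hf, map_zero]

theorem lab_injective {f : B → V} (hf : Function.Injective f) :
    Function.Injective (lab h f) := fun x y hxy => by
  have := congrArg (coord (Set.range f)) hxy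
  rw [coord_lab hf, coord_lab hf] at this
  exact O.map_injective _ this

theorem coord_lab_of_equiv {f : B → V} (x : O.obj B) {D : Set V} (e : B ≃ D)
    (he : ∀ b, (e b : V) = f b) : coord D (lab h f x) = O.map e x := by
  have hf : Function.Injective f := by
    rw [← funext he]
    exact Subtype.val_injective.comp e.injective
  obtain rfl : D = Set.range f := by
    ext v
    exact ⟨fun hv => ⟨e.symm ⟨v, hv⟩, by simp [← he]⟩, by rintro ⟨b, rfl⟩; rw [← he]; exact (e b).2⟩
  rw [coord_lab hf]
  congr 2
  ext b
  exact (he b).symm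

theorem lab_map (σ : A ≃ B) (f : B → V) (x : O.obj A) :
    lab h f (O.map σ x) = lab h (f ∘ σ) x := by
  by_cases hf : Function.Injective f
  · ext D
    by_cases hD : D = Set.range f
    · subst hD
      rw [coord_lab hf, coord_lab_of_equiv (f := f ∘ σ) x (σ.trans (Equiv.ofInjective f hf))
        (fun _ => rfl), O.map_map]
    · rw [coord_lab_of_ne _ hD, coord_lab_of_ne]
      rwa [Set.range_comp, σ.surjective.range_eq, Set.image_univ]
  · rw [lab_of_not_injective hf, lab_of_not_injective]
    exact fun h => hf ((σ.injective_comp f).mp h)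

theorem sum_lab [Fintype (Set V)] (α : LabelAlg h V) :
    ∑ A : Set V, lab h (Subtype.val : A → V) (coord A α) = α := by
  ext D
  rw [map_sum, Finset.sum_eq_single D]
  · rw [coord_lab_of_equiv (f := Subtype.val) _ (Equiv.refl D) (fun _ => rfl), O.map_refl]
  · intro A _ hA
    exact coord_lab_of_ne _ (by rw [Subtype.range_val]; exact hA.symm)
  · exact fun h => (h (Finset.mem_univ _)).elim

theorem induction {P : LabelAlg h V → Prop} (hadd : ∀ α β, P α → P β → P (α + β))
    (hlab : ∀ (A : Set V) (x : O.obj A), P (lab h Subtype.val x)) (α : LabelAlg h V) : P α := by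
  classical
  rw [← sum_lab α]
  refine Finset.sum_induction _ P hadd ?_ fun A _ => hlab A _
  rw [← map_zero (lab h (Subtype.val : (∅ : Set V) → V))]
  exact hlab ∅ 0

open Classical in
/-- The bilinear operation induced by an element of arity two. It vanishes on elements which
share a label. -/
def opLin (h : IsSPPair O p s) (V : Type) [Fintype V] (q : O.obj (Fin 2)) :
    LabelAlg h V →ₗ[K] LabelAlg h V →ₗ[K] LabelAlg h V :=
  LinearMap.mk₂ K (fun α β => ∑ A : Set V, ∑ B : Set V,
      lab h (Sum.elim Subtype.val Subtype.val : A ⊕ B → V) (O.op q A B (coord A α) (coord B β)))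
    (by simp [Finset.sum_add_distrib]) (by simp [Finset.smul_sum])
    (by simp [Finset.sum_add_distrib]) (by simp [Finset.smul_sum])

theorem opLin_lab (q : O.obj (Fin 2)) (f : A → V) (g : B → V) (x : O.obj A) (y : O.obj B) :
    opLin h V q (lab h f x) (lab h g y) = lab h (Sum.elim f g) (O.op q A B x y) := by
  classical
  by_cases hf : Function.Injective f
  swap
  · rw [lab_of_not_injective hf, map_zero, LinearMap.zero_apply, lab_of_not_injective]
    exact fun H => hf (Function.Injective.comp (g := Sum.elim f g) H Sum.inl_injective)
  by_cases hg : Function.Injective g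
  swap
  · rw [lab_of_not_injective hg, map_zero, lab_of_not_injective]
    exact fun H => hg (Function.Injective.comp (g := Sum.elim f g) H Sum.inr_injective)
  rw [opLin, LinearMap.mk₂_apply, Finset.sum_eq_single (Set.range f),
    Finset.sum_eq_single (Set.range g), coord_lab hf, coord_lab hg, O.op_map, lab_map]
  · congr 2
    ext (a | b) <;> rfl
  · intro D _ hD
    rw [coord_lab_of_ne _ hD, map_zero, map_zero]
  · exact fun h => (h (Finset.mem_univ _)).elim
  · intro D _ hD
    refine Finset.sum_eq_zero fun E _ => ?_
    rw [coord_lab_of_ne _ hD, map_zero, LinearMap.zero_apply, map_zero]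
  · exact fun h => (h (Finset.mem_univ _)).elim

theorem opLin_comm {q : O.obj (Fin 2)} (hq : O.map (Equiv.swap 0 1) q = q) (α β : LabelAlg h V) :
    opLin h V q α β = opLin h V q β α := by
  induction α using LabelAlg.induction with
  | hadd α α' hα hα' => rw [map_add, map_add, LinearMap.add_apply, hα, hα']
  | hlab A x =>
  induction β using LabelAlg.induction with
  | hadd β β' hβ hβ' => rw [map_add, map_add, LinearMap.add_apply, hβ, hβ']
  | hlab B y =>
  rw [opLin_lab, opLin_lab, O.op_comm q hq, lab_map]
  congr 2
  funext v
  rcases v with a | b <;> rfl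

theorem opLin_assoc (α β γ : LabelAlg h V) :
    opLin h V p (opLin h V p α β) γ = opLin h V p α (opLin h V p β γ) := by
  induction α using LabelAlg.induction with
  | hadd α α' hα hα' => simp only [map_add, LinearMap.add_apply, hα, hα']
  | hlab A x =>
  induction β using LabelAlg.induction with
  | hadd β β' hβ hβ' => simp only [map_add, LinearMap.add_apply, hβ, hβ']
  | hlab B y =>
  induction γ using LabelAlg.induction with
  | hadd γ γ' hγ hγ' => simp only [map_add, hγ, hγ']
  | hlab C z =>
  have key := congrArg (lab h (Sum.elim (Sum.elim Subtype.val Subtype.val) Subtype.val))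
    (congrArg (Operad.substTriple x y z) h.assoc)
  rw [Operad.substTriple_ternary_last, Operad.substTriple_ternary_first, lab_map, lab_map] at key
  rw [opLin_comm h.symm_left, opLin_lab, opLin_lab, opLin_lab, opLin_lab]
  convert key using 2
  · congr 1; funext v; rcases v with c | (a | b) <;> rfl
  · congr 1; funext v; rcases v with a | (b | c) <;> rfl

theorem opLin_leibniz (α β γ : LabelAlg h V) :
    opLin h V s α (opLin h V p β γ) =
      opLin h V p (opLin h V s α β) γ + opLin h V p β (opLin h V s α γ) := by
  induction α using LabelAlg.induction with
  | hadd α α' hα hα' => simp only [map_add, LinearMap.add_apply, hα, hα']; abel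
  | hlab A x =>
  induction β using LabelAlg.induction with
  | hadd β β' hβ hβ' => simp only [map_add, LinearMap.add_apply, hβ, hβ']; abel
  | hlab B y =>
  induction γ using LabelAlg.induction with
  | hadd γ γ' hγ hγ' => simp only [map_add, hγ, hγ']; abel
  | hlab C z =>
  have key := congrArg (lab h (Sum.elim (Sum.elim Subtype.val Subtype.val) Subtype.val))
    (congrArg (Operad.substTriple x y z) h.leibniz)
  rw [map_add, map_add, Operad.substTriple_ternary_last, Operad.substTriple_ternary_first,
    Operad.substTriple_ternary_middle, lab_map, lab_map, lab_map] at key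
  rw [opLin_comm h.symm_left (opLin h V s _ _)]
  simp only [opLin_lab]
  convert key using 2
  · congr 1; funext v; rcases v with a | (b | c) <;> rfl
  · congr 2; funext v; rcases v with c | (a | b) <;> rfl
  · congr 2; funext v; rcases v with b | (a | c) <;> rfl

instance : NonUnitalCommRing (LabelAlg h V) where
  mul α β := opLin h V p α β
  left_distrib α β γ := map_add (opLin h V p α) β γ
  right_distrib α β γ := LinearMap.map_add₂ (opLin h V p) α β γ
  zero_mul α := LinearMap.map_zero₂ (opLin h V p) α
  mul_zero α := map_zero (opLin h V p α)
  mul_assoc := opLin_assoc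
  mul_comm := opLin_comm h.symm_left

instance : IsScalarTower K (LabelAlg h V) (LabelAlg h V) :=
  ⟨fun c α β => LinearMap.map_smul₂ (opLin h V p) c α β⟩

instance : SMulCommClass K (LabelAlg h V) (LabelAlg h V) :=
  ⟨fun c α β => (map_smul (opLin h V p α) c β).symm⟩

/-- The bracket, a symmetric biderivation. -/
def bracket : LabelAlg h V →ₗ[K] LabelAlg h V →ₗ[K] LabelAlg h V := opLin h V s

theorem lab_mul (f : A → V) (g : B → V) (x : O.obj A) (y : O.obj B) :
    lab h f x * lab h g y = lab h (Sum.elim f g) (O.op p A B x y) := opLin_lab p f g x y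

theorem bracket_lab (f : A → V) (g : B → V) (x : O.obj A) (y : O.obj B) :
    bracket (lab h f x) (lab h g y) = lab h (Sum.elim f g) (O.op s A B x y) := opLin_lab s f g x y

theorem bracket_comm (α β : LabelAlg h V) : bracket α β = bracket β α :=
  opLin_comm h.symm_right α β

theorem bracket_mul (α β γ : LabelAlg h V) :
    bracket α (β * γ) = bracket α β * γ + β * bracket α γ := opLin_leibniz α β γ

end LabelAlg

end LabelAlgebra

/-! ### Partitions into trees -/

section TreePartitions

variable {V : Type} [DecidableEq V]

/-- A family of disjoint trees, given by their vertex sets and edge sets, which together have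
vertex set `A`. -/
structure IsTreePartition (A : Finset V) (P : Finset (Finset V × Finset (Sym2 V))) : Prop where
  isTree : ∀ t ∈ P, IsTree t.1 t.2
  disjoint : ∀ t ∈ P, ∀ t' ∈ P, t ≠ t' → Disjoint t.1 t'.1
  biUnion_eq : P.biUnion Prod.fst = A

namespace IsTreePartition

variable {A B : Finset V} {P Q : Finset (Finset V × Finset (Sym2 V))}

theorem eq_of_mem (hP : IsTreePartition A P) {t t' : Finset V × Finset (Sym2 V)} (ht : t ∈ P)
    (ht' : t' ∈ P) {v : V} (hv : v ∈ t.1) (hv' : v ∈ t'.1) : t = t' := by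
  by_contra h
  exact Finset.disjoint_left.mp (hP.disjoint t ht t' ht' h) hv hv'

/-- By connectedness, a component of one partition is contained in any component of the other one
that it meets, if both have the same edges. -/
theorem fst_subset (hP : IsTreePartition A P) (hQ : IsTreePartition A Q)
    (h : P.biUnion Prod.snd = Q.biUnion Prod.snd) {t t' : Finset V × Finset (Sym2 V)}
    (ht : t ∈ P) (ht' : t' ∈ Q) {v : V} (hv : v ∈ t.1) (hv' : v ∈ t'.1) : t.1 ⊆ t'.1 := by
  refine (hP.isTree t ht).subset_of_closed (X := t'.1) (fun x y hxy hx => ?_) hv hv'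
  obtain ⟨w, hw, hxyw⟩ := Finset.mem_biUnion.mp (h ▸ Finset.mem_biUnion.mpr ⟨t, ht, hxy⟩)
  rw [hQ.eq_of_mem ht' hw hx ((hQ.isTree w hw).mem hxyw (Sym2.mem_mk_left x y))]
  exact (hQ.isTree w hw).mem hxyw (Sym2.mem_mk_right x y)

theorem snd_subset (hP : IsTreePartition A P) (hQ : IsTreePartition A Q)
    (h : P.biUnion Prod.snd = Q.biUnion Prod.snd) {t t' : Finset V × Finset (Sym2 V)}
    (ht : t ∈ P) (ht' : t' ∈ Q) (htt : t.1 ⊆ t'.1) : t.2 ⊆ t'.2 := by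
  intro e he
  obtain ⟨w, hw, hew⟩ := Finset.mem_biUnion.mp (h ▸ Finset.mem_biUnion.mpr ⟨t, ht, he⟩)
  induction e with | _ x y
  rwa [hQ.eq_of_mem ht' hw (htt ((hP.isTree t ht).mem he (Sym2.mem_mk_left x y)))
    ((hQ.isTree w hw).mem hew (Sym2.mem_mk_left x y))]

theorem subset (hP : IsTreePartition A P) (hQ : IsTreePartition A Q)
    (h : P.biUnion Prod.snd = Q.biUnion Prod.snd) : P ⊆ Q := by
  intro t ht
  obtain ⟨v, hv⟩ := (hP.isTree t ht).nonempty
  have hvA : v ∈ Q.biUnion Prod.fst := by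
    rw [hQ.biUnion_eq, ← hP.biUnion_eq]
    exact Finset.mem_biUnion.mpr ⟨t, ht, hv⟩
  obtain ⟨t', ht', hv'⟩ := Finset.mem_biUnion.mp hvA
  have h1 := hP.fst_subset hQ h ht ht' hv hv'
  have h2 := hQ.fst_subset hP h.symm ht' ht hv' hv
  rwa [show t = t' from Prod.ext (h1.antisymm h2)
    ((hP.snd_subset hQ h ht ht' h1).antisymm (hQ.snd_subset hP h.symm ht' ht h2))]

/-- A forest determines its components. -/
theorem eq_of_edges (hP : IsTreePartition A P) (hQ : IsTreePartition A Q)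
    (h : P.biUnion Prod.snd = Q.biUnion Prod.snd) : P = Q :=
  (hP.subset hQ h).antisymm (hQ.subset hP h.symm)

theorem singleton {E : Finset (Sym2 V)} (h : IsTree A E) : IsTreePartition A {(A, E)} where
  isTree := by simpa using h
  disjoint := by simp
  biUnion_eq := by simp

theorem disjoint_of_mem (hP : IsTreePartition A P) (hQ : IsTreePartition B Q)
    (hAB : Disjoint A B) {t t' : Finset V × Finset (Sym2 V)} (ht : t ∈ P) (ht' : t' ∈ Q) :
    Disjoint t.1 t'.1 := by
  rw [← hP.biUnion_eq, ← hQ.biUnion_eq] at hAB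
  exact hAB.mono (Finset.subset_biUnion_of_mem Prod.fst ht)
    (Finset.subset_biUnion_of_mem Prod.fst ht')

theorem union (hP : IsTreePartition A P) (hQ : IsTreePartition B Q) (hAB : Disjoint A B) :
    IsTreePartition (A ∪ B) (P ∪ Q) where
  isTree t ht := (Finset.mem_union.mp ht).elim (hP.isTree t) (hQ.isTree t)
  disjoint t ht t' ht' hne := by
    rcases Finset.mem_union.mp ht with h | h <;> rcases Finset.mem_union.mp ht' with h' | h'
    · exact hP.disjoint t h t' h' hne
    · exact hP.disjoint_of_mem hQ hAB h h'
    · exact (hP.disjoint_of_mem hQ hAB h' h).symm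
    · exact hQ.disjoint t h t' h' hne
  biUnion_eq := by rw [Finset.union_biUnion, hP.biUnion_eq, hQ.biUnion_eq]

theorem disjoint_union (hP : IsTreePartition A P) (hQ : IsTreePartition B Q)
    (hAB : Disjoint A B) : Disjoint P Q := by
  refine Finset.disjoint_left.mpr fun t ht ht' => ?_
  obtain ⟨v, hv⟩ := (hP.isTree t ht).nonempty
  exact Finset.disjoint_left.mp (hP.disjoint_of_mem hQ hAB ht ht') hv hv

theorem disjoint_edges (hP : IsTreePartition A P) (hQ : IsTreePartition B Q)
    (hAB : Disjoint A B) : Disjoint (P.biUnion Prod.snd) (Q.biUnion Prod.snd) := by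
  refine Finset.disjoint_left.mpr fun e he he' => ?_
  obtain ⟨t, ht, het⟩ := Finset.mem_biUnion.mp he
  obtain ⟨t', ht', het'⟩ := Finset.mem_biUnion.mp he'
  induction e with | _ x y
  exact Finset.disjoint_left.mp (hP.disjoint_of_mem hQ hAB ht ht')
    ((hP.isTree t ht).mem het (Sym2.mem_mk_left x y))
    ((hQ.isTree t' ht').mem het' (Sym2.mem_mk_left x y))

end IsTreePartition

/-- The two components of a forest are determined up to order. -/
theorem IsTree.eq_or_swap {A B A' B' : Finset V} {E F E' F' : Finset (Sym2 V)} (hA : IsTree A E)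
    (hB : IsTree B F) (hAB : Disjoint A B) (hA' : IsTree A' E') (hB' : IsTree B' F')
    (hAB' : Disjoint A' B') (h : A ∪ B = A' ∪ B') (h' : E ∪ F = E' ∪ F') :
    ((A, E) = (A', E') ∧ (B, F) = (B', F')) ∨ ((A, E) = (B', F') ∧ (B, F) = (A', E')) := by
  have hP := (IsTreePartition.singleton hA).union (.singleton hB) hAB
  have hQ := (IsTreePartition.singleton hA').union (.singleton hB') hAB'
  rw [← h] at hQ
  have key := hP.eq_of_edges hQ (by
    rw [Finset.union_biUnion, Finset.union_biUnion]
    simpa using h')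
  have := congrArg (fun P : Finset (Finset V × Finset (Sym2 V)) =>
    (P : Set (Finset V × Finset (Sym2 V)))) key
  simp only [Finset.coe_union, Finset.coe_singleton, ← Set.insert_eq] at this
  exact Set.pair_eq_pair_iff.mp this

end TreePartitions

/-! ### Elements attached to trees -/

section TreeMap

variable {K : Type u} [Field K] [CharZero K] {V : Type} [Fintype V] [DecidableEq V]
  {M : Type w} [AddCommGroup M] [Module K M]

/-- By linear independence of the families `addEdge`, there are elements attached to trees whose
sum over the trees joining two given ones is a prescribed symmetric function of the two. -/
theorem exists_treeMap (b : M →ₗ[K] M →ₗ[K] M) (hb : ∀ x y, b x y = b y x) (x : V → M) :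
    ∃ τ : Finset V → Finset (Sym2 V) → M, (∀ v, τ {v} ∅ = x v) ∧
      ∀ A B E F, IsTree A E → IsTree B F → Disjoint A B →
        ∑ i ∈ A, ∑ j ∈ B, τ (A ∪ B) (insert s(i, j) (E ∪ F)) = b (τ A E) (τ B F) := by
  -- induction on the number of vertices of the trees on which `τ` has its final values
  suffices H : ∀ n, ∃ τ : Finset V → Finset (Sym2 V) → M, (∀ v, τ {v} ∅ = x v) ∧
      ∀ A B E F, IsTree A E → IsTree B F → Disjoint A B → (A ∪ B).card ≤ n + 1 →
        ∑ i ∈ A, ∑ j ∈ B, τ (A ∪ B) (insert s(i, j) (E ∪ F)) = b (τ A E) (τ B F) by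
    obtain ⟨τ, h1, h2⟩ := H (Fintype.card V)
    exact ⟨τ, h1, fun A B E F hA hB hAB => h2 A B E F hA hB hAB
      ((Finset.card_le_univ _).trans (Nat.le_succ _))⟩
  intro n
  induction n with
  | zero =>
    refine ⟨fun A _ => ∑ v ∈ A, x v, fun v => Finset.sum_singleton _ _, ?_⟩
    intro A B E F hA hB hAB hcard
    have := (hA.isTwoForest_union hB hAB).two_le_card
    omega
  | succ n ih =>
    obtain ⟨τ, h1, h2⟩ := ih
    -- the values on the trees with vertex set `D`, extended linearly
    have hL : ∀ D : Finset V, ∃ L : (Finset (Sym2 V) →₀ K) →ₗ[K] M,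
        ∀ A B E F, IsTree A E → IsTree B F → Disjoint A B → A ∪ B = D →
          L (addEdge K D (E ∪ F)) = b (τ A E) (τ B F) := by
      intro D
      have hw : ∀ F : {F // IsTwoForest D F}, ∃ m : M, ∀ A B E₁ E₂, IsTree A E₁ → IsTree B E₂ →
          Disjoint A B → A ∪ B = D → E₁ ∪ E₂ = F.1 → m = b (τ A E₁) (τ B E₂) := by
        rintro ⟨F, hF⟩
        obtain ⟨A, B, E₁, E₂, hA, hB, hAB, hD, hE⟩ := hF.exists_trees
        refine ⟨b (τ A E₁) (τ B E₂), ?_⟩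
        intro A' B' E₁' E₂' hA' hB' hAB' hD' hE'
        rcases hA.eq_or_swap hB hAB hA' hB' hAB' (hD.trans hD'.symm) (hE.trans hE'.symm) with
          ⟨e, e'⟩ | ⟨e, e'⟩ <;> cases e <;> cases e'
        · rfl
        · exact hb _ _
      choose w hw using hw
      obtain ⟨g, hg⟩ := LinearMap.exists_leftInverse_of_injective
        (Finsupp.linearCombination K fun F : {F // IsTwoForest D F} => addEdge K D F.1)
        (linearIndependent_iff_ker.mp (linearIndependent_addEdge K D))
      refine ⟨(Finsupp.linearCombination K w).comp g, ?_⟩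
      rintro A B E F hA hB hAB rfl
      have hF := hA.isTwoForest_union hB hAB
      have := LinearMap.congr_fun hg (Finsupp.single ⟨_, hF⟩ 1)
      rw [LinearMap.comp_apply, Finsupp.linearCombination_single, one_smul] at this
      rw [LinearMap.comp_apply, this, LinearMap.id_apply, Finsupp.linearCombination_single,
        one_smul]
      exact hw ⟨_, hF⟩ A B E F hA hB hAB rfl rfl
    choose L hL using hL
    refine ⟨fun D E => if D.card = n + 2 then L D (Finsupp.single E 1) else τ D E,
      fun v => ?_, ?_⟩
    · simp only [Finset.card_singleton, if_neg (show 1 ≠ n + 2 by omega), h1]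
    · intro A B E F hA hB hAB hcard
      have hA0 := Finset.card_pos.mpr hA.nonempty
      have hB0 := Finset.card_pos.mpr hB.nonempty
      have hcardAB := Finset.card_union_of_disjoint hAB
      simp only [if_neg (show A.card ≠ n + 2 by omega), if_neg (show B.card ≠ n + 2 by omega)]
      split_ifs with hn
      · simp only [← hL _ A B E F hA hB hAB rfl, addEdge_union K hA hB hAB, map_sum]
      · exact h2 A B E F hA hB hAB (by omega)

end TreeMap

/-! ### Pairs of an element and a polynomial attached to a forest -/

section ForestPairs

variable {K : Type u} [Field K] {V : Type} {M : Type w} [NonUnitalCommRing M] [Module K M]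

/-- The bracket of two pairs: on polynomials, it adds an edge between `A` and `B` in all
possible ways. -/
def pairBracket (b : M →ₗ[K] M →ₗ[K] M) (A B : Finset V)
    (x y : M × MvPolynomial (Sym2 V) K) : M × MvPolynomial (Sym2 V) K :=
  (b x.1 y.1, (∑ i ∈ A, ∑ j ∈ B, MvPolynomial.X s(i, j)) * (x.2 * y.2))

theorem pairBracket_comm {b : M →ₗ[K] M →ₗ[K] M} (hb : ∀ x y, b x y = b y x) (A B : Finset V)
    (x y : M × MvPolynomial (Sym2 V) K) : pairBracket b A B x y = pairBracket b B A y x := by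
  rw [pairBracket, pairBracket, hb, mul_comm x.2, Finset.sum_comm]
  simp only [Sym2.eq_swap]

variable [DecidableEq V]

theorem pairBracket_mul {b : M →ₗ[K] M →ₗ[K] M}
    (hbm : ∀ x y z, b x (y * z) = b x y * z + y * b x z) {A B C : Finset V} (hBC : Disjoint B C)
    (x y z : M × MvPolynomial (Sym2 V) K) : pairBracket b A (B ∪ C) x (y * z) =
      pairBracket b A B x y * z + y * pairBracket b A C x z := by
  refine Prod.ext (hbm _ _ _) ?_
  simp only [pairBracket, Prod.snd_mul, Prod.snd_add, Finset.sum_union hBC,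
    Finset.sum_add_distrib]
  ring

variable [IsScalarTower K M M] [SMulCommClass K M M] (τ : Finset V → Finset (Sym2 V) → M)

/-- The pairs formed by the product of the elements `τ` of the trees of a forest with vertex
set `A`, and by the product of its edges, seen as variables. -/
inductive IsForestPair : Finset V → M × MvPolynomial (Sym2 V) K → Prop
  | tree {A : Finset V} {E : Finset (Sym2 V)} (h : IsTree A E) :
      IsForestPair A (τ A E, ∏ e ∈ E, MvPolynomial.X e)
  | mul {A B : Finset V} {x y : M × MvPolynomial (Sym2 V) K} (hx : IsForestPair A x)
      (hy : IsForestPair B y) (h : Disjoint A B) : IsForestPair (A ∪ B) (x * y)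

/-- The span of the pairs attached to the forests with vertex set `A`. -/
def forestPairs (K : Type u) [Field K] [Module K M] (τ : Finset V → Finset (Sym2 V) → M)
    (A : Finset V) : Submodule K (M × MvPolynomial (Sym2 V) K) :=
  Submodule.span K {x | IsForestPair τ A x}

variable {τ}

theorem forestPairs_mul {A B : Finset V} (hAB : Disjoint A B)
    {x y : M × MvPolynomial (Sym2 V) K} (hx : x ∈ forestPairs K τ A) (hy : y ∈ forestPairs K τ B) :
    x * y ∈ forestPairs K τ (A ∪ B) := by
  induction hx, hy using Submodule.span_induction₂ with
  | mem_mem x y hx hy => exact Submodule.subset_span (.mul hx hy hAB)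
  | zero_left => rw [zero_mul]; exact zero_mem _
  | zero_right => rw [mul_zero]; exact zero_mem _
  | add_left _ _ _ _ _ _ h h' => rw [add_mul]; exact add_mem h h'
  | add_right _ _ _ _ _ _ h h' => rw [mul_add]; exact add_mem h h'
  | smul_left c _ _ _ _ h => rw [smul_mul_assoc]; exact Submodule.smul_mem _ c h
  | smul_right c _ _ _ _ h => rw [mul_smul_comm]; exact Submodule.smul_mem _ c h

/-- The derivation property reduces the bracket of two forests to brackets of trees. -/
theorem pairBracket_mem_of_isForestPair {b : M →ₗ[K] M →ₗ[K] M} (hb : ∀ x y, b x y = b y x)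
    (hbm : ∀ x y z, b x (y * z) = b x y * z + y * b x z)
    (hτ : ∀ A B E F, IsTree A E → IsTree B F → Disjoint A B →
      ∑ i ∈ A, ∑ j ∈ B, τ (A ∪ B) (insert s(i, j) (E ∪ F)) = b (τ A E) (τ B F))
    {A B : Finset V} (hAB : Disjoint A B) {x y : M × MvPolynomial (Sym2 V) K}
    (hx : IsForestPair τ A x) (hy : IsForestPair τ B y) :
    pairBracket b A B x y ∈ forestPairs K τ (A ∪ B) := by
  induction hy generalizing A x with
  | @mul B C y z hy hz hBC ihy ihz =>
    rw [Finset.disjoint_union_right] at hAB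
    rw [pairBracket_mul hbm hBC]
    refine add_mem ?_ ?_
    · rw [← Finset.union_assoc]
      exact forestPairs_mul (Finset.disjoint_union_left.mpr ⟨hAB.2, hBC⟩) (ihy hAB.1 hx)
        (Submodule.subset_span hz)
    · rw [Finset.union_left_comm]
      exact forestPairs_mul (Finset.disjoint_union_right.mpr ⟨hAB.1.symm, hBC⟩)
        (Submodule.subset_span hy) (ihz hAB.2 hx)
  | @tree B F hB =>
    induction hx with
    | @mul A C x z hx hz hAC ihx ihz =>
      rw [Finset.disjoint_union_left] at hAB
      rw [pairBracket_comm hb, pairBracket_mul hbm hAC, pairBracket_comm hb, pairBracket_comm hb B C]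
      refine add_mem ?_ ?_
      · rw [Finset.union_right_comm]
        exact forestPairs_mul (Finset.disjoint_union_left.mpr ⟨hAC, hAB.2.symm⟩) (ihx hAB.1)
          (Submodule.subset_span hz)
      · rw [Finset.union_assoc]
        exact forestPairs_mul (Finset.disjoint_union_right.mpr ⟨hAC, hAB.1⟩)
          (Submodule.subset_span hx) (ihz hAB.2)
    | @tree A E hA =>
      have key : pairBracket b A B (τ A E, ∏ e ∈ E, (MvPolynomial.X e : MvPolynomial (Sym2 V) K))
          (τ B F, ∏ e ∈ F, MvPolynomial.X e) = ∑ i ∈ A, ∑ j ∈ B,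
          (τ (A ∪ B) (insert s(i, j) (E ∪ F)), ∏ e ∈ insert s(i, j) (E ∪ F), MvPolynomial.X e) := by
        refine Prod.ext ?_ ?_
        · simp only [Prod.fst_sum]
          exact (hτ A B E F hA hB hAB).symm
        · simp only [pairBracket, Prod.snd_sum, Finset.sum_mul]
          refine Finset.sum_congr rfl fun i hi => Finset.sum_congr rfl fun j hj => ?_
          have hEF : Disjoint E F := by
            have := (IsTreePartition.singleton hA).disjoint_edges (.singleton hB) hAB
            simpa using this
          have hij : s(i, j) ∉ E ∪ F := by
            rw [Finset.mem_union, not_or]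
            exact ⟨fun h => Finset.disjoint_left.mp hAB (hA.mem h (Sym2.mem_mk_right i j)) hj,
              fun h => Finset.disjoint_left.mp hAB hi (hB.mem h (Sym2.mem_mk_left i j))⟩
          rw [Finset.prod_insert hij, Finset.prod_union hEF]
      rw [key]
      exact sum_mem fun i hi => sum_mem fun j hj =>
        Submodule.subset_span (.tree (hA.join hi hB hj hAB))

theorem pairBracket_mem {b : M →ₗ[K] M →ₗ[K] M} (hb : ∀ x y, b x y = b y x)
    (hbm : ∀ x y z, b x (y * z) = b x y * z + y * b x z)
    (hτ : ∀ A B E F, IsTree A E → IsTree B F → Disjoint A B →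
      ∑ i ∈ A, ∑ j ∈ B, τ (A ∪ B) (insert s(i, j) (E ∪ F)) = b (τ A E) (τ B F))
    {A B : Finset V} (hAB : Disjoint A B) {x y : M × MvPolynomial (Sym2 V) K}
    (hx : x ∈ forestPairs K τ A) (hy : y ∈ forestPairs K τ B) :
    pairBracket b A B x y ∈ forestPairs K τ (A ∪ B) := by
  induction hx, hy using Submodule.span_induction₂ with
  | mem_mem x y hx hy => exact pairBracket_mem_of_isForestPair hb hbm hτ hAB hx hy
  | zero_left =>
    convert zero_mem (forestPairs K τ (A ∪ B)) using 1
    simp [pairBracket]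
  | zero_right =>
    convert zero_mem (forestPairs K τ (A ∪ B)) using 1
    simp [pairBracket]
  | add_left x y z _ _ _ h h' =>
    convert add_mem h h' using 1
    simp [pairBracket, add_mul, mul_add]
  | add_right x y z _ _ _ h h' =>
    convert add_mem h h' using 1
    simp [pairBracket, mul_add]
  | smul_left c x y _ _ h =>
    convert Submodule.smul_mem _ c h using 1
    simp [pairBracket]
  | smul_right c x y _ _ h =>
    convert Submodule.smul_mem _ c h using 1
    simp [pairBracket]

/-- The product over the components is taken in the unitization, as `M` has no unit. -/
theorem IsForestPair.exists_partition {A : Finset V} {x : M × MvPolynomial (Sym2 V) K}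
    (hx : IsForestPair τ A x) : ∃ P, IsTreePartition A P ∧
      (x.1 : Unitization K M) = ∏ t ∈ P, (τ t.1 t.2 : Unitization K M) ∧
      x.2 = ∏ e ∈ P.biUnion Prod.snd, MvPolynomial.X e := by
  induction hx with
  | tree h => exact ⟨_, .singleton h, by simp, by simp⟩
  | mul hx hy hAB ihx ihy =>
    obtain ⟨P, hP, hP1, hP2⟩ := ihx
    obtain ⟨Q, hQ, hQ1, hQ2⟩ := ihy
    refine ⟨P ∪ Q, hP.union hQ hAB, ?_, ?_⟩
    · rw [Finset.prod_union (hP.disjoint_union hQ hAB), ← hP1, ← hQ1, Prod.fst_mul,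
        Unitization.inr_mul]
    · rw [Finset.union_biUnion, Finset.prod_union (hP.disjoint_edges hQ hAB), ← hP2, ← hQ2,
        Prod.snd_mul]

theorem linearIndependent_prod_X (K : Type u) [Field K] (σ : Type*) :
    LinearIndependent K fun E : Finset σ => ∏ e ∈ E, (MvPolynomial.X e : MvPolynomial σ K) := by
  classical
  have hinj : Function.Injective fun E : Finset σ => ∑ e ∈ E, Finsupp.single e 1 := by
    intro E F h
    ext e
    have := DFunLike.congr_fun h e
    simp only [Finsupp.finsetSum_apply, Finsupp.single_apply, Finset.sum_ite_eq'] at this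
    by_cases h1 : e ∈ E <;> by_cases h2 : e ∈ F <;> simp_all
  have h : (fun E : Finset σ => ∏ e ∈ E, (MvPolynomial.X e : MvPolynomial σ K)) =
      MvPolynomial.basisMonomials σ K ∘ fun E : Finset σ => ∑ e ∈ E, Finsupp.single e 1 := by
    funext E
    simp [MvPolynomial.coe_basisMonomials, MvPolynomial.monomial_sum_one, MvPolynomial.X]
  rw [h]
  exact (MvPolynomial.basisMonomials σ K).linearIndependent.comp _ hinj

/-- Since a forest is determined by its edges, the second component of an element of the span
determines the first one. -/
theorem eq_zero_of_mem_forestPairs {A : Finset V} {α : M}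
    (h : (α, (0 : MvPolynomial (Sym2 V) K)) ∈ forestPairs K τ A) : α = 0 := by
  let v : {P // IsTreePartition A P} → Unitization K M × MvPolynomial (Sym2 V) K := fun P =>
    (∏ t ∈ P.1, (τ t.1 t.2 : Unitization K M), ∏ e ∈ P.1.biUnion Prod.snd, MvPolynomial.X e)
  have hv : LinearIndependent K fun P => (v P).2 :=
    (linearIndependent_prod_X K (Sym2 V)).comp
      (fun P : {P // IsTreePartition A P} => P.1.biUnion Prod.snd)
      fun P Q hPQ => Subtype.ext (P.2.eq_of_edges Q.2 hPQ)
  let Λ : M × MvPolynomial (Sym2 V) K →ₗ[K] Unitization K M × MvPolynomial (Sym2 V) K :=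
    (Unitization.inrHom K K M).prodMap LinearMap.id
  have hle : forestPairs K τ A ≤ (Submodule.span K (Set.range v)).comap Λ := by
    refine Submodule.span_le.mpr fun x hx => ?_
    obtain ⟨P, hP, h1, h2⟩ := hx.exists_partition
    exact Submodule.subset_span ⟨⟨P, hP⟩, (Prod.ext h1 h2).symm⟩
  obtain ⟨c, hc⟩ := Finsupp.mem_span_range_iff_exists_finsupp.mp (hle h)
  have hc2 := congrArg Prod.snd hc
  have hc0 : c = 0 := by
    refine (linearIndependent_iff.mp hv) c ?_
    rw [Finsupp.linearCombination_apply]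
    rw [Finsupp.sum, Prod.snd_sum] at hc2
    exact hc2
  rw [hc0, Finsupp.sum_zero_index] at hc
  exact Unitization.inr_injective (R := K) (congrArg Prod.fst hc).symm

end ForestPairs

/-! ### Edge weights on the operad of graphs -/

section Weights

variable {K : Type u} [Field K] {P : Type w} [CommRing P] [Algebra K P]

/-- The product of the weights of the edges of a graph. -/
def edgeProd {V : Type} (wt : Sym2 V → P) (g : SimpleGraph V) : P := ∏ᶠ e ∈ g.edgeSet, wt e

/-- The linear extension of `edgeProd`. With variables as weights, it encodes a graph by the
monomial formed by its edges. -/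
def weight (K : Type u) [Field K] [Algebra K P] {V : Type} [Finite V] (wt : Sym2 V → P) :
    (KG K).obj V →ₗ[K] P :=
  Finsupp.linearCombination K fun g : GraphOn V => edgeProd wt g.graph

theorem weight_single {V : Type} [Finite V] (wt : Sym2 V → P) (g : GraphOn V) (c : K) :
    weight K wt (Finsupp.single g c : GraphOn V →₀ K) = c • edgeProd wt g.graph :=
  Finsupp.linearCombination_single K c g

theorem edgeProd_bot {V : Type} (wt : Sym2 V → P) : edgeProd wt ⊥ = 1 := by
  rw [edgeProd, SimpleGraph.edgeSet_bot, finprod_mem_empty]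

theorem edgeProd_comap_symm {V W : Type} (σ : V ≃ W) (wt : Sym2 W → P) (g : SimpleGraph V) :
    edgeProd wt (g.comap σ.symm) = edgeProd (wt ∘ Sym2.map σ) g := by
  have h : (g.comap σ.symm).edgeSet = Sym2.map σ '' g.edgeSet := by
    ext e
    induction e with | _ x y
    constructor
    · intro h
      exact ⟨s(σ.symm x, σ.symm y), h, by simp⟩
    · rintro ⟨e, he, h⟩
      induction e with | _ a b
      rw [Sym2.map_mk, Sym2.eq_iff] at h
      rcases h with ⟨rfl, rfl⟩ | ⟨rfl, rfl⟩
      · simpa using he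
      · simpa using he.symm
  rw [edgeProd, h, finprod_mem_image ((Sym2.map.injective σ.injective).injOn)]
  rfl

theorem weight_map {V W : Type} [Finite V] [Finite W] (σ : V ≃ W) (wt : Sym2 W → P)
    (x : (KG K).obj V) : weight K wt ((KG K).map σ x) = weight K (wt ∘ Sym2.map σ) x := by
  change GraphOn V →₀ K at x
  induction x using Finsupp.induction_linear with
  | zero => exact (congrArg _ (map_zero _)).trans ((map_zero _).trans (map_zero _).symm)
  | add x y hx hy =>
    exact (congrArg _ (map_add _ _ _)).trans ((map_add _ _ _).trans
      ((congrArg₂ (· + ·) hx hy).trans (map_add _ _ _).symm))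
  | single g c =>
    have : (KG K).map σ (Finsupp.single g c : GraphOn V →₀ K) =
        (Finsupp.single (GraphOn.relabel σ g) c : GraphOn W →₀ K) := Finsupp.mapDomain_single
    rw [this, weight_single, weight_single]
    exact congrArg _ (edgeProd_comap_symm σ wt g.graph)

/-- The weights on `A ⊔ {∗}` obtained by contracting `B` to `∗` and adding up the weights of the
edges joining a point to `B`. The value at the loop at `∗` plays no role. -/
def collapse {A B : Type} [Finite B] (wt : Sym2 (A ⊕ B) → P) : Sym2 (Option A) → P :=
  Sym2.lift ⟨fun x y => match x, y with
    | some a, some a' => wt s(.inl a, .inl a')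
    | none, some a => ∑ᶠ b, wt s(.inl a, .inr b)
    | some a, none => ∑ᶠ b, wt s(.inl a, .inr b)
    | none, none => 1, by
      rintro (_ | a) (_ | a')
      · rfl
      · rfl
      · rfl
      · exact congrArg wt Sym2.eq_swap⟩

theorem edgeProd_option {A : Type} [Finite A] (wt : Sym2 (Option A) → P)
    (g : SimpleGraph (Option A)) : edgeProd wt g =
      edgeProd (wt ∘ Sym2.map some) (g.comap some) *
        ∏ᶠ a : {a // g.Adj none (some a)}, wt s(none, some a.1) := by
  have h : g.edgeSet = Sym2.map some '' (g.comap some).edgeSet ∪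
      Set.range fun a : {a // g.Adj none (some a)} => s(none, some a.1) := by
    ext e
    constructor
    · induction e with | _ x y
      intro h
      rcases x with _ | a <;> rcases y with _ | a'
      · exact (g.irrefl h).elim
      · exact .inr ⟨⟨a', h⟩, rfl⟩
      · exact .inr ⟨⟨a, h.symm⟩, Sym2.eq_swap⟩
      · exact .inl ⟨s(a, a'), h, rfl⟩
    · rintro (⟨e, he, rfl⟩ | ⟨a, rfl⟩)
      · induction e with | _ x y
        exact he
      · exact a.2
  rw [edgeProd, h, finprod_mem_union ?_ (Set.toFinite _) (Set.toFinite _),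
    finprod_mem_image (Sym2.map.injective (Option.some_injective A)).injOn, finprod_mem_range]
  · rfl
  · rintro ⟨a, ha⟩ ⟨b, hb⟩ h
    simpa using h
  · refine Set.disjoint_left.mpr ?_
    rintro _ ⟨e, he, rfl⟩ ⟨a, h⟩
    induction e with | _ x y
    simp at h

theorem edgeProd_insertAlong {A B : Type} [Finite A] [Finite B] (wt : Sym2 (A ⊕ B) → P)
    (g₁ : SimpleGraph (Option A)) (g₂ : SimpleGraph B) (f : g₁.neighborSet none → B) :
    edgeProd wt (insertAlong g₁ g₂ f) =
      edgeProd (wt ∘ Sym2.map .inl) (g₁.comap some) * edgeProd (wt ∘ Sym2.map .inr) g₂ *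
        ∏ᶠ a : {a // g₁.Adj none (some a)}, wt s(.inl a.1, .inr (f ⟨some a.1, a.2⟩)) := by
  have h : (insertAlong g₁ g₂ f).edgeSet = (Sym2.map .inl '' (g₁.comap some).edgeSet ∪
      Sym2.map .inr '' g₂.edgeSet) ∪ Set.range fun a : {a // g₁.Adj none (some a)} =>
        (s(.inl a.1, .inr (f ⟨some a.1, a.2⟩)) : Sym2 (A ⊕ B)) := by
    ext e
    constructor
    · induction e with | _ x y
      intro h
      rcases x with a | b <;> rcases y with a' | b'
      · exact .inl (.inl ⟨s(a, a'), h, rfl⟩)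
      · obtain ⟨h, rfl⟩ := h
        exact .inr ⟨⟨a, h⟩, rfl⟩
      · obtain ⟨h, rfl⟩ := h
        exact .inr ⟨⟨a', h⟩, Sym2.eq_swap⟩
      · exact .inl (.inr ⟨s(b, b'), h, rfl⟩)
    · rintro ((⟨e, he, rfl⟩ | ⟨e, he, rfl⟩) | ⟨a, rfl⟩)
      · induction e with | _ x y
        exact he
      · induction e with | _ x y
        exact he
      · exact ⟨a.2, rfl⟩
  rw [edgeProd, h, finprod_mem_union ?_ (Set.toFinite _) (Set.toFinite _),
    finprod_mem_union ?_ (Set.toFinite _) (Set.toFinite _),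
    finprod_mem_image (Sym2.map.injective Sum.inl_injective).injOn,
    finprod_mem_image (Sym2.map.injective Sum.inr_injective).injOn, finprod_mem_range]
  · rfl
  · rintro ⟨a, ha⟩ ⟨b, hb⟩ h
    simp at h
    exact Subtype.ext h.1
  · refine Set.disjoint_left.mpr ?_
    rintro _ ⟨e, he, rfl⟩ ⟨e', he', h⟩
    induction e with | _ x y
    induction e' with | _ x' y'
    simp at h
  · refine Set.disjoint_left.mpr ?_
    rintro _ (⟨e, he, rfl⟩ | ⟨e, he, rfl⟩) ⟨a, h⟩ <;> induction e with | _ x y <;> simp at h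

theorem sum_edgeProd_insertAlong {A B : Type} [Finite A] [Finite B] (wt : Sym2 (A ⊕ B) → P)
    (g₁ : SimpleGraph (Option A)) (g₂ : SimpleGraph B) :
    ∑ᶠ f : g₁.neighborSet none → B, edgeProd wt (insertAlong g₁ g₂ f) =
      edgeProd (collapse wt) g₁ * edgeProd (wt ∘ Sym2.map .inr) g₂ := by
  classical
  have := Fintype.ofFinite B
  have := Fintype.ofFinite A
  let e : {a // g₁.Adj none (some a)} ≃ g₁.neighborSet none :=
    { toFun := fun a => ⟨some a.1, a.2⟩
      invFun := fun v => match v with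
        | ⟨some a, h⟩ => ⟨a, h⟩
        | ⟨none, h⟩ => (g₁.irrefl h).elim
      left_inv := fun _ => rfl
      right_inv := by
        rintro ⟨_ | a, h⟩
        · exact (g₁.irrefl h).elim
        · rfl }
  have key : ∏ᶠ a : {a // g₁.Adj none (some a)}, collapse wt s(none, some a.1) =
      ∑ᶠ f : g₁.neighborSet none → B,
        ∏ᶠ a : {a // g₁.Adj none (some a)}, wt s(.inl a.1, .inr (f ⟨some a.1, a.2⟩)) := by
    have h1 : ∀ a, collapse wt s(none, some a) = ∑ b, wt s(.inl a, .inr b) := fun a =>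
      finsum_eq_sum_of_fintype _
    simp only [h1, finprod_eq_prod_of_fintype, Fintype.prod_sum]
    rw [← finsum_eq_sum_of_fintype]
    exact finsum_eq_of_bijective (fun f v => f (e.symm v))
      ((Equiv.arrowCongr e (Equiv.refl B)).bijective) fun f => rfl
  have hsome : collapse wt ∘ Sym2.map some = wt ∘ Sym2.map .inl := by
    funext e
    induction e with | _ x y
    rfl
  have := Fintype.ofFinite (g₁.neighborSet none → B)
  rw [edgeProd_option, key, hsome, finsum_eq_sum_of_fintype, finsum_eq_sum_of_fintype,
    Finset.mul_sum, Finset.sum_mul]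
  exact Finset.sum_congr rfl fun f _ => by rw [edgeProd_insertAlong, mul_right_comm]

/-- Insertion becomes a product: the sum over the ways to reattach the edges at `∗` is expanded as
the product of the sums of weights recorded by `collapse`. -/
theorem weight_comp {A B : Type} [Finite A] [Finite B] (wt : Sym2 (A ⊕ B) → P)
    (x : (KG K).obj (Option A)) (y : (KG K).obj B) :
    weight K wt ((KG K).comp A B x y) =
      weight K (collapse wt) x * weight K (wt ∘ Sym2.map .inr) y := by
  have hsum : ∀ g₁ g₂, weight K wt (insertion K g₁ g₂) =
      edgeProd (collapse wt) g₁.graph * edgeProd (wt ∘ Sym2.map .inr) g₂.graph := by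
    intro g₁ g₂
    have := Fintype.ofFinite (g₁.graph.neighborSet none → B)
    rw [← sum_edgeProd_insertAlong, insertion, finsum_eq_sum_of_fintype,
      finsum_eq_sum_of_fintype]
    refine (map_sum (weight K wt) _ _).trans (Finset.sum_congr rfl fun f _ => ?_)
    exact (weight_single wt _ _).trans (one_smul _ _)
  suffices H : ((insertionLin K A B).compr₂ (weight K wt) :
      (GraphOn (Option A) →₀ K) →ₗ[K] (GraphOn B →₀ K) →ₗ[K] P) = (LinearMap.mul K P).compl₁₂
      (weight K (collapse wt)) (weight K (wt ∘ Sym2.map .inr)) from LinearMap.congr_fun₂ H x y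
  refine Finsupp.lhom_ext' fun g₁ => LinearMap.ext_ring (Finsupp.lhom_ext' fun g₂ =>
    LinearMap.ext_ring ?_)
  change weight K wt (insertionLin K A B (Finsupp.single g₁ 1) (Finsupp.single g₂ 1)) =
    weight K (collapse wt) (Finsupp.single g₁ 1 : GraphOn (Option A) →₀ K) *
      weight K (wt ∘ Sym2.map .inr) (Finsupp.single g₂ 1 : GraphOn B →₀ K)
  have h : insertionLin K A B (Finsupp.single g₁ 1) (Finsupp.single g₂ 1) =
      insertion K g₁ g₂ := by
    simp [insertionLin]
  rw [h, hsum, weight_single, weight_single, one_smul, one_smul]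

/-- The weight of the edge joining two adjoined points is the sum of the weights of the edges
joining the two sets that they stand for. -/
theorem weight_op {A B : Type} [Finite A] [Finite B] (wt : Sym2 (A ⊕ B) → P)
    (q : (KG K).obj (Fin 2)) (x : (KG K).obj A) (y : (KG K).obj B) :
    ∃ wt' : Sym2 (Fin 2) → P, wt' s(0, 1) = ∑ᶠ a, ∑ᶠ b, wt s(.inl a, .inr b) ∧
      weight K wt ((KG K).op q A B x y) = weight K wt' q *
        weight K (wt ∘ Sym2.map .inl) x * weight K (wt ∘ Sym2.map .inr) y := by
  rw [Operad.op_apply, weight_map, weight_comp, weight_map, weight_comp, weight_map]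
  refine ⟨_, ?_, congrArg₂ _ (congrArg₂ _ rfl ?_) ?_⟩
  · rfl
  · refine congrArg (fun w => weight K w _) (funext fun e => ?_)
    induction e with | _ a b
    rfl
  · refine congrArg (fun w => weight K w _) (funext fun e => ?_)
    induction e with | _ a b
    rfl

theorem weight_points (wt : Sym2 (Fin 2) → P) : weight K wt (points K) = 1 := by
  rw [points, weight_single, one_smul, edgeProd_bot]

theorem weight_segment (wt : Sym2 (Fin 2) → P) : weight K wt (segment K) = wt s(0, 1) := by
  have h : (⊤ : SimpleGraph (Fin 2)).edgeSet = {s(0, 1)} := by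
    ext e
    induction e with | _ x y
    fin_cases x <;> fin_cases y <;> simp
  rw [segment, weight_single, one_smul, edgeProd, h, finprod_mem_singleton]

theorem weight_unit (wt : Sym2 Unit → P) : weight K wt (KG K).unit = 1 := by
  refine (weight_single wt _ _).trans ?_
  rw [one_smul, edgeProd_bot]

theorem weight_op_points {A B : Type} [Finite A] [Finite B] (wt : Sym2 (A ⊕ B) → P)
    (x : (KG K).obj A) (y : (KG K).obj B) : weight K wt ((KG K).op (points K) A B x y) =
      weight K (wt ∘ Sym2.map .inl) x * weight K (wt ∘ Sym2.map .inr) y := by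
  obtain ⟨wt', -, h⟩ := weight_op wt (points K) x y
  rw [h, weight_points, one_mul]

theorem weight_op_segment {A B : Type} [Finite A] [Finite B] (wt : Sym2 (A ⊕ B) → P)
    (x : (KG K).obj A) (y : (KG K).obj B) : weight K wt ((KG K).op (segment K) A B x y) =
      (∑ᶠ a, ∑ᶠ b, wt s(.inl a, .inr b)) *
        (weight K (wt ∘ Sym2.map .inl) x * weight K (wt ∘ Sym2.map .inr) y) := by
  obtain ⟨wt', hwt', h⟩ := weight_op wt (segment K) x y
  rw [h, weight_segment, hwt', mul_assoc]

/-- Elements of the operad of graphs are determined by their weights. -/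
theorem weight_X_injective (K : Type u) [Field K] (V : Type) [Finite V] :
    Function.Injective (weight K (MvPolynomial.X : Sym2 V → MvPolynomial (Sym2 V) K)) := by
  have hinj : Function.Injective fun g : GraphOn V => (Set.toFinite g.graph.edgeSet).toFinset :=
    fun g g' h => GraphOn.ext (SimpleGraph.edgeSet_injective (by simpa using h))
  have := (linearIndependent_prod_X K (Sym2 V)).comp _ hinj
  have h : ((fun E : Finset (Sym2 V) => ∏ e ∈ E, (MvPolynomial.X e : MvPolynomial (Sym2 V) K)) ∘
      fun g : GraphOn V => (Set.toFinite g.graph.edgeSet).toFinset) =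
      fun g => edgeProd MvPolynomial.X g.graph := by
    funext g
    exact (finprod_mem_eq_finite_toFinset_prod _ _).symm
  rw [h] at this
  exact this

/-- The relations of the presentation hold in the operad of graphs. -/
theorem isSPPair_KG (K : Type u) [Field K] : IsSPPair (KG K) (points K) (segment K) where
  symm_left := weight_X_injective K _ (by rw [weight_map, weight_points, weight_points])
  symm_right := weight_X_injective K _ (by
    rw [weight_map, weight_segment, weight_segment]
    exact congrArg MvPolynomial.X Sym2.eq_swap)
  assoc := weight_X_injective K _ (by
    simp only [Operad.ternary_eq, weight_map, weight_op_points, weight_unit])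
  leibniz := weight_X_injective K _ (by
    simp only [Operad.ternary_eq, map_add, weight_map, weight_op_points, weight_op_segment,
      weight_unit, finsum_eq_sum_of_fintype, Fintype.sum_sum_type]
    simp [place]
    rfl)

end Weights

/-! ### Elements generated by two binary operations -/

section BinaryGen

variable {K : Type u} [Field K]

/-- The elements of `O` obtained from the unit by linear combinations, relabellings and the
operations defined by two elements `p` and `s` of arity two. -/
inductive BinaryGen {O : Operad.{u, w'} K} (p s : O.obj (Fin 2)) :
    (V : Type) → [Finite V] → O.obj V → Prop
  | zero {V : Type} [Finite V] : BinaryGen p s V 0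
  | add {V : Type} [Finite V] {x y : O.obj V} : BinaryGen p s V x → BinaryGen p s V y →
      BinaryGen p s V (x + y)
  | smul {V : Type} [Finite V] (c : K) {x : O.obj V} : BinaryGen p s V x →
      BinaryGen p s V (c • x)
  | unit : BinaryGen p s Unit O.unit
  | map {V W : Type} [Finite V] [Finite W] (σ : V ≃ W) {x : O.obj V} : BinaryGen p s V x →
      BinaryGen p s W (O.map σ x)
  | left {A B : Type} [Finite A] [Finite B] {x : O.obj A} {y : O.obj B} : BinaryGen p s A x →
      BinaryGen p s B y → BinaryGen p s (A ⊕ B) (O.op p A B x y)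
  | right {A B : Type} [Finite A] [Finite B] {x : O.obj A} {y : O.obj B} : BinaryGen p s A x →
      BinaryGen p s B y → BinaryGen p s (A ⊕ B) (O.op s A B x y)

theorem exists_optionCongr {A D : Type} (E : Option A ≃ Option D) (h : E none = none) :
    ∃ g : A ≃ D, E = Equiv.optionCongr g := by
  refine ⟨Equiv.removeNone E, ?_⟩
  ext1 (_ | a)
  · exact h
  · refine (Equiv.removeNone_some E (Option.ne_none_iff_exists'.mp fun h' => ?_)).symm
    exact Option.some_ne_none a (E.injective (h'.trans h.symm))

variable {O : Operad.{u, w'} K} {p s : O.obj (Fin 2)}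

/-- A composite with an element of the form `O.op q A B x y` is a composite with `x` or a composite
with `y`, followed by the same operation. -/
theorem exists_comp_op {A B C D : Type} [Finite A] [Finite B] [Finite C] [Finite D]
    (q : O.obj (Fin 2)) (e : A ⊕ B ≃ Option D) (x : O.obj A) (y : O.obj B) (z : O.obj C) :
    (∃ (A' : Type) (_ : Finite A') (e' : A ≃ Option A') (g : (A' ⊕ C) ⊕ B ≃ D ⊕ C),
      O.comp D C (O.map e (O.op q A B x y)) z =
        O.map g (O.op q (A' ⊕ C) B (O.comp A' C (O.map e' x) z) y)) ∨
    ∃ (B' : Type) (_ : Finite B') (e' : B ≃ Option B') (g : A ⊕ (B' ⊕ C) ≃ D ⊕ C),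
      O.comp D C (O.map e (O.op q A B x y)) z =
        O.map g (O.op q A (B' ⊕ C) x (O.comp B' C (O.map e' y) z)) := by
  classical
  rcases h : e.symm none with a | b
  · left
    let e' : A ≃ Option {c // c ≠ a} := (Equiv.optionSubtypeNe a).symm
    obtain ⟨g, hg⟩ := exists_optionCongr
      ((((e'.sumCongr (Equiv.refl B)).trans (starLeft _ B)).symm).trans e) (by
        change e (.inl (e'.symm none)) = none
        rw [← Equiv.eq_symm_apply, h]
        simp [e'])
    have he : e = (e'.sumCongr (Equiv.refl B)).trans ((starLeft _ B).trans
        (Equiv.optionCongr g)) := by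
      rw [← hg]
      ext1 v
      simp
    refine ⟨_, inferInstance, e', (sumRightComm _ B C).trans (g.sumCongr (Equiv.refl C)), ?_⟩
    rw [he, ← Operad.map_map, ← Operad.op_map, O.map_refl, ← Operad.map_map,
      Operad.comp_map_left, Operad.op_comp_left, Operad.map_map]
  · right
    let e' : B ≃ Option {c // c ≠ b} := (Equiv.optionSubtypeNe b).symm
    obtain ⟨g, hg⟩ := exists_optionCongr
      (((((Equiv.refl A).sumCongr e').trans (starRight A _)).symm).trans e) (by
        change e (.inr (e'.symm none)) = none
        rw [← Equiv.eq_symm_apply, h]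
        simp [e'])
    have he : e = ((Equiv.refl A).sumCongr e').trans ((starRight A _).trans
        (Equiv.optionCongr g)) := by
      rw [← hg]
      ext1 v
      simp
    refine ⟨_, inferInstance, e', (Equiv.sumAssoc A _ C).symm.trans
      (g.sumCongr (Equiv.refl C)), ?_⟩
    rw [he, ← Operad.map_map, ← Operad.op_map, O.map_refl, ← Operad.map_map,
      Operad.comp_map_left, Operad.op_comp_right, Operad.map_map]

/-- The generated elements are closed under composition: a composition at a point of `x` is pushed
towards the leaf of `x` at this point. -/
theorem BinaryGen.comp_map {C B D : Type} [Finite C] [Finite B] [Finite D] {x : O.obj C}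
    {y : O.obj B} (hx : BinaryGen p s C x) (hy : BinaryGen p s B y) (e : C ≃ Option D) :
    BinaryGen p s (D ⊕ B) (O.comp D B (O.map e x) y) := by
  induction hx generalizing D with
  | zero => simpa using BinaryGen.zero
  | add _ _ hx hx' => simpa using (hx e).add (hx' e)
  | smul c _ hx => simpa using (hx e).smul c
  | unit =>
    obtain ⟨g, hg⟩ := exists_optionCongr (starOnly.symm.trans e) (by
      rcases h : e () with _ | d
      · exact h
      · have := e.symm.injective (a₁ := none) (a₂ := some d) (Subsingleton.elim _ _)
        simp at this)
    have he : e = starOnly.trans (Equiv.optionCongr g) := by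
      rw [← hg]
      ext1 v
      simp
    rw [he, ← Operad.map_map, Operad.comp_map_left, O.unit_comp]
    exact (hy.map _).map _
  | map σ _ hx =>
    rw [Operad.map_map]
    exact hx _
  | @left A A' _ _ x x' hx hx' ihx ihx' =>
    obtain ⟨_, _, e', g, h⟩ | ⟨_, _, e', g, h⟩ := exists_comp_op p e x x' y
    · exact h ▸ ((ihx e').left hx').map g
    · exact h ▸ (hx.left (ihx' e')).map g
  | @right A A' _ _ x x' hx hx' ihx ihx' =>
    obtain ⟨_, _, e', g, h⟩ | ⟨_, _, e', g, h⟩ := exists_comp_op s e x x' y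
    · exact h ▸ ((ihx e').right hx').map g
    · exact h ▸ (hx.right (ihx' e')).map g

variable (p s) in
/-- The suboperad of the elements generated by two binary operations. -/
def binaryGen : Suboperad O where
  carrier V _ :=
    { carrier := {x | BinaryGen p s V x}
      zero_mem' := .zero
      add_mem' := .add
      smul_mem' := fun c _ => .smul c }
  map_mem σ _ hx := hx.map σ
  unit_mem := .unit
  comp_mem {A B} _ _ x y hx hy := by
    have := hx.comp_map hy (Equiv.refl (Option A))
    rwa [O.map_refl] at this

theorem BinaryGen.left_mem : BinaryGen p s (Fin 2) p := by
  have := ((BinaryGen.unit (p := p) (s := s)).left .unit).map Operad.pairUnits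
  rwa [Operad.op_unit_unit, Operad.map_map, Equiv.symm_trans_self, O.map_refl] at this

theorem BinaryGen.right_mem : BinaryGen p s (Fin 2) s := by
  have := ((BinaryGen.unit (p := p) (s := s)).right .unit).map Operad.pairUnits
  rwa [Operad.op_unit_unit, Operad.map_map, Equiv.symm_trans_self, O.map_refl] at this

end BinaryGen

/-! ### Injectivity of morphisms to the operad of graphs -/

section Injectivity

variable {K : Type u} [Field K] {O : Operad.{u, w} K} {Q : Operad.{u, w'} K}

theorem Operad.Hom.map_op (ψ : Operad.Hom O Q) (q : O.obj (Fin 2)) {A B : Type} [Finite A]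
    [Finite B] (x : O.obj A) (y : O.obj B) : ψ.toFun (A ⊕ B) (O.op q A B x y) =
      Q.op (ψ.toFun (Fin 2) q) A B (ψ.toFun A x) (ψ.toFun B y) := by
  simp only [Operad.op_apply, ψ.map_map, ψ.map_comp]

variable {p s : O.obj (Fin 2)}

theorem exists_range_sum {C D V : Type} [Finite C] [Finite D] [DecidableEq V] {f : C ⊕ D → V}
    (hf : Function.Injective f) {A : Finset V} (hA : (A : Set V) = Set.range f) :
    ∃ A₁ A₂ : Finset V, (A₁ : Set V) = Set.range (f ∘ Sum.inl) ∧
      (A₂ : Set V) = Set.range (f ∘ Sum.inr) ∧ Disjoint A₁ A₂ ∧ A₁ ∪ A₂ = A := by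
  refine ⟨(Set.finite_range (f ∘ Sum.inl)).toFinset, (Set.finite_range (f ∘ Sum.inr)).toFinset,
    Set.Finite.coe_toFinset _, Set.Finite.coe_toFinset _, ?_, ?_⟩
  · rw [← Finset.disjoint_coe, Set.Finite.coe_toFinset, Set.Finite.coe_toFinset,
      Set.disjoint_left]
    rintro _ ⟨c, rfl⟩ ⟨d, h⟩
    exact Sum.inr_ne_inl (hf h)
  · rw [← Finset.coe_inj, Finset.coe_union, Set.Finite.coe_toFinset, Set.Finite.coe_toFinset, hA,
      Set.range_comp, Set.range_comp, ← Set.image_union, Set.range_inl_union_range_inr,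
      Set.image_univ]

theorem finsum_comp_eq_sum {B V M : Type*} [AddCommMonoid M] {f : B → V}
    (hf : Function.Injective f) {A : Finset V} (hA : (A : Set V) = Set.range f) (g : V → M) :
    ∑ᶠ b, g (f b) = ∑ i ∈ A, g i := by
  rw [← finsum_mem_range hf, ← hA, finsum_mem_coe_finset]

/-- For an element generated by `p` and `s`, its label element and the weight of its image are
given by the same combination of forests. -/
theorem BinaryGen.lab_weight_mem (h : IsSPPair O p s) (ψ : Operad.Hom O (KG K))
    (hp : ψ.toFun (Fin 2) p = points K) (hs : ψ.toFun (Fin 2) s = segment K)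
    {V : Type} [Fintype V] [DecidableEq V] {τ : Finset V → Finset (Sym2 V) → LabelAlg h V}
    (hτ₁ : ∀ v, τ {v} ∅ = LabelAlg.lab h (fun _ : Unit => v) O.unit)
    (hτ : ∀ A B E F, IsTree A E → IsTree B F → Disjoint A B →
      ∑ i ∈ A, ∑ j ∈ B, τ (A ∪ B) (insert s(i, j) (E ∪ F)) = LabelAlg.bracket (τ A E) (τ B F))
    {B : Type} [Finite B] {x : O.obj B} (hx : BinaryGen p s B x) {f : B → V}
    (hf : Function.Injective f) {A : Finset V} (hA : (A : Set V) = Set.range f) :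
    (LabelAlg.lab h f x, weight K (MvPolynomial.X ∘ Sym2.map f) (ψ.toFun B x)) ∈
      forestPairs K τ A := by
  induction hx generalizing A with
  | zero =>
    rw [map_zero, map_zero, map_zero]
    exact zero_mem _
  | add _ _ hx hx' =>
    rw [map_add, map_add, map_add]
    exact add_mem (hx hf hA) (hx' hf hA)
  | smul c _ hx =>
    rw [map_smul, map_smul, map_smul]
    exact Submodule.smul_mem _ c (hx hf hA)
  | unit =>
    obtain rfl : A = {f ()} := by
      ext v
      rw [← Finset.mem_coe, hA, Finset.mem_singleton]
      exact ⟨fun ⟨_, hv⟩ => hv.symm, fun hv => ⟨(), hv.symm⟩⟩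
    rw [ψ.map_unit, weight_unit]
    have := IsForestPair.tree (K := K) (τ := τ) (⟨f (), .root⟩ : IsTree {f ()} ∅)
    rw [hτ₁, Finset.prod_empty] at this
    exact Submodule.subset_span this
  | map σ _ hx =>
    rw [LabelAlg.lab_map, ψ.map_map, weight_map, Function.comp_assoc, ← Sym2.map_comp]
    exact hx (hf.comp σ.injective) (by rw [hA, σ.surjective.range_comp])
  | @left C D _ _ x y _ _ hx hy =>
    obtain ⟨A₁, A₂, h₁, h₂, hdisj, rfl⟩ := exists_range_sum hf hA
    have := forestPairs_mul hdisj (hx (hf.comp Sum.inl_injective) h₁)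
      (hy (hf.comp Sum.inr_injective) h₂)
    rw [Prod.mk_mul_mk, LabelAlg.lab_mul, Sum.elim_comp_inl_inr] at this
    rw [ψ.map_op, hp, weight_op_points, Function.comp_assoc, Function.comp_assoc,
      ← Sym2.map_comp, ← Sym2.map_comp]
    exact this
  | @right C D _ _ x y _ _ hx hy =>
    obtain ⟨A₁, A₂, h₁, h₂, hdisj, rfl⟩ := exists_range_sum hf hA
    have := pairBracket_mem LabelAlg.bracket_comm LabelAlg.bracket_mul hτ hdisj
      (hx (hf.comp Sum.inl_injective) h₁) (hy (hf.comp Sum.inr_injective) h₂)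
    rw [pairBracket, LabelAlg.bracket_lab, Sum.elim_comp_inl_inr,
      ← finsum_comp_eq_sum (hf.comp Sum.inl_injective) h₁] at this
    simp only [← finsum_comp_eq_sum (hf.comp Sum.inr_injective) h₂] at this
    rw [ψ.map_op, hs, weight_op_segment, Function.comp_assoc, Function.comp_assoc,
      ← Sym2.map_comp, ← Sym2.map_comp]
    exact this

/-- A morphism to the operad of graphs which maps a pair satisfying the relations of the
presentation to `points` and `segment` is injective on the elements generated by the pair. -/
theorem BinaryGen.eq_zero [CharZero K] (h : IsSPPair O p s) (ψ : Operad.Hom O (KG K))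
    (hp : ψ.toFun (Fin 2) p = points K) (hs : ψ.toFun (Fin 2) s = segment K)
    {V : Type} [Finite V] {x : O.obj V} (hx : BinaryGen p s V x) (h₀ : ψ.toFun V x = 0) :
    x = 0 := by
  classical
  have := Fintype.ofFinite V
  obtain ⟨τ, hτ₁, hτ⟩ := exists_treeMap (LabelAlg.bracket (h := h) (V := V))
    LabelAlg.bracket_comm fun v => LabelAlg.lab h (fun _ : Unit => v) O.unit
  have key := hx.lab_weight_mem h ψ hp hs hτ₁ hτ (f := id) Function.injective_id
    (A := Finset.univ) (by simp)
  rw [h₀, map_zero] at key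
  exact LabelAlg.lab_injective (h := h) Function.injective_id
    ((eq_zero_of_mem_forestPairs key).trans (map_zero _).symm)

end Injectivity

/-! ### Generated substructures, kernels and ranges -/

section Morphisms

variable {K : Type u} [Field K]

theorem Subspecies.generated_le {S : Species.{u, w} K} {ι : Type} {V : ι → Type}
    [∀ i, Finite (V i)] {x : ∀ i, S.obj (V i)} (R : Subspecies S)
    (hR : ∀ i, x i ∈ R.carrier (V i)) (W : Type) [Finite W] :
    (Subspecies.generated S V x).carrier W ≤ R.carrier W :=
  sInf_le ⟨R, hR, rfl⟩

theorem Suboperad.generated_le {O : Operad.{u, w} K} {ι : Type} {V : ι → Type}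
    [∀ i, Finite (V i)] {x : ∀ i, O.obj (V i)} (P : Suboperad O)
    (hP : ∀ i, x i ∈ P.carrier (V i)) (W : Type) [Finite W] :
    (Suboperad.generated O V x).carrier W ≤ P.carrier W :=
  sInf_le ⟨P, hP, rfl⟩

theorem Suboperad.mem_generated {O : Operad.{u, w} K} {ι : Type} {V : ι → Type}
    [∀ i, Finite (V i)] (x : ∀ i, O.obj (V i)) (i : ι) :
    x i ∈ (Suboperad.generated O V x).carrier (V i) :=
  Submodule.mem_sInf.mpr fun _ ⟨_, hP, h⟩ => h ▸ hP i

theorem OperadIdeal.generated_le {O : Operad.{u, w} K} {R : Subspecies O.toSpecies}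
    (I : OperadIdeal O) (hI : ∀ (V : Type) [Finite V], R.carrier V ≤ I.carrier V) (W : Type)
    [Finite W] : (OperadIdeal.generated R).carrier W ≤ I.carrier W :=
  sInf_le ⟨I, fun V _ => hI V, rfl⟩

theorem OperadIdeal.le_generated {O : Operad.{u, w} K} (R : Subspecies O.toSpecies) (W : Type)
    [Finite W] : R.carrier W ≤ (OperadIdeal.generated R).carrier W :=
  le_sInf fun _ ⟨_, hI, h⟩ => h ▸ hI W

namespace Operad.Hom

variable {O : Operad.{u, w} K} {Q : Operad.{u, w'} K} {Q' : Operad.{u, w''} K}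

/-- The composite of two operad morphisms. -/
def comp (g : Hom Q Q') (f : Hom O Q) : Hom O Q' where
  toFun V _ := (g.toFun V).comp (f.toFun V)
  map_map σ x := by simp only [LinearMap.comp_apply, f.map_map, g.map_map]
  map_unit := by simp only [LinearMap.comp_apply, f.map_unit, g.map_unit]
  map_comp x y := by simp only [LinearMap.comp_apply, f.map_comp, g.map_comp]

/-- The kernel of an operad morphism. -/
def ker (f : Hom O Q) : OperadIdeal O where
  carrier V _ := LinearMap.ker (f.toFun V)
  map_mem σ x hx := by
    rw [LinearMap.mem_ker] at hx ⊢
    rw [f.map_map, hx, map_zero]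
  comp_mem_left x y hx := by
    rw [LinearMap.mem_ker] at hx ⊢
    rw [f.map_comp, hx, map_zero, LinearMap.zero_apply]
  comp_mem_right x y hy := by
    rw [LinearMap.mem_ker] at hy ⊢
    rw [f.map_comp, hy, map_zero]

/-- The range of an operad morphism. -/
def range (f : Hom O Q) : Suboperad Q where
  carrier V _ := LinearMap.range (f.toFun V)
  map_mem σ := by
    rintro _ ⟨x, rfl⟩
    exact ⟨O.map σ x, f.map_map σ x⟩
  unit_mem := ⟨O.unit, f.map_unit⟩
  comp_mem {A B} _ _ := by
    rintro _ _ ⟨x, rfl⟩ ⟨y, rfl⟩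
    exact ⟨O.comp A B x y, f.map_comp x y⟩

/-- The projection to a quotient operad. -/
def mkQ (I : OperadIdeal O) : Hom O (O.quotient I) where
  toFun V _ := (I.carrier V).mkQ
  map_map _ _ := rfl
  map_unit := rfl
  map_comp _ _ := rfl

/-- The morphism induced on a quotient operad. -/
def liftQ (I : OperadIdeal O) (f : Hom O Q)
    (h : ∀ (V : Type) [Finite V], I.carrier V ≤ f.ker.carrier V) : Hom (O.quotient I) Q where
  toFun V _ := (I.carrier V).liftQ (f.toFun V) (h V)
  map_map σ := by
    rintro ⟨x⟩
    exact f.map_map σ x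
  map_unit := f.map_unit
  map_comp := by
    rintro A B _ _ ⟨x⟩ ⟨y⟩
    exact f.map_comp x y

/-- The inclusion of a suboperad. -/
def subtype (P : Suboperad O) : Hom P.toOperad O where
  toFun V _ := (P.carrier V).subtype
  map_map _ _ := rfl
  map_unit := rfl
  map_comp _ _ := rfl

/-- The inverse of a bijective operad morphism. -/
def inverse (f : Hom O Q) (hf : ∀ (V : Type) [Finite V], Function.Bijective (f.toFun V)) :
    Hom Q O where
  toFun V _ := (LinearEquiv.ofBijective (f.toFun V) (hf V)).symm
  map_map {V W} _ _ σ y := by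
    obtain ⟨x, rfl⟩ := (hf V).2 y
    rw [← f.map_map]
    exact (LinearEquiv.ofBijective_symm_apply_apply _ _).trans
      (congrArg _ (LinearEquiv.ofBijective_symm_apply_apply _ _).symm)
  map_unit := by
    rw [← f.map_unit]
    exact LinearEquiv.ofBijective_symm_apply_apply _ _
  map_comp {A B} _ _ y z := by
    obtain ⟨x, rfl⟩ := (hf _).2 y
    obtain ⟨x', rfl⟩ := (hf _).2 z
    rw [← f.map_comp]
    exact (LinearEquiv.ofBijective_symm_apply_apply _ _).trans
      (congrArg₂ (fun a b => O.comp A B a b) (LinearEquiv.ofBijective_symm_apply_apply _ _).symm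
        (LinearEquiv.ofBijective_symm_apply_apply _ _).symm)

theorem map_ternary (f : Hom O Q) (q q' : O.obj (Fin 2)) (i j k : Fin 3) (h) :
    f.toFun (Fin 3) (Operad.ternary q q' i j k h) =
      Operad.ternary (f.toFun (Fin 2) q) (f.toFun (Fin 2) q') i j k h := by
  simp only [Operad.ternary, f.map_map, f.map_comp]

end Operad.Hom

theorem Free.gen_map {G : Species.{u, w} K} {V W : Type} [Finite V] [Finite W] (σ : V ≃ W)
    (x : G.obj V) : Free.gen (G.map σ x) = (Free G).map σ (Free.gen x) :=
  Quot.sound (.gen_map σ x)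

/-- A suboperad of a free operad which contains the generators is the whole operad. -/
theorem Free.mem_of_gen_mem {G : Species.{u, w} K} (P : Suboperad (Free G))
    (hP : ∀ (V : Type) [Finite V] (x : G.obj V), Free.gen x ∈ P.carrier V) {V : Type} [Finite V] :
    ∀ x : (Free G).obj V, x ∈ P.carrier V := by
  suffices H : ∀ t : Term G V, (FreeObj.mk t : (Free G).obj V) ∈ P.carrier V by
    rintro ⟨t⟩
    exact H t
  intro t
  induction t with
  | zero => exact zero_mem _
  | add s t hs ht => exact add_mem hs ht
  | smul c t ht => exact Submodule.smul_mem _ c ht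
  | gen x => exact hP _ x
  | unit => exact P.unit_mem
  | map σ t ht => exact P.map_mem σ ht
  | comp s t hs ht => exact P.comp_mem hs ht

end Morphisms

/-! ### The presentation of the operad `SP` -/

section Presentation

variable (K : Type u) [Field K]

variable {K} in
/-- A subspecies of the species of generators which contains `ptG` and `segG` is the whole
species. -/
theorem mem_of_ptG_segG_mem (T : Subspecies (G K)) (h₀ : ptG K ∈ T.carrier (Fin 2))
    (h₁ : segG K ∈ T.carrier (Fin 2)) {V : Type} [Finite V] (x : (G K).obj V) :
    x ∈ T.carrier V := by
  let T' : Subspecies (KG K).toSpecies :=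
    { carrier := fun V _ => (T.carrier V).map ((genSubspecies K).carrier V).subtype
      map_mem := by
        rintro V W _ _ σ _ ⟨y, hy, rfl⟩
        exact ⟨(G K).map σ y, T.map_mem σ hy, rfl⟩ }
  have hT' : ∀ i, (![points K, segment K] : Fin 2 → _) i ∈ T'.carrier (Fin 2) := by
    intro i
    fin_cases i
    · exact ⟨ptG K, h₀, rfl⟩
    · exact ⟨segG K, h₁, rfl⟩
  obtain ⟨y, hy, h⟩ := Subspecies.generated_le T' hT' V x.2
  rwa [Subtype.ext h] at hy

theorem isBinary_G : IsBinary (G K) := by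
  intro V _ hV x
  -- the property to be proved, as a subspecies
  let T : Subspecies (G K) :=
    { carrier := fun V _ =>
        { carrier := {x | Nat.card V ≠ 2 → x = 0}
          zero_mem' := fun _ => rfl
          add_mem' := fun hx hy hV => by rw [hx hV, hy hV, add_zero]
          smul_mem' := fun c x hx hV => by rw [hx hV, smul_zero] }
      map_mem := fun σ x hx hW => by
        rw [hx ((Nat.card_congr σ).trans_ne hW), map_zero] }
  exact mem_of_ptG_segG_mem T (fun h => (h (Nat.card_fin 2)).elim)
    (fun h => (h (Nat.card_fin 2)).elim) x hV

theorem isQuadratic_R : IsQuadratic (R K) := by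
  intro V _
  have h : ∀ x y i j k h, graft K x y i j k h ∈ (Free.graded (G K) 2).carrier (Fin 3) :=
    fun x y i j k h => Submodule.subset_span (.map _ (.comp (.gen _) (.gen _)))
  refine Subspecies.generated_le _ (fun i => ?_) V
  fin_cases i
  · exact sub_mem (h _ _ _ _ _ _) (h _ _ _ _ _ _)
  · exact sub_mem (sub_mem (h _ _ _ _ _ _) (h _ _ _ _ _ _)) (h _ _ _ _ _ _)

theorem graft_eq_ternary (x y : (G K).obj (Fin 2)) (i j k : Fin 3) (h) :
    graft K x y i j k h = Operad.ternary (Free.gen x) (Free.gen y) i j k h := by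
  rw [graft, Free.gen_map, Operad.ternary]

/-- The inclusion of the generators in `SP` extends to the free operad. -/
theorem exists_hom_Free_SP : ∃ Ψ : Operad.Hom (Free (G K)) (SP K), ∀ (V : Type) [Finite V]
    (x : (G K).obj V), (Ψ.toFun V (Free.gen x)).1 = x.1 := by
  have hle : ∀ (V : Type) [Finite V], (genSubspecies K).carrier V ≤
      (Suboperad.generated (KG K) (fun _ : Fin 2 => Fin 2)
        ![points K, segment K]).carrier V := fun V _ =>
    Subspecies.generated_le _ (Suboperad.mem_generated _) V
  obtain ⟨Ψ, hΨ, -⟩ := Free.existsUnique_hom (G := G K) (SP K)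
    (fun V _ => Submodule.inclusion (hle V)) fun _ _ => rfl
  exact ⟨Ψ, fun V _ x => congrArg Subtype.val (hΨ V x)⟩

/-- The inclusion of `SP` in the operad of graphs. -/
def inclSP : Operad.Hom (SP K) (KG K) := Operad.Hom.subtype _

theorem inclSP_injective (V : Type) [Finite V] : Function.Injective ((inclSP K).toFun V) :=
  Subtype.val_injective

/-- The generators of the quotient satisfy the relations by construction; their symmetry comes from
the species of generators. -/
theorem isSPPair_Ope : IsSPPair (Ope (G K) (R K))
    ((Operad.Hom.mkQ (OperadIdeal.generated (R K))).toFun (Fin 2) (Free.gen (ptG K)))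
    ((Operad.Hom.mkQ (OperadIdeal.generated (R K))).toFun (Fin 2) (Free.gen (segG K))) := by
  let π := Operad.Hom.mkQ (OperadIdeal.generated (R K))
  have hrel : ∀ i, π.toFun (Fin 3) (![rel₁ K, rel₂ K] i) = 0 := fun i =>
    (Submodule.Quotient.mk_eq_zero _).mpr (OperadIdeal.le_generated (R K) (Fin 3)
      (Subspecies.mem_generated (Free (G K)).toSpecies (fun _ : Fin 2 => Fin 3)
        ![rel₁ K, rel₂ K] i))
  have h₁ : π.toFun (Fin 3) (rel₁ K) = 0 := hrel 0
  have h₂ : π.toFun (Fin 3) (rel₂ K) = 0 := hrel 1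
  rw [rel₁, map_sub, graft_eq_ternary, graft_eq_ternary, π.map_ternary, π.map_ternary] at h₁
  rw [rel₂, map_sub, map_sub, graft_eq_ternary, graft_eq_ternary, graft_eq_ternary, π.map_ternary,
    π.map_ternary, π.map_ternary, sub_sub] at h₂
  have hsymm : ∀ x : (G K).obj (Fin 2), (G K).map (Equiv.swap 0 1) x = x →
      (Ope (G K) (R K)).map (Equiv.swap 0 1) (π.toFun (Fin 2) (Free.gen x)) =
        π.toFun (Fin 2) (Free.gen x) := fun x hx =>
    (π.map_map _ _).symm.trans (by rw [← Free.gen_map, hx])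
  exact ⟨hsymm _ (Subtype.ext (isSPPair_KG K).symm_left),
    hsymm _ (Subtype.ext (isSPPair_KG K).symm_right), sub_eq_zero.mp h₁, sub_eq_zero.mp h₂⟩

/-- The morphism extending the inclusion of the generators induces a bijective morphism from the
quotient. -/
theorem exists_hom_Ope_SP [CharZero K] : ∃ ψ : Operad.Hom (Ope (G K) (R K)) (SP K),
    ∀ (V : Type) [Finite V], Function.Bijective (ψ.toFun V) := by
  obtain ⟨Ψ, hΨ⟩ := exists_hom_Free_SP K
  let Φ : Operad.Hom (Free (G K)) (KG K) := (inclSP K).comp Ψ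
  have hpt : Φ.toFun (Fin 2) (Free.gen (ptG K)) = points K := hΨ _ _
  have hseg : Φ.toFun (Fin 2) (Free.gen (segG K)) = segment K := hΨ _ _
  have hR : ∀ (V : Type) [Finite V], (R K).carrier V ≤ Ψ.ker.carrier V := fun V _ => by
    refine Subspecies.generated_le Ψ.ker.toSubspecies (fun i => inclSP_injective K _ ?_) V
    refine Eq.trans ?_ (map_zero _).symm
    fin_cases i
    · change Φ.toFun (Fin 3) (rel₁ K) = 0
      rw [rel₁, map_sub, graft_eq_ternary, graft_eq_ternary, Φ.map_ternary, Φ.map_ternary, hpt,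
        (isSPPair_KG K).assoc, sub_self]
    · change Φ.toFun (Fin 3) (rel₂ K) = 0
      rw [rel₂, map_sub, map_sub, graft_eq_ternary, graft_eq_ternary, graft_eq_ternary,
        Φ.map_ternary, Φ.map_ternary, Φ.map_ternary, hpt, hseg, (isSPPair_KG K).leibniz, sub_sub,
        sub_self]
  let π := Operad.Hom.mkQ (OperadIdeal.generated (R K))
  let ψ : Operad.Hom (Ope (G K) (R K)) (SP K) :=
    Operad.Hom.liftQ _ Ψ (OperadIdeal.generated_le Ψ.ker hR)
  refine ⟨ψ, fun V _ => ⟨(injective_iff_map_eq_zero _).mpr fun x hx => ?_, fun y => ?_⟩⟩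
  · -- every element of the quotient is generated by the classes of the two generators
    let P : Suboperad (Ope (G K) (R K)) := binaryGen (π.toFun (Fin 2) (Free.gen (ptG K)))
      (π.toFun (Fin 2) (Free.gen (segG K)))
    let P' : Suboperad (Free (G K)) :=
      { carrier := fun V _ => (P.carrier V).comap (π.toFun V)
        map_mem := fun σ x hx => P.map_mem σ hx
        unit_mem := P.unit_mem
        comp_mem := fun hx hy => P.comp_mem hx hy }
    have hgen : ∀ (V : Type) [Finite V] (x : (G K).obj V), Free.gen x ∈ P'.carrier V := by
      intro V _ x
      exact mem_of_ptG_segG_mem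
        { carrier := fun V _ => (P'.carrier V).comap Free.gen
          map_mem := fun σ x hx => by
            rw [Submodule.mem_comap, Free.gen_map]
            exact P'.map_mem σ hx } BinaryGen.left_mem BinaryGen.right_mem x
    obtain ⟨t, rfl⟩ := Submodule.Quotient.mk_surjective _ x
    have hmem : BinaryGen (π.toFun (Fin 2) (Free.gen (ptG K)))
      (π.toFun (Fin 2) (Free.gen (segG K))) V (π.toFun V t) := Free.mem_of_gen_mem P' hgen t
    exact hmem.eq_zero (isSPPair_Ope K) ((inclSP K).comp ψ) hpt hseg
      (congrArg Subtype.val hx)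
  · have hle := Suboperad.generated_le Φ.range (V := fun _ : Fin 2 => Fin 2)
      (x := ![points K, segment K]) (fun i => by
        fin_cases i
        · exact ⟨_, hpt⟩
        · exact ⟨_, hseg⟩) V y.2
    obtain ⟨t, ht⟩ := hle
    exact ⟨π.toFun V t, inclSP_injective K V ht⟩

end Presentation

end GraphOperad

end

theorem mainTheorem4 (K : Type*) [Field K] [CharZero K] :
    GraphOperad.Operad.Isomorphic (GraphOperad.SP K)
      (GraphOperad.Ope (GraphOperad.G K) (GraphOperad.R K)) ∧
    GraphOperad.IsBinary (GraphOperad.G K) ∧ GraphOperad.IsQuadratic (GraphOperad.R K) := by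
  obtain ⟨ψ, hψ⟩ := GraphOperad.exists_hom_Ope_SP K
  exact ⟨⟨ψ.inverse hψ, fun V _ => (LinearEquiv.ofBijective (ψ.toFun V) (hψ V)).symm.bijective⟩,
    GraphOperad.isBinary_G K, GraphOperad.isQuadratic_R K⟩
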